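/- Conventions. A signature $S=(\mathrm{ar}(k))_{k\in K}$ is a set $K$ of operation symbols, each with an arity $\mathrm{ar}(k)$, a possibly infinite set; $S$ is finitary if every $\mathrm{ar}(k)$ is finite. For a set $A$, $S+A$ is $S$ extended by a constant (operation of arity $\emptyset$) for each $a\in A$. A theory $\theta$ is a signature with a set of equations between terms; its monad $T_\theta$ on $\mathbf{Set}$ sends $A$ to the set of terms with variables in $A$ modulo the least congruence containing all instances of the equations. The theory $\theta+S$ has the operations of $\theta$ and of $S$ and the equations of $\theta$; the theory $\theta\otimes S$ has in addition, for each operation $c$ of $\theta$ and $k$ of $S$, the equation $c(k(x_{i,j})_{j})_{i}=k(c(x_{i,j})_{i})_{j}$. The monads $T_{\theta+S}$ and $T_{\theta\otimes S}$ are the free extension and the free tensorial extension of $T_\theta$ by $S$. The convex theory has a binary operation $+_p$ for each $p\in(0,1)$ and the equations $x+_px=x$, $x+_py=y+_{1-p}x$, $(x+_py)+_qz=x+_{pq}\bigl(y+_{\frac{(1-p)q}{1-pq}}z\bigr)$; it yields the monad $\mathcal D_{\mathsf f}$ of finitely supported probability distributions, $+_p$ being $(x,y)\mapsto p\,x+(1-p)\,y$.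 The $\omega$-convex theory has an operation $(x_n)_{n\in\mathbb N}\mapsto\sum_n p_n\cdot x_n$ for each sequence $p$ of nonnegative reals summing to $1$, and the equations $\sum_n\delta_{n,m}\cdot x_n=x_m$ and $\sum_np_n\cdot\sum_mq_{n,m}\cdot x_m=\sum_m\bigl(\sum_np_nq_{n,m}\bigr)\cdot x_m$; it yields the monad $\mathcal D$ of discrete probability distributions. Programs. Finitely probabilistic programs over $S$ are the well-founded terms $M::=\mathsf{Req}\,k?(M_i)_{i\in\mathrm{ar}(k)}\mid M+_pM'$ with $p\in(0,1)$; countably probabilistic ones are $M::=\mathsf{Req}\,k?(M_i)_{i\in\mathrm{ar}(k)}\mid\sum_{n\in\mathbb N}p_n\cdot M_n$. With $H_SX=\sum_{k\in K}X^{\mathrm{ar}(k)}$, programs form a system $\zeta:\mathsf{Prog}\to\mathcal D H_S\mathsf{Prog}$: $\mathsf{Req}\,k?(M_i)_i$ goes to the point mass at $(k,(M_i)_i)$, and choices go to the corresponding mixtures. A bisimulation is a relation $R$ such that $R(M,N)$ implies $\zeta(M)[U]\le\zeta(N)[(H_SR)(U)]$ for every $U\subseteq H_S\mathsf{Prog}$,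 where $H_SR$ relates $(k,(x_i)_i)$ to $(k,(y_i)_i)$ if $R(x_i,y_i)$ for all $i$; bisimilarity is the greatest bisimulation. Let $\mathcal D_{\mathsf f,S}$ and $\mathcal D_S$ be the monads sending $A$ to the set of finitely, respectively countably, probabilistic programs over $S+A$ modulo bisimilarity, with the constants $a\in A$ as unit and substitution for these constants as multiplication. Strategies. Plays over $S$ are finite sequences $k_0,i_0,k_1,i_1,\dots$ with $k_r\in K$, $i_r\in\mathrm{ar}(k_r)$; they are active-ending if empty or ending in an input $i_r$, passive-ending if ending in an output $k_r$. A (probabilistic trace) strategy $\sigma$ assigns to each play a number in $[0,1]$ such that $\sigma(\varepsilon)=1$, $\sigma(s.i)=\sigma(s)$ for $s$ passive-ending, and $\sigma(t)=\sum_{k\in K}\sigma(t.k)$ for $t$ active-ending. It is finitely founded if no infinite play has all its prefixes in the support $\{s:\sigma(s)>0\}$ and each active-ending $t$ in the support has only finitely many $k$ with $\sigma(t.k)>0$. A partial counterstrategy is a set $\rho$ of active-ending plays that contains $\varepsilon$, contains $t$ whenever it contains $t.k.i$, and contains $t.k.i$ for at most one $i$, for each $t.k$. A strategy $\sigma$ is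 victorious if for every partial counterstrategy $\rho$ the infimum over $m$ of $\sum\{\sigma(t): t\in\rho \text{ has } m \text{ outputs}\}$ is $0$. Let $\mathsf{FinFound}_S$ and $\mathsf{Vict}_S$ be the monads sending $A$ to the set of finitely founded, respectively victorious, strategies over $S+A$, with unit sending $a$ to the strategy that outputs the constant $a$, and with multiplication given by substitution: when the constant $a$ is output, the strategy substituted for $a$ takes over. Theorem. For every signature $S$: 1. the monad $\mathcal D_{\mathsf f,S}$ is the free extension of $\mathcal D_{\mathsf f}$ by $S$; 2. the monad $\mathcal D_S$ is the free extension of $\mathcal D$ by $S$; 3. the monad $\mathsf{FinFound}_S$ is the free tensorial extension of $\mathcal D_{\mathsf f}$ by $S$; 4. if $S$ is finitary, the monad $\mathsf{Vict}_S$ is the free tensorial extension of $\mathcal D$ by $S$. Here "is" means that there is an isomorphism of monads from $T_{\theta+S}$ (respectively $T_{\theta\otimes S}$), with $\theta$ the convex theory in 1 and 3 and the $\omega$-convex theory in 2 and 4, under which the operations of $\theta$ and of $S$ become the evident ones: probabilistic choice and $\mathsf{Req}\,k?$ on programs, mixtures and output of $k$ followed by the strategy for the input received on strategies; and that $\mathcal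 D_{\mathsf f}$, respectively $\mathcal D$, is in the same way the monad $T_\theta$. -/

import Mathlib

open scoped ENNReal

universe u

namespace ProbIO

/-! ### Signatures, terms, theories and their monads -/

/-- A signature: operation symbols `k`, each with an arity `ar k`, a possibly infinite set. -/
structure Sig : Type (u + 1) where
  K : Type u
  ar : K → Type u

/-- A signature is finitary when every arity is finite. -/
def Sig.Finitary (S : Sig.{u}) : Prop := ∀ k, Finite (S.ar k)

/-- The disjoint union of two signatures. -/
abbrev Sig.sum (S T : Sig.{u}) : Sig.{u} := ⟨S.K ⊕ T.K, Sum.elim S.ar T.ar⟩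

/-- The signature `S + A`: the signature `S` with an additional constant for each `a : A`. -/
abbrev Sig.addConst (S : Sig.{u}) (A : Type u) : Sig.{u} := S.sum ⟨A, fun _ => PEmpty⟩

/-- `S`-terms on a set `A` of variables. -/
inductive Term (S : Sig.{u}) (A : Type u) : Type u
  | var (a : A) : Term S A
  | op (k : S.K) (x : S.ar k → Term S A) : Term S A

namespace Term

variable {S T : Sig.{u}} {A B C : Type u}

/-- Simultaneous substitution. -/
def subst (f : A → Term S B) : Term S A → Term S B
  | var a => f a
  | op k x => op k fun i => (x i).subst f

/-- An `S`-term is in particular an `S.sum T`-term. -/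
def inl : Term S A → Term (S.sum T) A
  | var a => var a
  | op k x => op (Sum.inl k) fun i => (x i).inl

theorem subst_var (t : Term S A) : t.subst var = t := by
  induction t with
  | var a => rfl
  | op k x ih => simp only [subst, ih]

theorem subst_subst (t : Term S A) (f : A → Term S B) (g : B → Term S C) :
    (t.subst f).subst g = t.subst fun a => (f a).subst g := by
  induction t with
  | var a => rfl
  | op k x ih => simp only [subst, ih]

end Term

/-- A congruence on a substitution structure `F` (with unit `η` and substitution `s`): what is
needed to form the quotient monad. -/
structure SubstCongr (F : Type u → Type u) where
  η : ∀ {A : Type u}, A → F A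
  s : ∀ {A B : Type u}, F A → (A → F B) → F B
  r : ∀ A : Type u, Setoid (F A)
  η_s : ∀ {A B : Type u} (a : A) (f : A → F B), s (η a) f = f a
  s_η : ∀ {A : Type u} (x : F A), s x η = x
  s_s : ∀ {A B C : Type u} (x : F A) (f : A → F B) (g : B → F C),
    s (s x f) g = s x fun a => s (f a) g
  congr : ∀ {A B : Type u} {x y : F A} {f g : A → F B}, (r A) x y → (∀ a, (r B) (f a) (g a)) →
    (r B) (s x f) (s y g)

namespace SubstCongr

variable {F : Type u → Type u} (c : SubstCongr F)

/-- The quotient of `F` by a congruence, objectwise. -/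
def Quot (A : Type u) : Type u := Quotient (c.r A)

/-- The class of an element. -/
def cls {A : Type u} (x : F A) : c.Quot A := Quotient.mk (c.r A) x

/-- The quotient monad: unit and substitution are computed on representatives. -/
noncomputable instance : Monad c.Quot where
  pure a := c.cls (c.η a)
  bind {A B} q f := Quotient.liftOn (s := c.r A) q
    (fun x => c.cls (c.s x fun a => Quotient.out (s := c.r B) (f a)))
    fun _ _ h => Quotient.sound (s := c.r B)
      (c.congr h fun a => (c.r B).refl (Quotient.out (s := c.r B) (f a)))

theorem cls_bind {A B : Type u} (x : F A) (f : A → F B) :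
    (c.cls x >>= fun a => c.cls (f a)) = c.cls (c.s x f) :=
  Quotient.sound (s := c.r B)
    (c.congr ((c.r A).refl x) fun a => Quotient.mk_out (s := c.r B) (f a))

theorem exists_rep {A : Type u} (q : c.Quot A) : ∃ x, c.cls x = q := Quotient.exists_rep q

theorem exists_rep_fun {A B : Type u} (f : A → c.Quot B) : ∃ g : A → F B, f = fun a => c.cls (g a) :=
  ⟨fun a => (c.exists_rep (f a)).choose, funext fun a => (c.exists_rep (f a)).choose_spec.symm⟩

instance : LawfulMonad c.Quot := LawfulMonad.mk'
  (id_map := by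
    intro A q
    obtain ⟨x, rfl⟩ := c.exists_rep q
    exact (c.cls_bind x c.η).trans (by rw [c.s_η]))
  (pure_bind := by
    intro A B a f
    obtain ⟨g, rfl⟩ := c.exists_rep_fun f
    exact (c.cls_bind (c.η a) g).trans (by rw [c.η_s]))
  (bind_assoc := by
    intro A B C q f g
    obtain ⟨x, rfl⟩ := c.exists_rep q
    obtain ⟨f, rfl⟩ := c.exists_rep_fun f
    obtain ⟨g, rfl⟩ := c.exists_rep_fun g
    simp only [c.cls_bind, c.s_s])

end SubstCongr

/-- A theory: a signature with a set of equations, each between two terms on a set `B`. -/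
structure Theory : Type (u + 1) where
  sig : Sig.{u}
  eqn : ∀ B : Type u, Term sig B → Term sig B → Prop

namespace Theory

/-- Provable equality: the least congruence on terms on `A` containing every instance of an
equation of the theory. -/
inductive Rel (θ : Theory.{u}) {A : Type u} : Term θ.sig A → Term θ.sig A → Prop
  | refl (t : Term θ.sig A) : Rel θ t t
  | symm {s t : Term θ.sig A} : Rel θ s t → Rel θ t s
  | trans {s t v : Term θ.sig A} : Rel θ s t → Rel θ t v → Rel θ s v
  | congr (k : θ.sig.K) {x y : θ.sig.ar k → Term θ.sig A} :
      (∀ i, Rel θ (x i) (y i)) → Rel θ (Term.op k x) (Term.op k y)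
  | inst {B : Type u} {s t : Term θ.sig B} (h : θ.eqn B s t) (f : B → Term θ.sig A) :
      Rel θ (s.subst f) (t.subst f)

theorem Rel.subst_left {θ : Theory.{u}} {A B : Type u} {s t : Term θ.sig A} (h : θ.Rel s t)
    (f : A → Term θ.sig B) : θ.Rel (s.subst f) (t.subst f) := by
  induction h with
  | refl t => exact .refl _
  | symm _ ih => exact ih.symm
  | trans _ _ ih₁ ih₂ => exact ih₁.trans ih₂
  | congr k _ ih => exact .congr k ih
  | inst h g =>
    rw [Term.subst_subst, Term.subst_subst]
    exact .inst h _

theorem Rel.subst_right {θ : Theory.{u}} {A B : Type u} (t : Term θ.sig A)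
    {f g : A → Term θ.sig B} (h : ∀ a, θ.Rel (f a) (g a)) :
    θ.Rel (t.subst f) (t.subst g) := by
  induction t with
  | var a => exact h a
  | op k x ih => exact .congr k ih

/-- Terms with substitution, modulo provable equality. -/
def termCongr (θ : Theory.{u}) : SubstCongr (Term θ.sig) where
  η := Term.var
  s t f := t.subst f
  r _ := ⟨θ.Rel, ⟨.refl, .symm, .trans⟩⟩
  η_s _ _ := rfl
  s_η := Term.subst_var
  s_s := Term.subst_subst
  congr h h' := (h.subst_left _).trans (Rel.subst_right _ h')

/-- The monad `T_θ` of a theory: terms on `A` modulo provable equality. -/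
abbrev Cls (θ : Theory.{u}) : Type u → Type u := θ.termCongr.Quot

/-- The class of `k(x_i)_{i ∈ ar k}`. -/
def gen (θ : Theory.{u}) (k : θ.sig.K) : θ.Cls (θ.sig.ar k) :=
  θ.termCongr.cls (Term.op k Term.var)

/-- The equations of the free extension `θ + S`: those of `θ`. -/
inductive FreeExtEqn (θ : Theory.{u}) (S : Sig.{u}) :
    ∀ B : Type u, Term (θ.sig.sum S) B → Term (θ.sig.sum S) B → Prop
  | base {B : Type u} {s t : Term θ.sig B} (h : θ.eqn B s t) : FreeExtEqn θ S B s.inl t.inl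

/-- The free extension `θ + S`. -/
def freeExt (θ : Theory.{u}) (S : Sig.{u}) : Theory.{u} := ⟨θ.sig.sum S, FreeExtEqn θ S⟩

/-- The equations of the free tensorial extension `θ ⊗ S`: those of `θ`, and for each operation
`c` of `θ` and `k` of `S` the equation
`c(k(x_{i,j})_j)_i = k(c(x_{i,j})_i)_j` in the variables `x_{i,j}`. -/
inductive TensorExtEqn (θ : Theory.{u}) (S : Sig.{u}) :
    ∀ B : Type u, Term (θ.sig.sum S) B → Term (θ.sig.sum S) B → Prop
  | base {B : Type u} {s t : Term θ.sig B} (h : θ.eqn B s t) : TensorExtEqn θ S B s.inl t.inl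
  | comm (c : θ.sig.K) (k : S.K) : TensorExtEqn θ S (θ.sig.ar c × S.ar k)
      (.op (.inl c) fun i => .op (.inr k) fun j => .var (i, j))
      (.op (.inr k) fun j => .op (.inl c) fun i => .var (i, j))

/-- The free tensorial extension `θ ⊗ S`. -/
def tensorExt (θ : Theory.{u}) (S : Sig.{u}) : Theory.{u} := ⟨θ.sig.sum S, TensorExtEqn θ S⟩

end Theory

/-- An isomorphism of monads. -/
structure MonadIso (M N : Type u → Type u) [Monad M] [Monad N] where
  equiv : ∀ A : Type u, M A ≃ N A
  map_pure : ∀ {A : Type u} (a : A), equiv A (pure a) = pure a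
  map_bind : ∀ {A B : Type u} (x : M A) (f : A → M B),
    equiv B (x >>= f) = equiv A x >>= fun a => equiv B (f a)

/-- The monad `M` is the monad `T_θ` of the theory `θ`, the operation symbol `k` of `θ` acting on
`M` as the operation `(m_i)_i ↦ g k >>= m` (in particular `g k = k(pure i)_i`). -/
def Theory.Presents (θ : Theory.{u}) (M : Type u → Type u) [Monad M]
    (g : ∀ k : θ.sig.K, M (θ.sig.ar k)) : Prop :=
  ∃ Φ : MonadIso θ.Cls M, ∀ k, Φ.equiv _ (θ.gen k) = g k

/-! ### Probabilistic choice -/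

/-- A signature of probabilistic choice operations: the operation `c` chooses `i : ar c` with
probability `weight c i`. -/
structure Choice : Type (u + 1) extends Sig.{u} where
  weight : ∀ c : K, PMF (ar c)

/-- The distribution on two points giving `true` the probability `p` and `false` the probability
`1 - p`. -/
noncomputable def coin (p : Set.Ioo (0 : ℝ) 1) : PMF (ULift.{u} Bool) :=
  PMF.ofFintype (fun b => cond b.down (ENNReal.ofReal p) (ENNReal.ofReal (1 - p))) (by
    rw [← Equiv.sum_comp Equiv.ulift.symm]
    have h0 : (0 : ℝ) ≤ p := p.2.1.le
    have h1 : (0 : ℝ) ≤ 1 - p := sub_nonneg.2 p.2.2.le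
    simp [← ENNReal.ofReal_add h0 h1])

/-- Binary choice: an operation `+_p` for each `p ∈ (0, 1)`, choosing `true` (the left argument)
with probability `p` and `false` (the right argument) with probability `1 - p`. -/
noncomputable def binaryChoice : Choice.{u} where
  K := ULift (Set.Ioo (0 : ℝ) 1)
  ar _ := ULift Bool
  weight p := coin p.down

/-- Countable choice: an `ω`-ary operation `∑ₙ pₙ · -` for each sequence `p` of nonnegative reals
that sum to `1`. -/
noncomputable def countableChoice : Choice.{u} where
  K := PMF (ULift.{u} ℕ)
  ar _ := ULift ℕ
  weight p := p

/-- The term `s +_p t`. -/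
noncomputable def Term.cc {B : Type u} (p : Set.Ioo (0 : ℝ) 1)
    (s t : Term binaryChoice.{u}.toSig B) : Term binaryChoice.{u}.toSig B :=
  .op (ULift.up p) fun b : ULift Bool => cond b.down s t

/-- The convex laws. -/
inductive ConvexEqn : ∀ B : Type u, Term binaryChoice.{u}.toSig B →
    Term binaryChoice.{u}.toSig B → Prop
  | idem {B : Type u} (p : Set.Ioo (0 : ℝ) 1) (x : B) :
      ConvexEqn B (.cc p (.var x) (.var x)) (.var x)
  | comm {B : Type u} (p q : Set.Ioo (0 : ℝ) 1) (h : (q : ℝ) = 1 - p) (x y : B) :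
      ConvexEqn B (.cc p (.var x) (.var y)) (.cc q (.var y) (.var x))
  | assoc {B : Type u} (p q r s : Set.Ioo (0 : ℝ) 1) (hr : (r : ℝ) = p * q)
      (hs : (s : ℝ) = (1 - p) * q / (1 - p * q)) (x y z : B) :
      ConvexEqn B (.cc q (.cc p (.var x) (.var y)) (.var z))
        (.cc r (.var x) (.cc s (.var y) (.var z)))

/-- The convex theory. -/
noncomputable def convexTheory : Theory.{u} := ⟨binaryChoice.toSig, ConvexEqn⟩

/-- The term `∑ₙ pₙ · tₙ`. -/
noncomputable def Term.sum {B : Type u} (p : PMF (ULift.{u} ℕ))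
    (t : ULift.{u} ℕ → Term countableChoice.{u}.toSig B) : Term countableChoice.{u}.toSig B :=
  .op p t

/-- The `ω`-convex laws: `∑ₙ δₙₘ · xₙ = xₘ` and
`∑ₙ pₙ · ∑ₘ qₙₘ · xₘ = ∑ₘ (∑ₙ pₙ qₙₘ) · xₘ`. -/
inductive OmegaConvexEqn : ∀ B : Type u, Term countableChoice.{u}.toSig B →
    Term countableChoice.{u}.toSig B → Prop
  | proj {B : Type u} (m : ULift.{u} ℕ) (x : ULift.{u} ℕ → B) :
      OmegaConvexEqn B (.sum (PMF.pure m) fun n => .var (x n)) (.var (x m))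
  | bary {B : Type u} (p : PMF (ULift.{u} ℕ)) (q : ULift.{u} ℕ → PMF (ULift.{u} ℕ))
      (x : ULift.{u} ℕ → B) :
      OmegaConvexEqn B (.sum p fun n => .sum (q n) fun m => .var (x m))
        (.sum (p.bind q) fun m => .var (x m))

/-- The `ω`-convex theory. -/
noncomputable def omegaConvexTheory : Theory.{u} := ⟨countableChoice.toSig, OmegaConvexEqn⟩

/-- Finitely supported distributions on `A`. (The monad of all discrete distributions is
`PMF`.) -/
def FinDist (A : Type u) : Type u := {d : PMF A // d.support.Finite}

noncomputable instance : Monad FinDist.{u} where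
  pure a := ⟨PMF.pure a, by simp⟩
  bind d f := ⟨d.1.bind fun a => (f a).1, by
    rw [PMF.support_bind]
    exact d.2.biUnion fun a _ => (f a).2⟩

instance : LawfulMonad FinDist.{u} := LawfulMonad.mk'
  (id_map := fun d => Subtype.ext (PMF.bind_pure d.1))
  (pure_bind := fun a f => Subtype.ext (PMF.pure_bind a fun a => (f a).1))
  (bind_assoc := fun d f g => Subtype.ext
    (PMF.bind_bind d.1 (fun a => (f a).1) fun b => (g b).1))

/-- The operations `+_p` on `FinDist`, given by their values `x +_p y` on generators `x`, `y`. -/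
noncomputable def FinDist.gen (c : convexTheory.{u}.sig.K) :
    FinDist (convexTheory.{u}.sig.ar c) :=
  ⟨binaryChoice.weight c, Set.toFinite (α := ULift Bool) _⟩

/-- The operations `∑ₙ pₙ · -` on `PMF`, given by their values `∑ₙ pₙ · xₙ` on generators `xₙ`. -/
noncomputable def distGen (c : omegaConvexTheory.{u}.sig.K) :
    PMF (omegaConvexTheory.{u}.sig.ar c) := countableChoice.weight c


/-! ### Probabilistic systems and bisimilarity -/

/-- `H_S X = ∑ₖ X^(ar k)`. -/
abbrev Sig.H (S : Sig.{u}) (X : Type u) : Type u := Σ k : S.K, S.ar k → X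

/-- The action of `H_S` on relations. -/
inductive HRel (S : Sig.{u}) {X Y : Type u} (R : X → Y → Prop) : S.H X → S.H Y → Prop
  | mk (k : S.K) (x : S.ar k → X) (y : S.ar k → Y) (h : ∀ i, R (x i) (y i)) :
      HRel S R ⟨k, x⟩ ⟨k, y⟩

/-- The action of distributions on relations: `d[U] ≤ e[R(U)]` for every subset `U`. -/
def DRel {X Y : Type u} (R : X → Y → Prop) (d : PMF X) (e : PMF Y) : Prop :=
  ∀ U : Set X, d.toOuterMeasure U ≤ e.toOuterMeasure {y | ∃ x ∈ U, R x y}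

/-- `R` is a bisimulation between the probabilistic systems `(X, ζ)` and `(Y, ξ)`. -/
def IsBisimulation (S : Sig.{u}) {X Y : Type u} (ζ : X → PMF (S.H X)) (ξ : Y → PMF (S.H Y))
    (R : X → Y → Prop) : Prop :=
  ∀ x y, R x y → DRel (HRel S R) (ζ x) (ξ y)

/-- Bisimilarity, the greatest bisimulation, on a probabilistic system `(X, ζ)`. -/
def Bisimilar (S : Sig.{u}) {X : Type u} (ζ : X → PMF (S.H X)) (x y : X) : Prop :=
  ∃ R : X → X → Prop, IsBisimulation S ζ ζ R ∧ R x y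

section BisimilarityFacts

variable {S : Sig.{u}} {X Y Z : Type u}

theorem HRel.mono {R R' : X → Y → Prop} (h : ∀ x y, R x y → R' x y) {a : S.H X} {b : S.H Y}
    (hab : HRel S R a b) : HRel S R' a b := by
  cases hab with
  | mk k x y hxy => exact .mk k x y fun i => h _ _ (hxy i)

theorem DRel.mono {R R' : X → Y → Prop} (h : ∀ x y, R x y → R' x y) {d : PMF X} {e : PMF Y}
    (hde : DRel R d e) : DRel R' d e := fun U =>
  (hde U).trans (e.toOuterMeasure.mono fun _ ⟨x, hx, hxy⟩ => ⟨x, hx, h _ _ hxy⟩)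

theorem DRel.of_refl {R : X → X → Prop} (h : ∀ x, R x x) (d : PMF X) : DRel R d d := fun _ =>
  d.toOuterMeasure.mono fun x hx => ⟨x, hx, h x⟩

theorem DRel.comp {R : X → Y → Prop} {Q : Y → Z → Prop} {d : PMF X} {e : PMF Y} {f : PMF Z}
    (h : DRel R d e) (h' : DRel Q e f) : DRel (fun x z => ∃ y, R x y ∧ Q y z) d f := fun U =>
  ((h U).trans (h' _)).trans (f.toOuterMeasure.mono
    fun _ ⟨y, ⟨x, hx, hxy⟩, hyz⟩ => ⟨x, hx, y, hxy, hyz⟩)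

theorem toOuterMeasure_add_compl (d : PMF X) (U : Set X) :
    d.toOuterMeasure U + d.toOuterMeasure Uᶜ = 1 := by
  rw [PMF.toOuterMeasure_apply, PMF.toOuterMeasure_apply, ← ENNReal.tsum_add, ← d.tsum_coe]
  exact tsum_congr fun x => congrFun (Set.indicator_self_add_compl U d) x

theorem DRel.swap {R : X → Y → Prop} {d : PMF X} {e : PMF Y} (h : DRel R d e) :
    DRel (fun y x => R x y) e d := by
  intro V
  set W : Set X := {x | ∃ y ∈ V, R x y}
  have h1 : d.toOuterMeasure Wᶜ ≤ e.toOuterMeasure Vᶜ :=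
    (h _).trans (e.toOuterMeasure.mono fun y ⟨x, hx, hxy⟩ hy => hx ⟨y, hy, hxy⟩)
  have h2 := toOuterMeasure_add_compl d W
  have h3 := toOuterMeasure_add_compl e V
  have hfin : e.toOuterMeasure Vᶜ ≠ ∞ := ne_top_of_le_ne_top ENNReal.one_ne_top
    (h3 ▸ le_add_self)
  refine (ENNReal.add_le_add_iff_right hfin).1 ?_
  rw [h3, ← h2]
  gcongr

theorem HRel.comp {R : X → Y → Prop} {Q : Y → Z → Prop} {a : S.H X} {b : S.H Y} {c : S.H Z}
    (h : HRel S R a b) (h' : HRel S Q b c) : HRel S (fun x z => ∃ y, R x y ∧ Q y z) a c := by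
  cases h with
  | mk k x y hxy =>
    cases h' with
    | mk _ _ z hyz => exact .mk k x z fun i => ⟨y i, hxy i, hyz i⟩

theorem HRel.swap {R : X → Y → Prop} {a : S.H X} {b : S.H Y} (h : HRel S R a b) :
    HRel S (fun y x => R x y) b a := by
  cases h with
  | mk k x y hxy => exact .mk k y x hxy

theorem Bisimilar.step {ζ : X → PMF (S.H X)} :
    IsBisimulation S ζ ζ (Bisimilar S ζ) := fun x y ⟨R, hR, hxy⟩ =>
  (hR x y hxy).mono fun _ _ => HRel.mono fun _ _ h => ⟨R, hR, h⟩

theorem Bisimilar.equivalence (ζ : X → PMF (S.H X)) : Equivalence (Bisimilar S ζ) where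
  refl x := ⟨Eq, by
    rintro x _ rfl
    exact DRel.of_refl (fun ⟨k, x⟩ => .mk k x x fun _ => rfl) _, rfl⟩
  symm {x y} h := ⟨fun y x => Bisimilar S ζ x y,
    fun y x h => (Bisimilar.step x y h).swap.mono fun _ _ => HRel.swap, h⟩
  trans {x y z} h h' := ⟨fun x z => ∃ y, Bisimilar S ζ x y ∧ Bisimilar S ζ y z,
    fun x z ⟨y, h, h'⟩ => ((Bisimilar.step x y h).comp (Bisimilar.step y z h')).mono
      fun _ _ ⟨_, h, h'⟩ => h.comp h', y, h, h'⟩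

theorem HRel.equivalence {R : X → X → Prop} (hR : Equivalence R) : Equivalence (HRel S R) where
  refl := fun ⟨k, x⟩ => .mk k x x fun _ => hR.refl _
  symm h := h.swap.mono fun _ _ => hR.symm
  trans h h' := (h.comp h').mono fun _ _ ⟨_, h, h'⟩ => hR.trans h h'

/-- Sums over a distribution respect the relation `DRel E`. -/
theorem DRel.tsum_le {E : X → X → Prop} (hE : Equivalence E) {d e : PMF X} (h : DRel E d e)
    (g : X → ℝ≥0∞) (hg : ∀ x y, E x y → g x = g y) :
    ∑' x, d x * g x ≤ ∑' x, e x * g x := by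
  classical
  let s : Setoid X := ⟨E, hE⟩
  let G : Quotient s → ℝ≥0∞ := Quotient.lift g hg
  have key : ∀ d : PMF X, ∑' x, d x * g x =
      ∑' q : Quotient s, d.toOuterMeasure {x | Quotient.mk s x = q} * G q := by
    intro d
    have : ∀ q : Quotient s, d.toOuterMeasure {x | Quotient.mk s x = q} * G q =
        ∑' x, if q = Quotient.mk s x then d x * g x else 0 := by
      intro q
      rw [PMF.toOuterMeasure_apply, ← ENNReal.tsum_mul_right]
      refine tsum_congr fun x => ?_
      by_cases hx : q = Quotient.mk s x
      · subst hx
        simp [Set.indicator, G]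
      · have : ¬ Quotient.mk s x = q := fun h => hx h.symm
        simp [Set.indicator, hx, this]
    simp_rw [this]
    rw [ENNReal.tsum_comm]
    simp
  rw [key, key]
  refine ENNReal.tsum_le_tsum fun q => mul_le_mul_left ((h _).trans
    (e.toOuterMeasure.mono ?_)) _
  rintro y ⟨x, hx, hxy⟩
  exact (Quotient.sound (s := s) (hE.symm hxy)).trans hx

theorem DRel.bind {E : X → X → Prop} (hE : Equivalence E) {d e : PMF X} (h : DRel E d e)
    {Q : Y → Z → Prop} {φ : X → PMF Y} {ψ : X → PMF Z}
    (hφ : ∀ x y, E x y → DRel Q (φ x) (ψ y)) : DRel Q (d.bind φ) (e.bind ψ) := by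
  intro U
  rw [PMF.toOuterMeasure_bind_apply, PMF.toOuterMeasure_bind_apply]
  set V : Set Z := {y | ∃ x ∈ U, Q x y}
  let g : X → ℝ≥0∞ := fun x => ⨅ y, ⨅ _ : E x y, (ψ y).toOuterMeasure V
  have hg : ∀ x y, E x y → g x ≤ g y := fun x y hxy =>
    le_iInf₂ fun z hz => iInf₂_le z (hE.trans hxy hz)
  calc ∑' x, d x * (φ x).toOuterMeasure U
      ≤ ∑' x, d x * g x := ENNReal.tsum_le_tsum fun x =>
        mul_le_mul_right (le_iInf₂ fun y hy => hφ x y hy U) _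
    _ ≤ ∑' x, e x * g x := h.tsum_le hE g fun x y hxy =>
        le_antisymm (hg x y hxy) (hg y x (hE.symm hxy))
    _ ≤ ∑' x, e x * (ψ x).toOuterMeasure V := ENNReal.tsum_le_tsum fun x =>
        mul_le_mul_right (iInf₂_le x (hE.refl x)) _

end BisimilarityFacts

/-! ### Programs -/

/-- Programs over the signature `S`, with the choice operations `C`. -/
inductive Prog (C : Choice.{u}) (S : Sig.{u}) : Type u
  | req (k : S.K) (M : S.ar k → Prog C S) : Prog C S
  | choice (c : C.K) (M : C.ar c → Prog C S) : Prog C S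

namespace Prog

variable {C : Choice.{u}} {S : Sig.{u}} {A B D : Type u}

/-- The probabilistic system of programs: `Req k?(Mᵢ)ᵢ` makes the transition `(k, (Mᵢ)ᵢ)`, and a
choice is resolved according to its weights. -/
noncomputable def step : Prog C S → PMF (S.H (Prog C S))
  | req k M => PMF.pure ⟨k, M⟩
  | choice c M => (C.weight c).bind fun i => (M i).step

/-- The constant `a` of the signature `S + A`, as a program. -/
def const (a : A) : Prog C (S.addConst A) := .req (Sum.inr a) PEmpty.elim

/-- Substitution of `f a` for each constant `a`. -/
def subst (f : A → Prog C (S.addConst B)) : Prog C (S.addConst A) → Prog C (S.addConst B)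
  | req (.inl k) M => req (.inl k) fun i => (M i).subst f
  | req (.inr a) _ => f a
  | choice c M => choice c fun i => (M i).subst f

theorem subst_const (M : Prog C (S.addConst A)) : M.subst const = M := by
  induction M with
  | req k M ih =>
    rcases k with k | a
    · simp only [subst]
      exact congrArg _ (funext ih)
    · simp only [subst, const]
      exact congrArg _ (funext fun i => i.elim)
  | choice c M ih => simp only [subst, ih]

theorem subst_subst (M : Prog C (S.addConst A)) (f : A → Prog C (S.addConst B))
    (g : B → Prog C (S.addConst D)) :
    (M.subst f).subst g = M.subst fun a => (f a).subst g := by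
  induction M with
  | req k M ih =>
    rcases k with k | a
    · simp only [subst]
      exact congrArg _ (funext ih)
    · simp only [subst]
  | choice c M ih => simp only [subst, ih]

/-- The transitions of `M.subst f`, given a transition of `M`. -/
noncomputable def substStep (f : A → Prog C (S.addConst B)) :
    (S.addConst A).H (Prog C (S.addConst A)) → PMF ((S.addConst B).H (Prog C (S.addConst B)))
  | ⟨.inl k, M⟩ => PMF.pure ⟨.inl k, fun i => (M i).subst f⟩
  | ⟨.inr a, _⟩ => (f a).step

theorem step_subst (M : Prog C (S.addConst A)) (f : A → Prog C (S.addConst B)) :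
    (M.subst f).step = M.step.bind (substStep f) := by
  induction M with
  | req k M ih =>
    rcases k with k | a
    · exact (PMF.pure_bind (⟨.inl k, M⟩ : (S.addConst A).H _) (substStep f)).symm
    · exact (PMF.pure_bind (⟨.inr a, M⟩ : (S.addConst A).H _) (substStep f)).symm
  | choice c M ih =>
    simp only [subst, step, PMF.bind_bind]
    exact congrArg _ (funext ih)

theorem bisimilar_subst {M N : Prog C (S.addConst A)}
    {f g : A → Prog C (S.addConst B)} (h : Bisimilar _ step M N)
    (hfg : ∀ a, Bisimilar _ step (f a) (g a)) :
    Bisimilar _ step (M.subst f) (N.subst g) := by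
  refine ⟨fun P Q => (∃ M N, Bisimilar _ step M N ∧ P = M.subst f ∧ Q = N.subst g) ∨
    Bisimilar _ step P Q, ?_, .inl ⟨M, N, h, rfl, rfl⟩⟩
  rintro P Q (⟨M, N, h, rfl, rfl⟩ | h)
  · rw [step_subst, step_subst]
    refine (Bisimilar.step M N h).bind (HRel.equivalence (Bisimilar.equivalence _)) ?_
    rintro _ _ ⟨k | a, x, y, hxy⟩
    · intro U
      classical
      refine (PMF.toOuterMeasure_pure_apply _ U).le.trans ?_
      refine le_trans ?_ (PMF.toOuterMeasure_pure_apply _ _).ge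
      split_ifs with h1 h2
      · exact le_rfl
      · exact absurd ⟨_, h1, .mk _ _ _ fun i => .inl ⟨_, _, hxy i, rfl, rfl⟩⟩ h2
      all_goals exact zero_le
    · exact (Bisimilar.step _ _ (hfg a)).mono fun _ _ => HRel.mono fun _ _ => .inr
  · exact (Bisimilar.step P Q h).mono fun _ _ => HRel.mono fun _ _ => .inr

end Prog

/-- Programs over `S + A` with substitution for the constants in `A`, modulo bisimilarity. -/
noncomputable def progCongr (C : Choice.{u}) (S : Sig.{u}) :
    SubstCongr fun A => Prog C (S.addConst A) where
  η := Prog.const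
  s M f := M.subst f
  r _ := ⟨Bisimilar _ Prog.step, Bisimilar.equivalence _⟩
  η_s _ _ := rfl
  s_η := Prog.subst_const
  s_s := Prog.subst_subst
  congr := Prog.bisimilar_subst

/-- The monad of programs modulo bisimilarity: it sends `A` to the set of programs over `S + A`
modulo bisimilarity. -/
abbrev ProgBisim (C : Choice.{u}) (S : Sig.{u}) : Type u → Type u := (progCongr C S).Quot

/-- The operations of `C` and of `S` on programs modulo bisimilarity. -/
noncomputable def ProgBisim.gen (C : Choice.{u}) (S : Sig.{u}) :
    ∀ k : (C.toSig.sum S).K, ProgBisim C S ((C.toSig.sum S).ar k)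
  | .inl c => (progCongr C S).cls (.choice c fun i => .const i)
  | .inr k => (progCongr C S).cls (.req (.inl k) fun i => .const i)

/-! ### Plays and strategies -/

/-- An active-ending play `k₀, i₀, …, kₙ₋₁, iₙ₋₁`, as the list of the pairs `⟨kᵣ, iᵣ⟩`. Its length
as a play is its length as a list. A passive-ending play `t.k` is given by the active-ending play
`t` and the output `k`. -/
abbrev Play (S : Sig.{u}) : Type u := List (Σ k : S.K, S.ar k)

/-- A play-measure. The function `pass` on passive-ending plays `t.k` determines the function `act`
on active-ending plays by `act t = ∑ₖ pass (t.k)`; the condition is `act (t.k.i) = pass (t.k)`. -/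
@[ext] structure PlayMeasure (S : Sig.{u}) : Type u where
  pass : Play S → S.K → ℝ≥0∞
  pass_eq : ∀ (t : Play S) (k : S.K) (i : S.ar k), ∑' l, pass (t ++ [⟨k, i⟩]) l = pass t k

/-- The value of a play-measure on an active-ending play. -/
noncomputable def PlayMeasure.act {S : Sig.{u}} (σ : PlayMeasure S) (t : Play S) : ℝ≥0∞ :=
  ∑' k, σ.pass t k

/-- A probabilistic trace strategy: a play-measure of weight `1`. -/
@[ext] structure Strategy (S : Sig.{u}) : Type u extends PlayMeasure S where
  weight_eq : ∑' k, pass [] k = 1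

theorem Strategy.act_le_one {S : Sig.{u}} (σ : Strategy S) (t : Play S) : σ.act t ≤ 1 := by
  induction t using List.reverseRecOn with
  | nil => exact σ.weight_eq.le
  | append_singleton t x ih =>
    exact (σ.pass_eq t x.1 x.2).le.trans ((ENNReal.le_tsum x.1).trans ih)

/-- The active-ending prefix of length `n` of an infinite play `k₀, i₀, k₁, i₁, …`. -/
def prefixOf {S : Sig.{u}} (w : ℕ → Σ k : S.K, S.ar k) (n : ℕ) : Play S :=
  List.ofFn fun r : Fin n => w r

/-- There is no infinite play all of whose (active-ending and passive-ending) prefixes are in the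
support. -/
def PlayMeasure.IsWellFounded {S : Sig.{u}} (σ : PlayMeasure S) : Prop :=
  ¬ ∃ w : ℕ → Σ k : S.K, S.ar k, ∀ n, σ.act (prefixOf w n) ≠ 0 ∧ σ.pass (prefixOf w n) (w n).1 ≠ 0

/-- Each active-ending play in the support has finitely many possible outputs. -/
def PlayMeasure.IsFinitelyBranching {S : Sig.{u}} (σ : PlayMeasure S) : Prop :=
  ∀ t, σ.act t ≠ 0 → {k | σ.pass t k ≠ 0}.Finite

/-- Well-founded and finitely branching. -/
def PlayMeasure.IsFinitelyFounded {S : Sig.{u}} (σ : PlayMeasure S) : Prop :=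
  σ.IsWellFounded ∧ σ.IsFinitelyBranching

/-- A partial counterstrategy, given by its set of active-ending plays; its passive-ending plays
are the plays `t.k` with `t ∈ act`. Each of these has at most one prescribed input. -/
structure PartialCounterstrategy (S : Sig.{u}) : Type u where
  act : Set (Play S)
  nil_mem : [] ∈ act
  mem_of_append_mem : ∀ (t : Play S) (k : S.K) (i : S.ar k), t ++ [⟨k, i⟩] ∈ act → t ∈ act
  input_unique : ∀ (t : Play S) (k : S.K) (i j : S.ar k),
    t ++ [⟨k, i⟩] ∈ act → t ++ [⟨k, j⟩] ∈ act → i = j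

/-- The probability that play between `σ` and `ρ` lasts for at least `m` output-input cycles. -/
noncomputable def contProb {S : Sig.{u}} (ρ : PartialCounterstrategy S) (σ : PlayMeasure S)
    (m : ℕ) : ℝ≥0∞ :=
  ∑' s : {s : Play S // s ∈ ρ.act ∧ s.length = m}, σ.act s.1

/-- Against every partial counterstrategy, the probability that play lasts forever is `0`. -/
def PlayMeasure.IsVictorious {S : Sig.{u}} (σ : PlayMeasure S) : Prop :=
  ∀ ρ : PartialCounterstrategy S, ⨅ m, contProb ρ σ m = 0

/-! ### Substitution of strategies

Constants have no inputs, so an active-ending play over `S + A` is essentially one over `S`. The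
values of a play-measure over `S + A` are thus given by a function `List X → K ⊕ A → ℝ≥0∞`, where
`X` is the set of pairs `⟨k, i⟩` and `K ⊕ A` is the set of outputs. -/

/-- Substitution of `f a` for each constant `a` in `σ`: whenever `σ` outputs `a ∈ A`, the strategy
`f a` takes over. Thus the value on `t.l` is the sum of `σ (t.l)`, if `l` is an output of `S`, and
of the products `σ (t'.a) * f a (t''.l)`, for `t = t' ++ t''` and `a ∈ A`. -/
noncomputable def bindPass {X K A B : Type u} (f : A → List X → K ⊕ B → ℝ≥0∞) :
    (List X → K ⊕ A → ℝ≥0∞) → List X → K ⊕ B → ℝ≥0∞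
  | σ, [], l => Sum.elim (fun k => σ [] (.inl k)) (fun _ => 0) l +
      ∑' a, σ [] (.inr a) * f a [] l
  | σ, x :: s, l => bindPass f (fun t => σ (x :: t)) s l + ∑' a, σ [] (.inr a) * f a (x :: s) l

/-- The strategy that outputs a constant `a ∈ A`, chosen with the distribution `d`. -/
noncomputable def distPass {X K A : Type u} (d : PMF A) : List X → K ⊕ A → ℝ≥0∞
  | [], .inr a => d a
  | _, _ => 0

open Classical in
/-- The strategy that outputs `k` and, after the input `i`, outputs the constant `i`. -/
noncomputable def reqPass {S : Sig.{u}} (k : S.K) :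
    List (Σ k : S.K, S.ar k) → S.K ⊕ S.ar k → ℝ≥0∞
  | [], .inl l => if l = k then 1 else 0
  | [x], .inr j => if x = ⟨k, j⟩ then 1 else 0
  | _, _ => 0

section PassFacts

variable {X K A B D : Type u}

theorem tsum_sum_type {α β : Type u} (f : α ⊕ β → ℝ≥0∞) :
    ∑' x, f x = ∑' a, f (.inl a) + ∑' b, f (.inr b) :=
  ENNReal.summable.tsum_sum ENNReal.summable

/-- The condition on play-measures. -/
def Consistent (out : X → K) (σ : List X → K ⊕ A → ℝ≥0∞) : Prop :=
  ∀ (t : List X) (x : X), ∑' l, σ (t ++ [x]) l = σ t (.inl (out x))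

variable {out : X → K}

theorem Consistent.after {σ : List X → K ⊕ A → ℝ≥0∞} (h : Consistent out σ) (x : X) :
    Consistent out fun t => σ (x :: t) :=
  fun t y => h (x :: t) y

theorem Consistent.total_after {σ : List X → K ⊕ A → ℝ≥0∞} (h : Consistent out σ) (x : X) :
    ∑' l, σ [x] l = σ [] (.inl (out x)) := h [] x

theorem bindPass_nil (f : A → List X → K ⊕ B → ℝ≥0∞) (σ : List X → K ⊕ A → ℝ≥0∞) (l : K ⊕ B) :
    bindPass f σ [] l = Sum.elim (fun k => σ [] (.inl k)) (fun _ => 0) l +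
      ∑' a, σ [] (.inr a) * f a [] l := rfl

theorem bindPass_cons (f : A → List X → K ⊕ B → ℝ≥0∞) (σ : List X → K ⊕ A → ℝ≥0∞) (x : X)
    (s : List X) (l : K ⊕ B) : bindPass f σ (x :: s) l = bindPass f (fun t => σ (x :: t)) s l +
      ∑' a, σ [] (.inr a) * f a (x :: s) l := rfl

theorem tsum_bindPass_nil {f : A → List X → K ⊕ B → ℝ≥0∞} (hw : ∀ a, ∑' k, f a [] k = 1)
    (σ : List X → K ⊕ A → ℝ≥0∞) : ∑' l, bindPass f σ [] l = ∑' l, σ [] l := by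
  simp only [bindPass_nil]
  rw [ENNReal.tsum_add, tsum_sum_type, tsum_sum_type (σ []), ENNReal.tsum_comm]
  simp [ENNReal.tsum_mul_left, hw]

theorem bindPass_consistent {f : A → List X → K ⊕ B → ℝ≥0∞} (hf : ∀ a, Consistent out (f a))
    (hw : ∀ a, ∑' k, f a [] k = 1) {σ : List X → K ⊕ A → ℝ≥0∞} (hσ : Consistent out σ) :
    Consistent out (bindPass f σ) := by
  intro t
  induction t generalizing σ with
  | nil =>
    intro x
    have h2 : ∀ a, ∑' l, f a [x] l = f a [] (.inl (out x)) := fun a => hf a [] x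
    simp only [List.nil_append, bindPass_cons]
    rw [ENNReal.tsum_add, tsum_bindPass_nil hw, ENNReal.tsum_comm, bindPass_nil, hσ.total_after]
    simp only [ENNReal.tsum_mul_left, h2, Sum.elim_inl]
  | cons y s ih =>
    intro x
    have h2 : ∀ a, ∑' l, f a (y :: (s ++ [x])) l = f a (y :: s) (.inl (out x)) :=
      fun a => hf a (y :: s) x
    simp only [List.cons_append, bindPass_cons]
    rw [ENNReal.tsum_add, ih (hσ.after _), ENNReal.tsum_comm]
    simp only [ENNReal.tsum_mul_left, h2]

theorem bindPass_zero (f : A → List X → K ⊕ B → ℝ≥0∞) (t : List X) (l : K ⊕ B) :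
    bindPass f (fun _ _ => 0) t l = 0 := by
  induction t with
  | nil => rcases l with l | l <;> simp [bindPass]
  | cons x s ih => simp [bindPass, ih]

theorem bindPass_add_tsum (f : A → List X → K ⊕ B → ℝ≥0∞) (σ : List X → K ⊕ A → ℝ≥0∞)
    {ι : Type u} (c : ι → ℝ≥0∞) (τ : ι → List X → K ⊕ A → ℝ≥0∞) (t : List X) (l : K ⊕ B) :
    bindPass f (fun t l => σ t l + ∑' j, c j * τ j t l) t l =
      bindPass f σ t l + ∑' j, c j * bindPass f (τ j) t l := by
  have aux : ∀ (σ : List X → K ⊕ A → ℝ≥0∞) (τ : ι → List X → K ⊕ A → ℝ≥0∞) (s l),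
      ∑' a, (σ [] (.inr a) + ∑' j, c j * τ j [] (.inr a)) * f a s l =
      ∑' a, σ [] (.inr a) * f a s l + ∑' j, c j * ∑' a, τ j [] (.inr a) * f a s l := by
    intro σ τ s l
    simp_rw [add_mul, ENNReal.tsum_add, ← ENNReal.tsum_mul_right, ← ENNReal.tsum_mul_left]
    rw [ENNReal.tsum_comm]
    simp_rw [mul_assoc]
  induction t generalizing σ τ with
  | nil =>
    simp only [bindPass_nil, aux, mul_add, ENNReal.tsum_add]
    rcases l with l | l
    · simp only [Sum.elim_inl]
      ring
    · simp only [Sum.elim_inr]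
      simp
  | cons x s ih =>
    simp only [bindPass_cons, aux, mul_add, ENNReal.tsum_add]
    rw [ih (fun t => σ (x :: t)) (fun j t => τ j (x :: t))]
    ring

theorem bindPass_assoc (f : A → List X → K ⊕ B → ℝ≥0∞) (g : B → List X → K ⊕ D → ℝ≥0∞)
    (σ : List X → K ⊕ A → ℝ≥0∞) (t : List X) (l : K ⊕ D) :
    bindPass g (bindPass f σ) t l = bindPass (fun a => bindPass g (f a)) σ t l := by
  have aux : ∀ (σ : List X → K ⊕ A → ℝ≥0∞) (s l), ∑' b, bindPass f σ [] (.inr b) * g b s l =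
      ∑' a, σ [] (.inr a) * ∑' b, f a [] (.inr b) * g b s l := by
    intro σ s l
    simp_rw [bindPass_nil, Sum.elim_inr, zero_add, ← ENNReal.tsum_mul_right,
      ← ENNReal.tsum_mul_left]
    rw [ENNReal.tsum_comm]
    simp_rw [mul_assoc]
  induction t generalizing σ with
  | nil =>
    rw [bindPass_nil, aux]
    rcases l with l | l
    · simp only [bindPass_nil, Sum.elim_inl, mul_add, ENNReal.tsum_add]
      ring
    · simp only [bindPass_nil, Sum.elim_inr, zero_add]
  | cons x s ih =>
    rw [bindPass_cons, aux, bindPass_cons]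
    have : (fun t => bindPass f σ (x :: t)) = fun t l =>
        bindPass f (fun t => σ (x :: t)) t l + ∑' a, σ [] (.inr a) * f a (x :: t) l := rfl
    rw [this, bindPass_add_tsum g _ _ (fun a t => f a (x :: t)), ih]
    simp only [bindPass_cons, mul_add, ENNReal.tsum_add]
    ring

theorem distPass_cons (d : PMF A) (x : X) (s : List X) (l : K ⊕ A) :
    distPass d (x :: s) l = 0 := by
  simp [distPass]

theorem distPass_consistent (out : X → K) (d : PMF A) : Consistent out (distPass d) := by
  rintro (_ | ⟨x, s⟩) x <;> simp [distPass]

theorem distPass_weight (d : PMF A) : ∑' l, distPass (X := X) (K := K) d [] l = 1 := by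
  rw [tsum_sum_type]
  simp [distPass, d.tsum_coe]

theorem reqPass_cons_cons {S : Sig.{u}} (k : S.K) (x y : Σ k : S.K, S.ar k)
    (s : List (Σ k : S.K, S.ar k)) (l : S.K ⊕ S.ar k) : reqPass k (x :: y :: s) l = 0 := by
  simp [reqPass]

theorem reqPass_weight {S : Sig.{u}} (k : S.K) : ∑' l, reqPass k [] l = 1 := by
  rw [tsum_sum_type]
  simp [reqPass]

theorem reqPass_consistent {S : Sig.{u}} (k : S.K) : Consistent Sigma.fst (reqPass k) := by
  rintro (_ | ⟨x, _ | ⟨y, s⟩⟩) ⟨l, i⟩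
  · rw [List.nil_append, tsum_sum_type]
    by_cases h : l = k
    · subst h
      simp only [reqPass, tsum_zero, zero_add, if_true]
      rw [tsum_eq_single i fun j hj => if_neg fun h => hj (eq_of_heq (Sigma.mk.inj h).2).symm]
      simp
    · simp [reqPass, h]
  · simp [reqPass]
  · simp [reqPass]

theorem bindPass_pure_left (a : A) (f : A → List X → K ⊕ B → ℝ≥0∞) (t : List X) (l : K ⊕ B) :
    bindPass f (distPass (PMF.pure a)) t l = f a t l := by
  classical
  have aux : ∀ s l,
      ∑' a', distPass (X := X) (K := K) (PMF.pure a) [] (.inr a') * f a' s l = f a s l := by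
    intro s l
    rw [tsum_eq_single a fun b hb => by simp [distPass, PMF.pure_apply, hb]]
    simp [distPass]
  cases t with
  | nil =>
    rw [bindPass_nil, aux]
    rcases l with l | l <;> simp [distPass]
  | cons x s =>
    rw [bindPass_cons, aux]
    have h0 : (fun t => distPass (K := K) (PMF.pure a) (x :: t)) = fun _ _ => 0 := by
      funext t l
      exact distPass_cons _ _ _ _
    rw [h0, bindPass_zero, zero_add]

theorem bindPass_pure_right (σ : List X → K ⊕ A → ℝ≥0∞) (t : List X) (l : K ⊕ A) :
    bindPass (fun a => distPass (PMF.pure a)) σ t l = σ t l := by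
  classical
  induction t generalizing σ with
  | nil =>
    rw [bindPass_nil]
    rcases l with l | l
    · simp [distPass]
    · rw [tsum_eq_single l fun b hb => by simp [distPass, PMF.pure_apply, Ne.symm hb]]
      simp [distPass]
  | cons x s ih =>
    rw [bindPass_cons, ih]
    simp [distPass_cons]

/-! Finitely founded strategies are closed under substitution. -/

/-- Prefixes of an infinite sequence. -/
theorem ofFn_succ_concat (w : ℕ → X) (n : ℕ) :
    (List.ofFn fun r : Fin (n + 1) => w r) = (List.ofFn fun r : Fin n => w r) ++ [w n] := by
  rw [List.ofFn_succ']
  simp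

theorem ofFn_succ_cons (w : ℕ → X) (n : ℕ) :
    (List.ofFn fun r : Fin (n + 1) => w r) =
      w 0 :: List.ofFn fun r : Fin n => w (r + 1) := by
  rw [List.ofFn_succ]
  simp

/-- There is no infinite play in the support. -/
def PassWF (out : X → K) (σ : List X → K ⊕ A → ℝ≥0∞) : Prop :=
  ¬ ∃ w : ℕ → X, ∀ n, σ (List.ofFn fun r : Fin n => w r) (.inl (out (w n))) ≠ 0

/-- Finite branching. -/
def PassFB (σ : List X → K ⊕ A → ℝ≥0∞) : Prop := ∀ t, {l | σ t l ≠ 0}.Finite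

theorem Consistent.ne_zero_of_succ {σ : List X → K ⊕ A → ℝ≥0∞} (h : Consistent out σ)
    (w : ℕ → X) (n : ℕ) {l : K ⊕ A} (hn : σ (List.ofFn fun r : Fin (n + 1) => w r) l ≠ 0) :
    σ (List.ofFn fun r : Fin n => w r) (.inl (out (w n))) ≠ 0 := by
  rw [ofFn_succ_concat] at hn
  rw [← h]
  exact fun h0 => hn (ENNReal.tsum_eq_zero.1 h0 l)

theorem Consistent.ne_zero_of_le {σ : List X → K ⊕ A → ℝ≥0∞} (h : Consistent out σ)
    (w : ℕ → X) {m n : ℕ} (hmn : m ≤ n)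
    (hn : σ (List.ofFn fun r : Fin n => w r) (.inl (out (w n))) ≠ 0) :
    σ (List.ofFn fun r : Fin m => w r) (.inl (out (w m))) ≠ 0 := by
  induction n, hmn using Nat.le_induction with
  | base => exact hn
  | succ n _ ih => exact ih (h.ne_zero_of_succ w n hn)

theorem bindPass_fb {f : A → List X → K ⊕ B → ℝ≥0∞} (hf : ∀ a, PassFB (f a))
    {σ : List X → K ⊕ A → ℝ≥0∞} (hσ : PassFB σ) : PassFB (bindPass f σ) := by
  have aux : ∀ (σ : List X → K ⊕ A → ℝ≥0∞), PassFB σ → ∀ s,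
      {l | ∑' a, σ [] (.inr a) * f a s l ≠ 0}.Finite := by
    intro σ hσ s
    refine (((hσ []).preimage Sum.inr_injective.injOn).biUnion fun a _ => hf a s).subset ?_
    intro l hl
    by_contra hc
    refine hl (ENNReal.tsum_eq_zero.2 fun a => ?_)
    by_contra h
    exact hc (Set.mem_biUnion (x := a) (left_ne_zero_of_mul h) (right_ne_zero_of_mul h))
  intro t
  induction t generalizing σ with
  | nil =>
    refine ((((hσ []).preimage Sum.inl_injective.injOn).image Sum.inl).union (aux σ hσ [])).subset ?_
    intro l hl
    by_contra hc
    rw [Set.mem_union, not_or] at hc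
    refine hl ?_
    rw [bindPass_nil, not_not.1 hc.2, add_zero]
    rcases l with l | l
    · by_contra h
      exact hc.1 ⟨l, h, rfl⟩
    · rfl
  | cons x s ih =>
    refine ((ih (σ := fun t => σ (x :: t)) fun t => hσ (x :: t)).union
      (aux σ hσ (x :: s))).subset ?_
    intro l hl
    by_contra hc
    rw [Set.mem_union, not_or] at hc
    exact hl (by rw [bindPass_cons, not_not.1 hc.1, not_not.1 hc.2, add_zero])

theorem bindPass_wf {f : A → List X → K ⊕ B → ℝ≥0∞} (hf : ∀ a, Consistent out (f a))
    (hw : ∀ a, ∑' k, f a [] k = 1) (hff : ∀ a, PassWF out (f a))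
    {σ : List X → K ⊕ A → ℝ≥0∞} (hσ : Consistent out σ) (hfb : PassFB σ) (hwf : PassWF out σ) :
    PassWF out (bindPass f σ) := by
  have one : ∀ (σ : List X → K ⊕ A → ℝ≥0∞), Consistent out σ → PassFB σ → ∀ w : ℕ → X,
      (∀ n, bindPass f σ (List.ofFn fun r : Fin n => w r) (.inl (out (w n))) ≠ 0) →
      ∀ n, bindPass f (fun t => σ (w 0 :: t)) (List.ofFn fun r : Fin n => w (r + 1))
        (.inl (out (w (n + 1)))) ≠ 0 := by
    intro σ hσ hfb w hw' n
    have hN : ∀ a, ∃ N, ∀ n ≥ N, f a (List.ofFn fun r : Fin n => w r) (.inl (out (w n))) = 0 := by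
      intro a
      by_contra hc
      push Not at hc
      refine hff a ⟨w, fun n => ?_⟩
      obtain ⟨m, hm, h⟩ := hc n
      exact (hf a).ne_zero_of_le w hm h
    choose N hN using hN
    obtain ⟨M, hM⟩ := (((hfb []).preimage Sum.inr_injective.injOn).image N).bddAbove
    have hcons := bindPass_consistent hf hw (hσ.after (w 0))
    refine hcons.ne_zero_of_le (fun n => w (n + 1)) (le_max_left n M) ?_
    have h := hw' (max n M + 1)
    rw [ofFn_succ_cons, bindPass_cons] at h
    have h0 : ∑' a, σ [] (.inr a) * f a (w 0 :: List.ofFn fun r : Fin (max n M) => w (r + 1))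
        (.inl (out (w (max n M + 1)))) = 0 := by
      refine ENNReal.tsum_eq_zero.2 fun a => ?_
      by_cases ha : σ [] (.inr a) = 0
      · rw [ha, zero_mul]
      · have h1 := hN a (max n M + 1)
          ((hM ⟨a, ha, rfl⟩).trans ((le_max_right n M).trans (Nat.le_succ _)))
        rw [ofFn_succ_cons] at h1
        rw [h1, mul_zero]
    rwa [h0, add_zero] at h
  rintro ⟨w, hw'⟩
  have all : ∀ m n, bindPass f (fun t => σ ((List.ofFn fun r : Fin m => w r) ++ t))
      (List.ofFn fun r : Fin n => w (r + m)) (.inl (out (w (n + m)))) ≠ 0 := by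
    intro m
    induction m with
    | zero => simpa using hw'
    | succ m ih =>
      intro n
      have hc : Consistent out fun t => σ ((List.ofFn fun r : Fin m => w r) ++ t) := fun t x => by
        simpa using hσ ((List.ofFn fun r : Fin m => w r) ++ t) x
      have := one _ hc (fun t => hfb _) (fun r => w (r + m)) ih n
      have e : ∀ t, (List.ofFn fun r : Fin (m + 1) => w r) ++ t =
          (List.ofFn fun r : Fin m => w r) ++ (w m :: t) := fun t => by
        rw [ofFn_succ_concat, List.append_assoc, List.singleton_append]
      simp only [e]
      simpa [add_assoc, add_comm, add_left_comm] using this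
  refine hwf ⟨w, fun n h0 => all (n + 1) 0 ?_⟩
  have hz : (fun t => σ ((List.ofFn fun r : Fin (n + 1) => w r) ++ t)) = fun _ _ => 0 := by
    have hz : ∀ t l, σ ((List.ofFn fun r : Fin (n + 1) => w r) ++ t) l = 0 := by
      intro t
      induction t using List.reverseRecOn with
      | nil =>
        intro l
        by_contra h
        exact hσ.ne_zero_of_succ w n (by simpa using h) h0
      | append_singleton t x ih =>
        intro l
        have := hσ ((List.ofFn fun r : Fin (n + 1) => w r) ++ t) x
        rw [ih, List.append_assoc] at this
        exact ENNReal.tsum_eq_zero.1 this l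
    funext t l
    exact hz t l
  rw [hz, bindPass_zero]

/-! Victorious strategies are closed under substitution. -/

open Classical in
/-- The probability that play lasts for at least `m` cycles, for a set `R` of active-ending
plays. -/
noncomputable def passCont (R : Set (List X)) (σ : List X → K ⊕ A → ℝ≥0∞) (m : ℕ) : ℝ≥0∞ :=
  ∑' s, if s ∈ R ∧ s.length = m then ∑' l, σ s l else 0

/-- The set of plays of a partial counterstrategy, or empty. -/
def IsCounter (out : X → K) (R : Set (List X)) : Prop :=
  (∀ t x, t ++ [x] ∈ R → t ∈ R) ∧ ∀ t x y, t ++ [x] ∈ R → t ++ [y] ∈ R → out x = out y → x = y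

/-- Victorious strategies. -/
def PassVict (out : X → K) (σ : List X → K ⊕ A → ℝ≥0∞) : Prop :=
  ∀ R, IsCounter out R → ⨅ m, passCont R σ m = 0

theorem IsCounter.after {R : Set (List X)} (h : IsCounter out R) (x : X) :
    IsCounter out {t | x :: t ∈ R} :=
  ⟨fun t => h.1 (x :: t), fun t => h.2 (x :: t)⟩

theorem passCont_zero (R : Set (List X)) (σ : List X → K ⊕ A → ℝ≥0∞) :
    passCont R σ 0 = open Classical in if [] ∈ R then ∑' l, σ [] l else 0 := by
  classical
  rw [passCont, tsum_eq_single []]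
  · simp only [List.length_nil, and_true]
  · intro s hs
    rw [if_neg]
    rintro ⟨-, h⟩
    exact hs (List.length_eq_zero_iff.1 h)

theorem passCont_succ (R : Set (List X)) (σ : List X → K ⊕ A → ℝ≥0∞) (m : ℕ) :
    passCont R σ (m + 1) = ∑' x, passCont {t | x :: t ∈ R} (fun t => σ (x :: t)) m := by
  classical
  simp only [passCont]
  rw [← ENNReal.tsum_prod]
  have hinj : Function.Injective fun p : X × List X => p.1 :: p.2 := by
    rintro ⟨x, s⟩ ⟨y, t⟩ h
    simpa using h
  rw [← hinj.tsum_eq]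
  · simp
  · intro s hs
    rcases s with _ | ⟨x, s⟩
    · simp at hs
    · exact ⟨(x, s), rfl⟩

theorem passCont_add_tsum (R : Set (List X)) (σ : List X → K ⊕ A → ℝ≥0∞) {ι : Type u}
    (c : ι → ℝ≥0∞) (τ : ι → List X → K ⊕ A → ℝ≥0∞) (m : ℕ) :
    passCont R (fun t l => σ t l + ∑' j, c j * τ j t l) m =
      passCont R σ m + ∑' j, c j * passCont R (τ j) m := by
  classical
  simp only [passCont, ← ENNReal.tsum_mul_left]
  rw [ENNReal.tsum_comm (α := ι), ← ENNReal.tsum_add]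
  refine tsum_congr fun s => ?_
  split_ifs with h
  · rw [ENNReal.tsum_add, ENNReal.tsum_comm]
    simp only [ENNReal.tsum_mul_left]
  · simp

theorem passCont_empty {R : Set (List X)} (hR : IsCounter out R) (h : [] ∉ R)
    (σ : List X → K ⊕ A → ℝ≥0∞) (m : ℕ) : passCont R σ m = 0 := by
  have : ∀ t, t ∉ R := by
    intro t
    induction t using List.reverseRecOn with
    | nil => exact h
    | append_singleton t x ih => exact fun h => ih (hR.1 t x h)
  simp [passCont, this]

theorem passCont_one_le {R : Set (List X)} (hR : IsCounter out R)
    {σ : List X → K ⊕ A → ℝ≥0∞} (hσ : Consistent out σ) : passCont R σ 1 ≤ passCont R σ 0 := by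
  classical
  by_cases h : [] ∈ R
  · rw [passCont_succ, passCont_zero, if_pos h]
    simp only [passCont_zero, Set.mem_ofPred_eq, hσ.total_after]
    calc ∑' x, (if [x] ∈ R then σ [] (.inl (out x)) else 0)
        = ∑' x : {x : X | [x] ∈ R}, σ [] (.inl (out x)) := by
          rw [tsum_subtype {x : X | [x] ∈ R} fun x => σ [] (.inl (out x))]
          rfl
      _ ≤ ∑' l, σ [] l := by
          refine ENNReal.tsum_comp_le_tsum_of_injective
            (f := fun x : {x : X | [x] ∈ R} => (Sum.inl (out x) : K ⊕ A)) ?_ (σ [])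
          intro x y hxy
          exact Subtype.ext (hR.2 [] x y x.2 y.2 (Sum.inl_injective hxy))
  · rw [passCont_empty hR h]
    exact zero_le

theorem passCont_antitone {R : Set (List X)} (hR : IsCounter out R)
    {σ : List X → K ⊕ A → ℝ≥0∞} (hσ : Consistent out σ) : Antitone (passCont R σ) := by
  refine antitone_nat_of_succ_le fun m => ?_
  induction m generalizing R σ with
  | zero => exact passCont_one_le hR hσ
  | succ m ih =>
    rw [passCont_succ, passCont_succ R σ m]
    exact ENNReal.tsum_le_tsum fun x => ih (hR.after x) (hσ.after x)

theorem tsum_iInf {ι : Type u} {g : ℕ → ι → ℝ≥0∞} (hg : Antitone g)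
    (h0 : ∑' j, g 0 j ≠ ∞) : ⨅ m, ∑' j, g m j = ∑' j, ⨅ m, g m j := by
  let _ : MeasurableSpace ι := ⊤
  have := MeasureTheory.lintegral_iInf (μ := MeasureTheory.Measure.count) (f := g)
    (fun _ => measurable_from_top) hg (by rwa [MeasureTheory.lintegral_count])
  simp only [MeasureTheory.lintegral_count] at this
  exact this.symm

theorem bindPass_vict {f : A → List X → K ⊕ B → ℝ≥0∞} (hf : ∀ a, Consistent out (f a))
    (hw : ∀ a, ∑' k, f a [] k = 1) (hv : ∀ a, PassVict out (f a))
    {σ : List X → K ⊕ A → ℝ≥0∞} (hσ : Consistent out σ) (hfin : ∑' l, σ [] l ≠ ∞)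
    (hvσ : PassVict out σ) : PassVict out (bindPass f σ) := by
  classical
  intro R hR
  suffices h : ∀ n, ⨅ m, passCont R (bindPass f σ) m ≤ passCont R σ n from
    le_antisymm ((le_iInf h).trans (hvσ R hR).le) zero_le
  clear hvσ
  intro n
  induction n generalizing R σ with
  | zero =>
    refine (iInf_le _ 0).trans (le_of_eq ?_)
    rw [passCont_zero, passCont_zero, tsum_bindPass_nil hw]
  | succ n ih =>
    let g : ℕ → X ⊕ A → ℝ≥0∞ := fun m => Sum.elim
      (fun x => passCont {t | x :: t ∈ R} (bindPass f fun t => σ (x :: t)) m)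
      (fun a => σ [] (.inr a) * passCont R (f a) (m + 1))
    have hstep : ∀ m, passCont R (bindPass f σ) (m + 1) = ∑' j, g m j := by
      intro m
      rw [tsum_sum_type]
      simp only [g, Sum.elim_inl, Sum.elim_inr]
      have h1 : ∀ a, passCont R (f a) (m + 1) =
          ∑' x, passCont {t | x :: t ∈ R} (fun t => f a (x :: t)) m := fun a => passCont_succ ..
      simp only [h1, ← ENNReal.tsum_mul_left]
      rw [passCont_succ, ENNReal.tsum_comm (α := A), ← ENNReal.tsum_add]
      refine tsum_congr fun x => ?_
      exact passCont_add_tsum _ _ (fun a => σ [] (.inr a)) (fun a t => f a (x :: t)) m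
    have hanti : Antitone g := by
      intro m m' hm j
      rcases j with x | a
      · exact passCont_antitone (hR.after x) (bindPass_consistent hf hw (hσ.after x)) hm
      · exact mul_le_mul_right (passCont_antitone hR (hf a) (Nat.succ_le_succ hm)) _
    have hle : ∀ x, ∑' l, σ [x] l ≠ ∞ := fun x => by
      rw [hσ.total_after]
      exact ne_top_of_le_ne_top hfin (ENNReal.le_tsum _)
    have hfin0 : ∑' j, g 0 j ≠ ∞ := by
      rw [← hstep]
      refine ne_top_of_le_ne_top hfin
        ((passCont_antitone hR (bindPass_consistent hf hw hσ) (Nat.zero_le 1)).trans ?_)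
      rw [passCont_zero, tsum_bindPass_nil hw]
      split_ifs
      · exact le_rfl
      · exact zero_le
    calc ⨅ m, passCont R (bindPass f σ) m
        ≤ ⨅ m, ∑' j, g m j := le_iInf fun m => (iInf_le _ (m + 1)).trans (hstep m).le
      _ = ∑' j, ⨅ m, g m j := tsum_iInf hanti hfin0
      _ = ∑' x, ⨅ m, passCont {t | x :: t ∈ R} (bindPass f fun t => σ (x :: t)) m := by
          rw [tsum_sum_type]
          have : ∀ a, ⨅ m, g m (.inr a) = 0 := by
            intro a
            have ha : σ [] (.inr a) ≠ ∞ := ne_top_of_le_ne_top hfin (ENNReal.le_tsum _)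
            simp only [g, Sum.elim_inr]
            rw [← ENNReal.mul_iInf fun h => absurd h ha]
            have : ⨅ m, passCont R (f a) (m + 1) = 0 := by
              refine le_antisymm ((le_iInf fun m => ?_).trans (hv a R hR).le) zero_le
              exact (iInf_le _ m).trans (passCont_antitone hR (hf a) (Nat.le_succ m))
            rw [this, mul_zero]
          simp only [this, tsum_zero, add_zero]
          rfl
      _ ≤ ∑' x, passCont {t | x :: t ∈ R} (fun t => σ (x :: t)) n :=
          ENNReal.tsum_le_tsum fun x => ih (hσ.after x) (hle x) _ (hR.after x)
      _ = passCont R σ (n + 1) := (passCont_succ R σ n).symm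

/-! Bounded strategies. -/

theorem wf_of_bounded {σ : List X → K ⊕ A → ℝ≥0∞}
    (h : ∀ x y s l, σ (x :: y :: s) l = 0) : PassWF out σ := by
  rintro ⟨w, hw⟩
  refine hw 2 ?_
  rw [ofFn_succ_cons, List.ofFn_succ]
  exact h _ _ _ _

theorem vict_of_bounded {σ : List X → K ⊕ A → ℝ≥0∞}
    (h : ∀ x y s l, σ (x :: y :: s) l = 0) : PassVict out σ := by
  intro R _
  refine le_antisymm ((iInf_le _ 2).trans (le_of_eq ?_)) zero_le
  rw [passCont_succ]
  refine ENNReal.tsum_eq_zero.2 fun x => ?_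
  rw [passCont_succ]
  refine ENNReal.tsum_eq_zero.2 fun y => ?_
  simp [passCont, h]

theorem distPass_fb (d : PMF A) (hd : d.support.Finite) :
    PassFB (distPass (X := X) (K := K) d) := by
  rintro (_ | ⟨x, s⟩)
  · refine (hd.image Sum.inr).subset ?_
    rintro (k | a) h
    · exact absurd rfl h
    · exact ⟨a, h, rfl⟩
  · simp [distPass_cons]

theorem reqPass_fb {S : Sig.{u}} (k : S.K) : PassFB (reqPass k) := by
  rintro (_ | ⟨x, _ | ⟨y, s⟩⟩)
  · refine (Set.finite_singleton (Sum.inl k)).subset ?_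
    rintro (l | j) h
    · by_contra hl
      refine h (if_neg fun h => hl ?_)
      rw [h]
      rfl
    · exact absurd rfl h
  · refine Set.Subsingleton.finite ?_
    rintro (l | j) h (l' | j') h'
    · exact absurd rfl h
    · exact absurd rfl h
    · exact absurd rfl h'
    · have e : x = ⟨k, j⟩ := by
        by_contra hx
        exact h (if_neg hx)
      have e' : x = ⟨k, j'⟩ := by
        by_contra hx
        exact h' (if_neg hx)
      rw [eq_of_heq (Sigma.mk.inj (e.symm.trans e')).2]
  · simp [reqPass_cons_cons]

end PassFacts

section Transport

variable {S : Sig.{u}} {A B D : Type u}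

/-- An output-input pair over `S`, as one over `S + A`. -/
def untag (A : Type u) (x : Σ k : S.K, S.ar k) : Σ k, (S.addConst A).ar k := ⟨.inl x.1, x.2⟩

/-- An output-input pair over `S + A`, as one over `S`: constants have no inputs. -/
def tag : (Σ k, (S.addConst A).ar k) → Σ k : S.K, S.ar k
  | ⟨.inl k, i⟩ => ⟨k, i⟩
  | ⟨.inr _, i⟩ => i.elim

theorem tag_untag (x : Σ k : S.K, S.ar k) : tag (untag A x) = x := rfl

theorem untag_tag (x : Σ k, (S.addConst A).ar k) : untag A (tag x) = x := by
  obtain ⟨k | a, i⟩ := x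
  · rfl
  · exact i.elim

/-- A play over `S`, as one over `S + A`. -/
def embPlay (A : Type u) (t : Play S) : Play (S.addConst A) := t.map (untag A)

/-- A play over `S + A`, as one over `S`. -/
def stripPlay (t : Play (S.addConst A)) : Play S := t.map tag

theorem strip_emb (t : Play S) : stripPlay (embPlay A t) = t := by
  induction t with
  | nil => rfl
  | cons x t ih => exact congrArg (List.cons x) ih

theorem emb_strip (t : Play (S.addConst A)) : embPlay A (stripPlay t) = t := by
  induction t with
  | nil => rfl
  | cons x t ih => exact congrArg₂ List.cons (untag_tag x) ih

theorem emb_concat (t : Play S) (x : Σ k : S.K, S.ar k) :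
    embPlay A (t ++ [x]) = embPlay A t ++ [untag A x] := List.map_append

theorem strip_concat (t : Play (S.addConst A)) (x : Σ k, (S.addConst A).ar k) :
    stripPlay (t ++ [x]) = stripPlay t ++ [tag x] := List.map_append

theorem emb_length (t : Play S) : (embPlay A t).length = t.length := List.length_map _

/-- `embPlay` as an equivalence. -/
def embEquiv (S : Sig.{u}) (A : Type u) : Play S ≃ Play (S.addConst A) :=
  ⟨embPlay A, stripPlay, strip_emb, emb_strip⟩

/-- The values of a play-measure over `S + A`, as a function of a play over `S` and an output. -/
def PlayMeasure.core (σ : PlayMeasure (S.addConst A)) : Play S → S.K ⊕ A → ℝ≥0∞ :=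
  fun t l => σ.pass (embPlay A t) l

theorem PlayMeasure.core_strip (σ : PlayMeasure (S.addConst A)) (t : Play (S.addConst A)) :
    σ.core (stripPlay t) = σ.pass t := congrArg σ.pass (emb_strip t)

theorem PlayMeasure.core_consistent (σ : PlayMeasure (S.addConst A)) :
    Consistent Sigma.fst σ.core := fun t x => by
  have := σ.pass_eq (embPlay A t) (.inl x.1) x.2
  refine Eq.trans (tsum_congr fun l => ?_) this
  exact congrArg (fun t => σ.pass t l) (emb_concat t x)

theorem Strategy.core_weight (σ : Strategy (S.addConst A)) : ∑' l, σ.core [] l = 1 :=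
  σ.weight_eq

/-- The strategy over `S + A` with given values. -/
noncomputable def Strategy.ofCore (r : Play S → S.K ⊕ A → ℝ≥0∞) (hr : Consistent Sigma.fst r)
    (hw : ∑' l, r [] l = 1) : Strategy (S.addConst A) where
  pass t l := r (stripPlay t) l
  pass_eq t k i := by
    rcases k with k | a
    · have := hr (stripPlay t) ⟨k, i⟩
      rw [strip_concat]
      exact this
    · exact i.elim
  weight_eq := hw

theorem Strategy.core_ofCore (r : Play S → S.K ⊕ A → ℝ≥0∞) (hr : Consistent Sigma.fst r)
    (hw : ∑' l, r [] l = 1) : (Strategy.ofCore r hr hw).core = r :=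
  funext fun t => congrArg r (strip_emb t)

theorem Strategy.ext_core {σ τ : Strategy (S.addConst A)} (h : ∀ t l, σ.core t l = τ.core t l) :
    σ = τ := by
  refine Strategy.ext (funext fun t => funext fun l => ?_)
  rw [← σ.core_strip, ← τ.core_strip]
  exact h _ l

theorem emb_prefix (w : ℕ → Σ k : S.K, S.ar k) (n : ℕ) :
    embPlay A (List.ofFn fun r : Fin n => w r) = prefixOf (fun n => untag A (w n)) n :=
  List.map_ofFn

theorem strip_prefix (w : ℕ → Σ k, (S.addConst A).ar k) (n : ℕ) :
    (List.ofFn fun r : Fin n => tag (w r)) = stripPlay (prefixOf w n) :=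
  (List.map_ofFn (f := fun r : Fin n => w r) (g := tag)).symm

theorem wf_iff_core (σ : PlayMeasure (S.addConst A)) :
    σ.IsWellFounded ↔ PassWF Sigma.fst σ.core := by
  refine not_congr ⟨?_, ?_⟩
  · rintro ⟨w, hw⟩
    refine ⟨fun n => tag (w n), fun n => ?_⟩
    rw [strip_prefix, σ.core_strip]
    have h1 : (Sum.inl (tag (w n)).1 : S.K ⊕ A) = (w n).1 := congrArg Sigma.fst (untag_tag (w n))
    rw [h1]
    exact (hw n).2
  · rintro ⟨w, hw⟩
    refine ⟨fun n => untag A (w n), fun n => ?_⟩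
    have h := hw n
    rw [PlayMeasure.core, emb_prefix] at h
    exact ⟨fun h0 => h (ENNReal.tsum_eq_zero.1 h0 _), h⟩

theorem fb_iff_core (σ : PlayMeasure (S.addConst A)) :
    σ.IsFinitelyBranching ↔ PassFB σ.core := by
  constructor
  · intro h t
    by_cases h0 : σ.act (embPlay A t) = 0
    · have : ∀ l, σ.core t l = 0 := ENNReal.tsum_eq_zero.1 h0
      simp [this]
    · exact h _ h0
  · intro h t _
    rw [← σ.core_strip]
    exact h _

theorem contProb_eq (σ : PlayMeasure (S.addConst A)) (ρ : PartialCounterstrategy (S.addConst A))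
    (m : ℕ) : contProb ρ σ m = passCont {t | embPlay A t ∈ ρ.act} σ.core m := by
  classical
  refine (tsum_subtype {s : Play (S.addConst A) | s ∈ ρ.act ∧ s.length = m} σ.act).trans ?_
  rw [← (embEquiv S A).tsum_eq]
  refine tsum_congr fun t => ?_
  refine (Set.indicator_apply _ _ _).trans (if_congr (and_congr Iff.rfl ?_) rfl rfl)
  exact Eq.congr (emb_length t) rfl

theorem vict_iff_core (σ : PlayMeasure (S.addConst A)) :
    σ.IsVictorious ↔ PassVict Sigma.fst σ.core := by
  constructor
  · intro h R hR
    by_cases h0 : [] ∈ R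
    · let ρ : PartialCounterstrategy (S.addConst A) :=
        { act := {t | stripPlay t ∈ R}
          nil_mem := h0
          mem_of_append_mem := fun t k i ht => by
            rw [Set.mem_ofPred_eq, strip_concat] at ht
            exact hR.1 _ _ ht
          input_unique := fun t k i j hi hj => by
            rw [Set.mem_ofPred_eq, strip_concat] at hi hj
            rcases k with k | a
            · exact eq_of_heq (Sigma.mk.inj (hR.2 _ ⟨k, i⟩ ⟨k, j⟩ hi hj rfl)).2
            · exact i.elim }
      have := h ρ
      simp only [contProb_eq] at this
      have e : {t : Play S | embPlay A t ∈ ρ.act} = R := by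
        ext t
        rw [Set.mem_ofPred_eq, Set.mem_ofPred_eq, strip_emb]
      rwa [e] at this
    · refine le_antisymm ((iInf_le _ 0).trans (passCont_empty hR h0 _ 0).le) zero_le
  · intro h ρ
    simp only [contProb_eq]
    refine h _ ⟨fun t x ht => ?_, fun t x y hx hy hxy => ?_⟩
    · rw [Set.mem_ofPred_eq, emb_concat] at ht
      exact ρ.mem_of_append_mem _ _ _ ht
    · rw [Set.mem_ofPred_eq, emb_concat] at hx hy
      obtain ⟨k, i⟩ := x
      obtain ⟨l, j⟩ := y
      obtain rfl : k = l := hxy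
      rw [show i = j from ρ.input_unique _ (.inl k) i j hx hy]

end Transport

namespace Strategy

variable {S : Sig.{u}} {A B D : Type u}

/-- The strategy over `S + A` that outputs a constant `a ∈ A`, chosen with the distribution
`d`. -/
noncomputable def dist (d : PMF A) : Strategy (S.addConst A) :=
  ofCore (distPass d) (distPass_consistent _ d) (distPass_weight d)

/-- The strategy over `S + ar k` that outputs `k` and, after the input `i`, outputs the constant
`i`. -/
noncomputable def req (k : S.K) : Strategy (S.addConst (S.ar k)) :=
  ofCore (reqPass k) (reqPass_consistent k) (reqPass_weight k)

/-- Substitution of a strategy `f a` for each constant `a`. -/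
noncomputable def subst (σ : Strategy (S.addConst A)) (f : A → Strategy (S.addConst B)) :
    Strategy (S.addConst B) :=
  ofCore (bindPass (fun a => (f a).core) σ.core)
    (bindPass_consistent (fun a => (f a).core_consistent) (fun a => (f a).core_weight)
      σ.core_consistent)
    ((tsum_bindPass_nil (fun a => (f a).core_weight) _).trans σ.core_weight)

theorem core_dist (d : PMF A) : (dist (S := S) d).core = distPass d := core_ofCore _ _ _

theorem core_req (k : S.K) : (req k).core = reqPass k := core_ofCore _ _ _

theorem core_subst (σ : Strategy (S.addConst A)) (f : A → Strategy (S.addConst B)) :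
    (σ.subst f).core = bindPass (fun a => (f a).core) σ.core := core_ofCore _ _ _

theorem dist_subst (a : A) (f : A → Strategy (S.addConst B)) :
    (dist (PMF.pure a)).subst f = f a := ext_core fun t l => by
  rw [core_subst, core_dist, bindPass_pure_left]

theorem subst_dist (σ : Strategy (S.addConst A)) :
    (σ.subst fun a => dist (PMF.pure a)) = σ := ext_core fun t l => by
  simp only [core_subst, core_dist, bindPass_pure_right]

theorem subst_subst (σ : Strategy (S.addConst A)) (f : A → Strategy (S.addConst B))
    (g : B → Strategy (S.addConst D)) :
    (σ.subst f).subst g = σ.subst fun a => (f a).subst g := ext_core fun t l => by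
  simp only [core_subst, bindPass_assoc]

theorem subst_ff {σ : Strategy (S.addConst A)} {f : A → Strategy (S.addConst B)}
    (hσ : σ.IsFinitelyFounded) (hf : ∀ a, (f a).IsFinitelyFounded) :
    (σ.subst f).IsFinitelyFounded := by
  constructor
  · rw [wf_iff_core, core_subst]
    exact bindPass_wf (fun a => (f a).core_consistent) (fun a => (f a).core_weight)
      (fun a => (wf_iff_core _).1 (hf a).1) σ.core_consistent ((fb_iff_core _).1 hσ.2)
      ((wf_iff_core _).1 hσ.1)
  · rw [fb_iff_core, core_subst]
    exact bindPass_fb (fun a => (fb_iff_core _).1 (hf a).2) ((fb_iff_core _).1 hσ.2)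

theorem subst_vict {σ : Strategy (S.addConst A)} {f : A → Strategy (S.addConst B)}
    (hσ : σ.IsVictorious) (hf : ∀ a, (f a).IsVictorious) : (σ.subst f).IsVictorious := by
  rw [vict_iff_core, core_subst]
  refine bindPass_vict (fun a => (f a).core_consistent) (fun a => (f a).core_weight)
    (fun a => (vict_iff_core _).1 (hf a)) σ.core_consistent ?_ ((vict_iff_core _).1 hσ)
  rw [core_weight]
  exact ENNReal.one_ne_top

theorem dist_ff (d : PMF A) (hd : d.support.Finite) :
    (dist (S := S) d).IsFinitelyFounded := by
  constructor
  · rw [wf_iff_core, core_dist]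
    exact wf_of_bounded fun _ _ _ _ => distPass_cons _ _ _ _
  · rw [fb_iff_core, core_dist]
    exact distPass_fb d hd

theorem dist_vict (d : PMF A) : (dist (S := S) d).IsVictorious := by
  rw [vict_iff_core, core_dist]
  exact vict_of_bounded fun _ _ _ _ => distPass_cons _ _ _ _

theorem req_ff (k : S.K) : (req k).IsFinitelyFounded := by
  constructor
  · rw [wf_iff_core, core_req]
    exact wf_of_bounded (reqPass_cons_cons k)
  · rw [fb_iff_core, core_req]
    exact reqPass_fb k

theorem req_vict (k : S.K) : (req k).IsVictorious := by
  rw [vict_iff_core, core_req]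
  exact vict_of_bounded (reqPass_cons_cons k)

end Strategy

/-- The monad `FinFound_S` sends `A` to the set of finitely founded strategies over `S + A`. -/
def FinFound (S : Sig.{u}) (A : Type u) : Type u :=
  {σ : Strategy (S.addConst A) // σ.IsFinitelyFounded}

/-- The unit is given by the constants, and multiplication by substitution. -/
noncomputable instance (S : Sig.{u}) : Monad (FinFound S) where
  pure a := ⟨.dist (PMF.pure a), Strategy.dist_ff _ (by simp)⟩
  bind σ f := ⟨σ.1.subst fun a => (f a).1, Strategy.subst_ff σ.2 fun a => (f a).2⟩

instance (S : Sig.{u}) : LawfulMonad (FinFound S) := LawfulMonad.mk'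
  (id_map := fun σ => Subtype.ext (Strategy.subst_dist σ.1))
  (pure_bind := fun a f => Subtype.ext (Strategy.dist_subst a fun a => (f a).1))
  (bind_assoc := fun σ f g => Subtype.ext
    (Strategy.subst_subst σ.1 (fun a => (f a).1) fun b => (g b).1))

/-- The operations `+_p` and those of `S` on finitely founded strategies. -/
noncomputable def FinFound.gen (S : Sig.{u}) :
    ∀ k : (binaryChoice.{u}.toSig.sum S).K, FinFound S ((binaryChoice.{u}.toSig.sum S).ar k)
  | .inl c => ⟨.dist (binaryChoice.weight c),
      Strategy.dist_ff _ (Set.toFinite (α := ULift Bool) _)⟩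
  | .inr k => ⟨.req k, Strategy.req_ff k⟩

/-- The monad `Vict_S` sends `A` to the set of victorious strategies over `S + A`. -/
def Vict (S : Sig.{u}) (A : Type u) : Type u :=
  {σ : Strategy (S.addConst A) // σ.IsVictorious}

/-- The unit is given by the constants, and multiplication by substitution. -/
noncomputable instance (S : Sig.{u}) : Monad (Vict S) where
  pure a := ⟨.dist (PMF.pure a), Strategy.dist_vict _⟩
  bind σ f := ⟨σ.1.subst fun a => (f a).1, Strategy.subst_vict σ.2 fun a => (f a).2⟩

instance (S : Sig.{u}) : LawfulMonad (Vict S) := LawfulMonad.mk'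
  (id_map := fun σ => Subtype.ext (Strategy.subst_dist σ.1))
  (pure_bind := fun a f => Subtype.ext (Strategy.dist_subst a fun a => (f a).1))
  (bind_assoc := fun σ f g => Subtype.ext
    (Strategy.subst_subst σ.1 (fun a => (f a).1) fun b => (g b).1))

/-- The operations `∑ₙ pₙ · -` and those of `S` on victorious strategies. -/
noncomputable def Vict.gen (S : Sig.{u}) :
    ∀ k : (countableChoice.{u}.toSig.sum S).K, Vict S ((countableChoice.{u}.toSig.sum S).ar k)
  | .inl c => ⟨.dist (countableChoice.weight c), Strategy.dist_vict _⟩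
  | .inr k => ⟨.req k, Strategy.req_vict k⟩

/-- The monad `M`, with the operations `m`, is the free extension by `S` of the monad `T`, with the
operations `t`: the theory `θ` yields `T`, and `θ + S` yields `M`. -/
def IsFreeExtension (θ : Theory.{u}) (S : Sig.{u})
    (T : Type u → Type u) [Monad T] (t : ∀ k : θ.sig.K, T (θ.sig.ar k))
    (M : Type u → Type u) [Monad M]
    (m : ∀ k : (θ.sig.sum S).K, M ((θ.sig.sum S).ar k)) : Prop :=
  θ.Presents T t ∧ (θ.freeExt S).Presents M m

/-- The monad `M`, with the operations `m`, is the free tensorial extension by `S` of the monad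
`T`, with the operations `t`: the theory `θ` yields `T`, and `θ ⊗ S` yields `M`. -/
def IsFreeTensorialExtension (θ : Theory.{u}) (S : Sig.{u})
    (T : Type u → Type u) [Monad T] (t : ∀ k : θ.sig.K, T (θ.sig.ar k))
    (M : Type u → Type u) [Monad M]
    (m : ∀ k : (θ.sig.sum S).K, M ((θ.sig.sum S).ar k)) : Prop :=
  θ.Presents T t ∧ (θ.tensorExt S).Presents M m

end ProbIO

/-! Each presentation comes down to three facts about the evaluation of terms
(`Theory.presents_of`): the equations hold, terms with equal values are provably equal, and every
element is a value. The two choice theories are handled together through `IsDistTheory`: pure choice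
terms are provably equal exactly when they denote the same distribution, and the distributions
denoted are those of finite support in the convex case and all of them in the `ω`-convex case. In
any extension, classes of terms therefore form an algebra with a mixture `mean d` of each admissible
distribution `d` of classes (`MixAlg`), and the remaining arguments take place in such algebras.

Programs. Terms and programs are the same trees. By `ecls_toTerm` a program is provably the mixture,
over its transition distribution, of the requests it may issue first. Bisimilar programs have
transition distributions that agree up to bisimilarity of the continuations, so induction on
programs turns bisimilarity into provable equality (`ecls_eq_of_bisimilar`).

Finitely founded strategies. Commutation merges all branches that start with the same output. Hence
every element has a normal form (`TensorAlg.exists_nf`): a distribution on first moves, with one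
continuation for each output and input. The values of the denoted strategy return the weights, and
the continuations of the moves of positive weight. Induction on well-founded values then shows that
values determine the element (`TensorAlg.eq_of_core_eq`), and the same recursion realizes every
finitely founded strategy (`TensorAlg.exists_core_eq`).

Victorious strategies need not be well-founded, so they are approximated. For surjectivity, the
probability of surviving `m` cycles against the worst opponent tends to `0` when arities are finite
(`iInf_contSup_eq_zero`). Trimming at a large `m` thus leaves a bounded play-measure with at least
half of the mass. Iterating on the remainder writes the strategy as a countable sum of well-founded
pieces (`exists_tsum_eq`), each a multiple of the values of an element, and their mixture has the
required values.

For injectivity, each element is a countable mixture of elements with only finitely many plays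
(`TensorAlg.exists_eq_mean`, by coupling the finitely many inputs). If two such mixtures have the
same values, finite truncations of one are dominated by slightly larger truncations of the other,
and vice versa. The interleaved increasing chain has well-founded increments, which define a third
mixture. Blocks of its increments match blocks of either original mixture, and within a block
well-foundedness gives equality. So both originals equal the third
(`TensorAlg.mean_eq_of_coreSum_eq`). -/

namespace ProbIO

/-! ### Presentations of monads -/

section Presentation

variable {θ : Theory.{u}} {M : Type u → Type u} [Monad M]

/-- The interpretation of terms in a monad with a generic element for each operation. -/
def Theory.eval (g : ∀ k : θ.sig.K, M (θ.sig.ar k)) {A : Type u} : Term θ.sig A → M A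
  | .var a => pure a
  | .op k x => g k >>= fun i => Theory.eval g (x i)

variable [LawfulMonad M]

theorem Theory.eval_subst (g : ∀ k : θ.sig.K, M (θ.sig.ar k)) {A B : Type u} (t : Term θ.sig A)
    (f : A → Term θ.sig B) : eval g (t.subst f) = eval g t >>= fun a => eval g (f a) := by
  induction t with
  | var a => simp [Term.subst, eval]
  | op k x ih => simp [Term.subst, eval, ih]

theorem Theory.eval_eq_of_rel {g : ∀ k : θ.sig.K, M (θ.sig.ar k)}
    (sound : ∀ (B : Type u) (s t : Term θ.sig B), θ.eqn B s t → eval g s = eval g t)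
    {A : Type u} {s t : Term θ.sig A} (h : θ.Rel s t) : eval g s = eval g t := by
  induction h with
  | refl t => rfl
  | symm _ ih => exact ih.symm
  | trans _ _ ih₁ ih₂ => exact ih₁.trans ih₂
  | congr k _ ih => simp only [eval, ih]
  | inst h f => rw [eval_subst, eval_subst, sound _ _ _ h]

/-- Soundness lets evaluation descend to classes; completeness makes the descended map injective.
Its compatibility with bind is the substitution lemma `Theory.eval_subst`. -/
theorem Theory.presents_of {g : ∀ k : θ.sig.K, M (θ.sig.ar k)}
    (sound : ∀ (B : Type u) (s t : Term θ.sig B), θ.eqn B s t → eval g s = eval g t)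
    (complete : ∀ (A : Type u) (s t : Term θ.sig A), eval g s = eval g t → θ.Rel s t)
    (surj : ∀ (A : Type u) (m : M A), ∃ t : Term θ.sig A, eval g t = m) : θ.Presents M g := by
  let ev : ∀ A, θ.Cls A → M A := fun A => Quotient.lift (s := θ.termCongr.r A) (eval g)
    fun _ _ h => eval_eq_of_rel sound h
  refine ⟨⟨fun A => Equiv.ofBijective (ev A) ⟨?_, ?_⟩, fun a => rfl, ?_⟩, ?_⟩
  · intro x y h
    obtain ⟨s, rfl⟩ := θ.termCongr.exists_rep x
    obtain ⟨t, rfl⟩ := θ.termCongr.exists_rep y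
    exact Quotient.sound (s := θ.termCongr.r A) (complete _ _ _ h)
  · intro m
    obtain ⟨t, rfl⟩ := surj A m
    exact ⟨θ.termCongr.cls t, rfl⟩
  · intro A B x f
    obtain ⟨x, rfl⟩ := θ.termCongr.exists_rep x
    obtain ⟨f, rfl⟩ := θ.termCongr.exists_rep_fun f
    rw [θ.termCongr.cls_bind]
    exact eval_subst g x f
  · intro k
    exact bind_pure (g k)

end Presentation

/-! ### Distributions -/

section Distributions

theorem pmf_bind_congr {A : Type*} {B : Type*} {d : PMF A} {e e' : A → PMF B}
    (h : ∀ a ∈ d.support, e a = e' a) : d.bind e = d.bind e' := by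
  ext b
  rw [PMF.bind_apply, PMF.bind_apply]
  refine tsum_congr fun a => ?_
  by_cases ha : d a = 0
  · simp [ha]
  · rw [h a ha]

theorem pmf_map_congr {A : Type*} {B : Type*} {d : PMF A} {f f' : A → B}
    (h : ∀ a ∈ d.support, f a = f' a) : d.map f = d.map f' :=
  pmf_bind_congr fun a ha => congrArg PMF.pure (h a ha)

theorem pmf_eq_of_le {A : Type*} {d e : PMF A} (h : ∀ a, d a ≤ e a) : d = e := by
  ext a
  refine le_antisymm (h a) ?_
  by_contra hlt
  have := ENNReal.tsum_lt_tsum d.tsum_coe_ne_top h (not_le.1 hlt)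
  rw [d.tsum_coe, e.tsum_coe] at this
  exact lt_irrefl _ this

/-- The support of `d` is finite, if `fin` holds. -/
def Adm (fin : Prop) {A : Type*} (d : PMF A) : Prop := fin → d.support.Finite

variable {fin : Prop}

theorem adm_pure {A : Type*} (a : A) : Adm fin (PMF.pure a) := fun _ => by simp

theorem Adm.bind {A : Type*} {B : Type*} {d : PMF A} {e : A → PMF B} (hd : Adm fin d)
    (he : ∀ a ∈ d.support, Adm fin (e a)) : Adm fin (d.bind e) := fun h => by
  rw [PMF.support_bind]
  exact (hd h).biUnion fun a ha => he a ha h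

theorem Adm.map {A : Type*} {B : Type*} {d : PMF A} (hd : Adm fin d) (f : A → B) :
    Adm fin (d.map f) := hd.bind fun _ _ => adm_pure _

open Classical in
/-- The conditional distribution of `d` on the fibre of `f` over `b`. -/
noncomputable def fibre {A : Type*} {B : Type*} (d : PMF A) (f : A → B) (b : B) : PMF A :=
  -- On a fibre of mass zero the value `d` is only a default: such a `b` has weight zero in `d.map
  -- f`.
  if h : ∃ a ∈ {a | f a = b}, a ∈ d.support then d.filter {a | f a = b} h else d

theorem fibre_support_subset {A : Type*} {B : Type*} (d : PMF A) (f : A → B) (b : B) :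
    (fibre d f b).support ⊆ d.support := by
  rw [fibre]
  split_ifs with h
  · rw [PMF.support_filter]
    exact Set.inter_subset_right
  · exact subset_rfl

theorem Adm.fibre {A : Type*} {B : Type*} {d : PMF A} (hd : Adm fin d) (f : A → B) (b : B) :
    Adm fin (fibre d f b) := fun h => (hd h).subset (fibre_support_subset d f b)

theorem eq_of_mem_fibre {A : Type*} {B : Type*} {d : PMF A} {f : A → B} {b : B}
    (hb : b ∈ (d.map f).support) {a : A} (ha : a ∈ (fibre d f b).support) : f a = b := by
  obtain ⟨a', ha', hb'⟩ := (PMF.mem_support_map_iff _ _ _).1 hb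
  rw [fibre, dif_pos ⟨a', hb', ha'⟩, PMF.support_filter] at ha
  exact ha.1

/-- Disintegration. At the point `a` only `b = f a` contributes, and the mass of that fibre cancels
against the normalizing factor of the conditional distribution. -/
theorem map_bind_fibre {A : Type*} {B : Type*} (d : PMF A) (f : A → B) :
    (d.map f).bind (fibre d f) = d := by
  classical
  ext a
  rw [PMF.bind_apply, tsum_eq_single (f a)]
  · by_cases ha : a ∈ d.support
    · have hmap : (d.map f) (f a) = ∑' x, Set.indicator {x | f x = f a} d x := by
        rw [PMF.map_apply]
        refine tsum_congr fun x => ?_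
        simp only [Set.indicator, Set.mem_ofPred_eq, eq_comm]
      have h : ∃ x ∈ {x | f x = f a}, x ∈ d.support := ⟨a, rfl, ha⟩
      rw [fibre, dif_pos h, PMF.filter_apply, ← hmap]
      have h0 : (d.map f) (f a) ≠ 0 := (PMF.mem_support_map_iff _ _ _).2 ⟨a, ha, rfl⟩
      rw [Set.indicator_of_mem (show a ∈ {x | f x = f a} from rfl), mul_comm, mul_assoc,
        ENNReal.inv_mul_cancel h0 (PMF.apply_ne_top _ _), mul_one]
    · have h1 : fibre d f (f a) a = 0 := by
        by_contra h1
        exact ha (fibre_support_subset d f _ h1)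
      rw [h1, mul_zero]
      exact (not_not.1 ha).symm
  · intro b hb
    by_cases hb' : b ∈ (d.map f).support
    · have : fibre d f b a = 0 := by
        by_contra h1
        exact hb (eq_of_mem_fibre hb' h1).symm
      rw [this, mul_zero]
    · rw [not_not.1 hb', zero_mul]

/-- A distribution is supported on a sequence. -/
theorem exists_nat_map {A : Type*} (d : PMF A) :
    ∃ (p : PMF ℕ) (x : ℕ → A), p.map x = d ∧ ∀ n, x n ∈ d.support := by
  classical
  -- `z` enumerates the countable support, possibly with repetitions. `r` picks one index for each
  -- point of the support, and `z` carries the law of that index back to `d`.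
  obtain ⟨z, hz⟩ := d.support_countable.exists_eq_range d.support_nonempty
  have hr : ∀ a : A, ∃ n : ℕ, a ∈ d.support → z n = a := fun a => by
    by_cases ha : a ∈ d.support
    · obtain ⟨n, hn⟩ := hz ▸ ha
      exact ⟨n, fun _ => hn⟩
    · exact ⟨0, fun h => absurd h ha⟩
  choose r hr using hr
  refine ⟨d.map r, z, ?_, fun n => hz ▸ ⟨n, rfl⟩⟩
  rw [PMF.map_comp]
  refine (pmf_map_congr fun a ha => ?_).trans (PMF.map_id d)
  exact hr a ha

end Distributions

/-! ### Theories of distributions -/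

section DistTheory

variable {C : Choice.{u}} {A B : Type u}

/-- The distribution denoted by a term of choice operations. -/
noncomputable def Term.dist : Term C.toSig A → PMF A
  | .var a => PMF.pure a
  | .op c x => (C.weight c).bind fun i => (x i).dist

theorem Term.dist_subst (t : Term C.toSig A) (f : A → Term C.toSig B) :
    (t.subst f).dist = t.dist.bind fun a => (f a).dist := by
  induction t with
  | var a => exact (PMF.pure_bind a fun a => (f a).dist).symm
  | op c x ih =>
    simp only [subst, dist, PMF.bind_bind]
    exact congrArg _ (funext ih)

/-- The equations `E` between terms of choice operations axiomatize equality of distributions, and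
the distributions denoted by terms are all those (with finite support, if `fin` holds). -/
structure IsDistTheory (C : Choice.{u})
    (E : ∀ B : Type u, Term C.toSig B → Term C.toSig B → Prop) (fin : Prop) : Prop where
  sound : ∀ (B : Type u) (s t : Term C.toSig B), E B s t → s.dist = t.dist
  complete : ∀ (A : Type u) (s t : Term C.toSig A), s.dist = t.dist →
    Theory.Rel ⟨C.toSig, E⟩ s t
  adm : ∀ (A : Type u) (t : Term C.toSig A), Adm fin t.dist
  exists_dist_eq : ∀ (A : Type u) (d : PMF A), Adm fin d → ∃ t : Term C.toSig A, t.dist = d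

theorem Term.inl_subst {S T : Sig.{u}} (t : Term S A) (f : A → Term S B) :
    (t.subst f).inl (T := T) = t.inl.subst fun a => (f a).inl := by
  induction t with
  | var a => rfl
  | op k x ih => exact congrArg (Term.op (S := S.sum T) (Sum.inl k)) (funext ih)

end DistTheory

/-! ### Mixtures in an extension -/

section Mixtures

variable {C : Choice.{u}} {E : ∀ B : Type u, Term C.toSig B → Term C.toSig B → Prop} {fin : Prop}
  {S : Sig.{u}}
  {G : ∀ B : Type u, Term (C.toSig.sum S) B → Term (C.toSig.sum S) B → Prop} {A B : Type u}

/-- The terms on `A` of the theory with the operations of `C` and `S` and the equations `G`, modulo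
provable equality. -/
abbrev ExtCls (C : Choice.{u}) (S : Sig.{u})
    (G : ∀ B : Type u, Term (C.toSig.sum S) B → Term (C.toSig.sum S) B → Prop) (A : Type u) :
    Type u := Theory.Cls ⟨C.toSig.sum S, G⟩ A

/-- The class of a term. -/
def ecls (G : ∀ B : Type u, Term (C.toSig.sum S) B → Term (C.toSig.sum S) B → Prop)
    (t : Term (C.toSig.sum S) A) : ExtCls C S G A :=
  (Theory.termCongr ⟨C.toSig.sum S, G⟩).cls t

theorem ecls_eq_iff {s t : Term (C.toSig.sum S) A} :
    ecls G s = ecls G t ↔ Theory.Rel ⟨C.toSig.sum S, G⟩ s t :=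
  ⟨fun h => Quotient.exact (s := (Theory.termCongr ⟨C.toSig.sum S, G⟩).r A) h,
    fun h => Quotient.sound (s := (Theory.termCongr ⟨C.toSig.sum S, G⟩).r A) h⟩

/-- A representative of a class. -/
noncomputable def erep (x : ExtCls C S G A) : Term (C.toSig.sum S) A :=
  Quotient.out (s := (Theory.termCongr ⟨C.toSig.sum S, G⟩).r A) x

theorem ecls_erep (x : ExtCls C S G A) : ecls G (erep x) = x :=
  Quotient.out_eq (s := (Theory.termCongr ⟨C.toSig.sum S, G⟩).r A) x

theorem ecls_op_congr (k : (C.toSig.sum S).K) {x y : (C.toSig.sum S).ar k → Term (C.toSig.sum S) A}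
    (h : ∀ i, ecls G (x i) = ecls G (y i)) : ecls G (.op k x) = ecls G (.op k y) :=
  ecls_eq_iff.2 (.congr (θ := ⟨C.toSig.sum S, G⟩) k fun i => ecls_eq_iff.1 (h i))

theorem ecls_subst_congr (t : Term (C.toSig.sum S) B) {f g : B → Term (C.toSig.sum S) A}
    (h : ∀ b, ecls G (f b) = ecls G (g b)) : ecls G (t.subst f) = ecls G (t.subst g) :=
  ecls_eq_iff.2 (Theory.Rel.subst_right (θ := ⟨C.toSig.sum S, G⟩) t fun b => ecls_eq_iff.1 (h b))

theorem Theory.Rel.inl {θ : Theory.{u}}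
    {G : ∀ B : Type u, Term (θ.sig.sum S) B → Term (θ.sig.sum S) B → Prop}
    (hG : ∀ (B : Type u) (s t : Term θ.sig B), θ.eqn B s t → G B s.inl t.inl)
    {s t : Term θ.sig B} (h : θ.Rel s t) :
    Theory.Rel ⟨θ.sig.sum S, G⟩ s.inl t.inl := by
  induction h with
  | refl t => exact .refl _
  | symm _ ih => exact ih.symm
  | trans _ _ ih₁ ih₂ => exact ih₁.trans ih₂
  | congr k _ ih => exact .congr (θ := ⟨θ.sig.sum S, G⟩) (Sum.inl k) ih
  | inst h f =>
    rw [Term.inl_subst, Term.inl_subst]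
    exact .inst (θ := ⟨θ.sig.sum S, G⟩) (hG _ _ _ h) _

open Classical in
/-- A term with a given distribution. -/
noncomputable def distTerm (C : Choice.{u}) (d : PMF A) : Term C.toSig A :=
  -- The variable is a default for distributions that no term denotes; admissible distributions
  -- never reach it.
  if h : ∃ t : Term C.toSig A, t.dist = d then h.choose else .var d.support_nonempty.some

theorem IsDistTheory.dist_distTerm (h : IsDistTheory C E fin) {d : PMF A} (hd : Adm fin d) :
    (distTerm C d).dist = d := by
  have := h.exists_dist_eq A d hd
  rw [distTerm, dif_pos this]
  exact this.choose_spec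

/-- The mixture of a distribution of classes of terms. -/
noncomputable def emean (d : PMF (ExtCls C S G A)) : ExtCls C S G A :=
  ecls G ((distTerm C d).inl.subst erep)

/-- Mixtures do not depend on the representing term, by completeness of `E`. The chosen term for the
image distribution and `t` with its variables renamed to classes denote the same distribution, so
they are provably equal, and remain so in the extension because `G` contains `E`. -/
theorem ecls_inl_subst (h : IsDistTheory C E fin)
    (hG : ∀ (B : Type u) (s t : Term C.toSig B), E B s t → G B s.inl t.inl)
    (t : Term C.toSig B) (f : B → Term (C.toSig.sum S) A) :
    ecls G (t.inl.subst f) = emean (t.dist.map fun b => ecls G (f b)) := by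
  have h1 := h.dist_distTerm ((h.adm _ t).map fun b => ecls G (f b))
  have h2 := Theory.Rel.inl (θ := ⟨C.toSig, E⟩) hG (h.complete _ (distTerm C (t.dist.map fun b => ecls G (f b)))
    (t.subst fun b => .var (ecls G (f b))) (by rw [h1, Term.dist_subst]; rfl))
  have h3 := ecls_eq_iff.2 (h2.subst_left erep)
  rw [emean, h3, Term.inl_subst, Term.subst_subst]
  exact ecls_subst_congr _ fun b => (ecls_erep _).symm

theorem emean_pure (h : IsDistTheory C E fin)
    (hG : ∀ (B : Type u) (s t : Term C.toSig B), E B s t → G B s.inl t.inl)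
    (x : ExtCls C S G A) : emean (PMF.pure x) = x := by
  have := ecls_inl_subst (G := G) h hG (.var x) erep
  simp only [Term.inl, Term.subst, Term.dist, PMF.pure_map, ecls_erep] at this
  exact this.symm

/-- Substituting the chosen terms for the inner distributions into the chosen term for `D` gives a
term for the flattened distribution. Computing its class as one mixture or as a mixture of mixtures
yields the two sides. -/
theorem emean_bind (h : IsDistTheory C E fin)
    (hG : ∀ (B : Type u) (s t : Term C.toSig B), E B s t → G B s.inl t.inl)
    (D : PMF (PMF (ExtCls C S G A))) (hD : Adm fin D) (hD' : ∀ d ∈ D.support, Adm fin d) :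
    emean (D.bind id) = emean (D.map emean) := by
  have h1 : ((distTerm C D).subst (distTerm C)).dist = D.bind id := by
    rw [Term.dist_subst, h.dist_distTerm hD]
    exact pmf_bind_congr fun d hd => h.dist_distTerm (hD' d hd)
  have h2 := ecls_inl_subst (G := G) h hG ((distTerm C D).subst (distTerm C)) erep
  have h3 := ecls_inl_subst (G := G) h hG (distTerm C D) fun d => (distTerm C d).inl.subst erep
  simp only [ecls_erep, h1] at h2
  rw [show (fun b : ExtCls C S G A => b) = id from rfl, PMF.map_id] at h2
  rw [← h2, Term.inl_subst, Term.subst_subst, h3, h.dist_distTerm hD]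
  rfl

theorem emean_op (h : IsDistTheory C E fin)
    (hG : ∀ (B : Type u) (s t : Term C.toSig B), E B s t → G B s.inl t.inl) (c : C.K)
    (x : C.ar c → Term (C.toSig.sum S) A) :
    ecls G (.op (.inl c) x) = emean ((C.weight c).map fun i => ecls G (x i)) := by
  have := ecls_inl_subst (G := G) h hG (.op c .var) x
  simp only [Term.inl, Term.subst, Term.dist, PMF.bind_pure] at this
  exact this

/-- The operations of `S` on classes of terms. -/
noncomputable def ereq (k : S.K) (x : S.ar k → ExtCls C S G A) : ExtCls C S G A :=
  ecls G (.op (.inr k) fun i => erep (x i))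

theorem ecls_op_inr (k : S.K) (x : S.ar k → Term (C.toSig.sum S) A) :
    ecls G (.op (.inr k) x) = ereq k fun i => ecls G (x i) :=
  ecls_op_congr (Sum.inr k) fun _ => (ecls_erep _).symm

/-- An algebra with mixtures, constants from `A` and the operations of `S`, generated by these. -/
structure MixAlg (fin : Prop) (S : Sig.{u}) (A : Type u) where
  X : Type u
  mean : PMF X → X
  pt : A → X
  req : ∀ k, (S.ar k → X) → X
  mean_pure : ∀ x, mean (PMF.pure x) = x
  mean_join : ∀ D : PMF (PMF X), Adm fin D → (∀ d ∈ D.support, Adm fin d) →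
    mean (D.bind id) = mean (D.map mean)
  ind : ∀ p : X → Prop, (∀ a, p (pt a)) → (∀ k x, (∀ i, p (x i)) → p (req k x)) →
    (∀ d : PMF X, Adm fin d → (∀ x ∈ d.support, p x) → p (mean d)) → ∀ x, p x

/-- The algebra of classes of terms. -/
noncomputable def extAlg (h : IsDistTheory C E fin)
    (hG : ∀ (B : Type u) (s t : Term C.toSig B), E B s t → G B s.inl t.inl) (A : Type u) :
    MixAlg fin S A where
  X := ExtCls C S G A
  mean := emean
  pt a := ecls G (.var a)
  req := ereq
  mean_pure := emean_pure h hG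
  mean_join := emean_bind h hG
  ind p hpt hreq hmean x := by
    rw [← ecls_erep x]
    induction erep x with
    | var a => exact hpt a
    | op k x ih =>
      rcases k with c | k
      · refine (congrArg p (emean_op h hG c x)).mpr ?_
        have hw : Adm fin (C.weight c) := by
          have := h.adm _ (.op c .var)
          simp only [Term.dist, PMF.bind_pure] at this
          exact this
        refine hmean _ (hw.map _) fun y hy => ?_
        obtain ⟨i, -, rfl⟩ := (PMF.mem_support_map_iff _ _ _).1 hy
        exact ih i
      · refine (congrArg p (ecls_op_inr k x)).mpr ?_
        exact hreq _ _ ih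

namespace MixAlg

variable (M : MixAlg fin S A)

theorem mean_bind {B : Type*} {d : PMF B} {e : B → PMF M.X} (hd : Adm fin d)
    (he : ∀ b ∈ d.support, Adm fin (e b)) :
    M.mean (d.bind e) = M.mean (d.map fun b => M.mean (e b)) := by
  have := M.mean_join (d.map e) (hd.map e) (by
    intro x hx
    obtain ⟨b, hb, rfl⟩ := (PMF.mem_support_map_iff _ _ _).1 hx
    exact he b hb)
  rw [PMF.bind_map, PMF.map_comp] at this
  exact this

theorem mean_map_bind {B : Type*} {D : Type*} {d : PMF B} {e : B → PMF D} (f : D → M.X)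
    (hd : Adm fin d) (he : ∀ b ∈ d.support, Adm fin (e b)) :
    M.mean ((d.bind e).map f) = M.mean (d.map fun b => M.mean ((e b).map f)) := by
  rw [PMF.map_bind, M.mean_bind hd fun b hb => (he b hb).map f]

end MixAlg

end Mixtures

/-! ### Soundness of the choice equations for distributions -/

section Soundness

variable {C : Choice.{u}} {E : ∀ B : Type u, Term C.toSig B → Term C.toSig B → Prop} {A B : Type u}

theorem eval_weight (t : Term C.toSig A) :
    Theory.eval (θ := ⟨C.toSig, E⟩) (M := PMF) C.weight t = t.dist := by
  induction t with
  | var a => rfl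
  | op c x ih => exact congrArg (PMF.bind (C.weight c)) (funext ih)

theorem Term.dist_eq_of_rel
    (sound : ∀ (B : Type u) (s t : Term C.toSig B), E B s t → s.dist = t.dist)
    {s t : Term C.toSig A} (h : Theory.Rel ⟨C.toSig, E⟩ s t) : s.dist = t.dist := by
  have := Theory.eval_eq_of_rel (θ := ⟨C.toSig, E⟩) (M := PMF) (g := C.weight)
    (fun B s t h => by rw [eval_weight, eval_weight, sound _ _ _ h]) h
  rwa [eval_weight, eval_weight] at this

theorem Theory.Rel.of_eqn {θ : Theory.{u}} {s t : Term θ.sig A} (h : θ.eqn A s t) : θ.Rel s t := by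
  have := Theory.Rel.inst h Term.var
  rwa [Term.subst_var, Term.subst_var] at this

end Soundness

/-! ### The `ω`-convex theory -/

namespace OmegaConvexEqn

variable {A B : Type u}

theorem sound (B : Type u) (s t : Term countableChoice.{u}.toSig B) (h : OmegaConvexEqn B s t) :
    s.dist = t.dist := by
  cases h with
  | proj m x => exact PMF.pure_bind (β := B) m fun n => PMF.pure (x n)
  | bary p q x => exact (PMF.bind_bind p q fun n => PMF.pure (x n)).symm

/-- Countable mixtures of variables. -/
noncomputable def nf (p : PMF (ULift.{u} ℕ)) (x : ULift.{u} ℕ → A) :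
    Term countableChoice.{u}.toSig A := .sum p fun n => .var (x n)

theorem rel_sum (p : PMF (ULift.{u} ℕ)) {s t : ULift.{u} ℕ → Term countableChoice.{u}.toSig A}
    (h : ∀ n, omegaConvexTheory.Rel (s n) (t n)) :
    omegaConvexTheory.Rel (Term.sum p s) (Term.sum p t) :=
  Theory.Rel.congr (θ := omegaConvexTheory) p h

/-- `proj` expands each `z (f n)` into a sum with all weight at `f n`, and `bary` absorbs these
point masses into `q`. Reindexing is therefore derivable, including the merging of repeated
variables. -/
theorem rel_nf_map (q : PMF (ULift.{u} ℕ)) (f : ULift.{u} ℕ → ULift.{u} ℕ)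
    (z : ULift.{u} ℕ → A) :
    omegaConvexTheory.Rel (nf q fun n => z (f n)) (nf (q.map f) z) := by
  refine .trans (.symm ?_)
    (Theory.Rel.of_eqn (θ := omegaConvexTheory) (.bary q (fun n => PMF.pure (f n)) z))
  exact rel_sum q fun n => Theory.Rel.of_eqn (θ := omegaConvexTheory) (.proj (f n) z)

theorem exists_rel_nf (t : Term countableChoice.{u}.toSig A) :
    ∃ p x, omegaConvexTheory.Rel t (nf p x) := by
  induction t with
  | var a =>
    exact ⟨PMF.pure ⟨0⟩, fun _ => a,
      (Theory.Rel.of_eqn (θ := omegaConvexTheory) (.proj ⟨0⟩ fun _ => a)).symm⟩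
  | op p t ih =>
    choose q y h using ih
    -- Pairing of indices lays out the countably many sequences `y m` as a single sequence `z`:
    -- `bary` needs all inner sums to range over the same variables.
    let pr : ULift.{u} ℕ → ULift.{u} ℕ → ULift.{u} ℕ := fun m n => ⟨Nat.pair m.down n.down⟩
    let z : ULift.{u} ℕ → A := fun n => y ⟨(Nat.unpair n.down).1⟩ ⟨(Nat.unpair n.down).2⟩
    have hz : ∀ m, (fun n => z (pr m n)) = y m := fun m => by
      funext n
      simp only [z, pr, Nat.unpair_pair]
    refine ⟨PMF.bind p fun m => (q m).map (pr m), z, ?_⟩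
    refine .trans (rel_sum p fun m => .trans (h m) ?_)
      (Theory.Rel.of_eqn (θ := omegaConvexTheory) (.bary p (fun m => (q m).map (pr m)) z))
    exact hz m ▸ rel_nf_map (q m) (pr m) z

/-- Both normal forms are rewritten over one common sequence of variables, the interleaving `z` of
`x` and `y`. There they are brought to a form that depends on the denoted distribution alone. -/
theorem complete (s t : Term countableChoice.{u}.toSig A) (h : s.dist = t.dist) :
    omegaConvexTheory.Rel s t := by
  obtain ⟨p, x, hs⟩ := exists_rel_nf s
  obtain ⟨q, y, ht⟩ := exists_rel_nf t
  let z : ULift.{u} ℕ → A := fun n =>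
    if n.down % 2 = 0 then x ⟨n.down / 2⟩ else y ⟨n.down / 2⟩
  -- `r` selects one index for each variable that occurs in `z`. Moving all weight of a variable to
  -- its selected index turns the weights into the image under `r` of the denoted distribution.
  let r : A → ULift.{u} ℕ := Function.invFun z
  have hx : x = fun n => z ⟨2 * n.down⟩ := by
    funext n
    simp [z]
  have hy : y = fun n => z ⟨2 * n.down + 1⟩ := by
    funext n
    have : (2 * n.down + 1) / 2 = n.down := by omega
    simp [z, this]
  have key : ∀ (v : Term countableChoice.{u}.toSig A) (p : PMF (ULift.{u} ℕ))
      (f : ULift.{u} ℕ → ULift.{u} ℕ), omegaConvexTheory.Rel v (nf p fun n => z (f n)) →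
      omegaConvexTheory.Rel v (nf (v.dist.map r) z) := by
    intro v p f hv
    have hv := hv.trans (rel_nf_map p f z)
    have hd : v.dist = (p.map f).map z := Term.dist_eq_of_rel sound hv
    have e : (nf (p.map f) z) = nf (p.map f) fun n => z (r (z n)) :=
      congrArg (nf (p.map f)) (funext fun n => (Function.invFun_eq ⟨n, rfl⟩).symm)
    rw [e] at hv
    have := hv.trans (rel_nf_map (p.map f) (fun n => r (z n)) z)
    rwa [show (p.map f).map (fun n => r (z n)) = v.dist.map r by
      rw [hd]
      exact (PMF.map_comp z (p.map f) r).symm] at this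
  rw [hx] at hs
  rw [hy] at ht
  exact (key s _ _ hs).trans (h ▸ (key t _ _ ht).symm)

theorem isDistTheory : IsDistTheory countableChoice.{u} OmegaConvexEqn.{u} False where
  sound := sound
  complete _ := complete
  adm _ _ h := h.elim
  exists_dist_eq A d _ := by
    obtain ⟨p, x, h, -⟩ := exists_nat_map d
    refine ⟨nf (p.map ULift.up) fun n => x n.down, ?_⟩
    refine (PMF.map_comp ULift.up p fun n : ULift.{u} ℕ => x n.down).trans ?_
    exact h

end OmegaConvexEqn

/-! ### The convex theory -/

namespace ConvexEqn

variable {A B : Type u}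

theorem dist_cc (p : Set.Ioo (0 : ℝ) 1) (s t : Term binaryChoice.{u}.toSig B) (b : B) :
    (Term.cc p s t).dist b = ENNReal.ofReal p * s.dist b + ENNReal.ofReal (1 - p) * t.dist b := by
  have : (Term.cc p s t).dist b = ∑' i : ULift.{u} Bool,
      coin p i * (Term.dist (cond i.down s t)) b := rfl
  rw [this, tsum_fintype, ← Equiv.sum_comp Equiv.ulift.symm]
  simp [coin]

theorem op_eq_cc (c : binaryChoice.{u}.K) (x : binaryChoice.{u}.ar c →
    Term binaryChoice.{u}.toSig A) : Term.op c x = .cc c.down (x ⟨true⟩) (x ⟨false⟩) := by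
  refine congrArg (Term.op (S := binaryChoice.toSig) c) (funext fun b => ?_)
  rcases b with ⟨_ | _⟩ <;> rfl

theorem subst_cc (p : Set.Ioo (0 : ℝ) 1) (s t : Term binaryChoice.{u}.toSig A)
    (f : A → Term binaryChoice.{u}.toSig B) :
    (Term.cc p s t).subst f = .cc p (s.subst f) (t.subst f) := by
  refine congrArg (Term.op (S := binaryChoice.toSig) (ULift.up p)) (funext fun b => ?_)
  rcases b with ⟨_ | _⟩ <;> rfl

theorem ofReal_add_ofReal (p : Set.Ioo (0 : ℝ) 1) :
    ENNReal.ofReal p + ENNReal.ofReal (1 - p) = 1 := by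
  rw [← ENNReal.ofReal_add p.2.1.le (sub_nonneg.2 p.2.2.le)]
  simp

theorem sound (B : Type u) (s t : Term binaryChoice.{u}.toSig B) (h : ConvexEqn B s t) :
    s.dist = t.dist := by
  ext b
  cases h with
  | idem p x => rw [dist_cc, ← add_mul, ofReal_add_ofReal, one_mul]
  | comm p q h x y =>
    rw [dist_cc, dist_cc, h, sub_sub_cancel, add_comm]
  | assoc p q r s hr hs x y z =>
    have hp0 := p.2.1
    have hp1 := p.2.2
    have hq0 := q.2.1
    have hq1 := q.2.2
    have hpq : (p : ℝ) * q < 1 := by nlinarith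
    have hne : 1 - (p : ℝ) * q ≠ 0 := by linarith
    simp only [dist_cc, mul_add, ← mul_assoc, ← add_assoc]
    have h1 : ENNReal.ofReal q * ENNReal.ofReal p = ENNReal.ofReal r := by
      rw [← ENNReal.ofReal_mul hq0.le, hr, mul_comm]
    have h2 : ENNReal.ofReal q * ENNReal.ofReal (1 - p) =
        ENNReal.ofReal (1 - r) * ENNReal.ofReal s := by
      rw [← ENNReal.ofReal_mul hq0.le, ← ENNReal.ofReal_mul (sub_nonneg.2 r.2.2.le), hr, hs,
        mul_div_cancel₀ _ hne, mul_comm]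
    have h3 : ENNReal.ofReal (1 - q) = ENNReal.ofReal (1 - r) * ENNReal.ofReal (1 - s) := by
      rw [← ENNReal.ofReal_mul (sub_nonneg.2 r.2.2.le), mul_sub, mul_one, hr, hs,
        mul_div_cancel₀ _ hne]
      congr 1
      ring
    rw [h1, h2, h3]

theorem rel_cc (p : Set.Ioo (0 : ℝ) 1) {s s' t t' : Term binaryChoice.{u}.toSig A}
    (hs : convexTheory.Rel s s') (ht : convexTheory.Rel t t') :
    convexTheory.Rel (Term.cc p s t) (Term.cc p s' t') := by
  refine Theory.Rel.congr (θ := convexTheory) (ULift.up p) fun b => ?_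
  rcases b with ⟨_ | _⟩
  · exact ht
  · exact hs

theorem rel_inst {s t : Term binaryChoice.{u}.toSig B} (h : ConvexEqn B s t)
    (f : B → Term binaryChoice.{u}.toSig A) :
    convexTheory.Rel (Term.subst (S := binaryChoice.toSig) f s)
      (Term.subst (S := binaryChoice.toSig) f t) :=
  Theory.Rel.inst (θ := convexTheory) h f

theorem rel_idem (p : Set.Ioo (0 : ℝ) 1) (s : Term binaryChoice.{u}.toSig A) :
    convexTheory.Rel (Term.cc p s s) s := by
  have := rel_inst (.idem p s) id
  rw [subst_cc] at this
  exact this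

/-- The new weight is left existential, here and in the rebracketing lemmas: only the shape of terms
matters until `complete`, where weights are read off from distributions. -/
theorem rel_comm (p : Set.Ioo (0 : ℝ) 1) (s t : Term binaryChoice.{u}.toSig A) :
    ∃ q, convexTheory.Rel (Term.cc p s t) (Term.cc q t s) := by
  have hp0 := p.2.1
  have hp1 := p.2.2
  refine ⟨⟨1 - p, by constructor <;> linarith⟩, ?_⟩
  have := rel_inst (.comm p ⟨1 - p, by constructor <;> linarith⟩ rfl s t)
    id
  rw [subst_cc, subst_cc] at this
  exact this

theorem rel_assoc (p q : Set.Ioo (0 : ℝ) 1) (s t v : Term binaryChoice.{u}.toSig A) :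
    ∃ r w, convexTheory.Rel (Term.cc q (Term.cc p s t) v) (Term.cc r s (Term.cc w t v)) := by
  have hp0 := p.2.1
  have hp1 := p.2.2
  have hq0 := q.2.1
  have hq1 := q.2.2
  have hpq : (p : ℝ) * q < 1 := by nlinarith
  let r : Set.Ioo (0 : ℝ) 1 := ⟨p * q, mul_pos hp0 hq0, hpq⟩
  let w : Set.Ioo (0 : ℝ) 1 := ⟨(1 - p) * q / (1 - p * q),
    div_pos (mul_pos (by linarith) hq0) (by linarith), by
      rw [div_lt_one (by linarith)]
      linarith⟩
  refine ⟨r, w, ?_⟩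
  have := rel_inst (.assoc p q r w rfl rfl s t v) id
  rw [subst_cc, subst_cc, subst_cc, subst_cc] at this
  exact this

/-- Rebracketing to the left is rebracketing to the right conjugated by commutativity. -/
theorem rel_assoc' (q r : Set.Ioo (0 : ℝ) 1) (s t v : Term binaryChoice.{u}.toSig A) :
    ∃ p w, convexTheory.Rel (Term.cc q s (Term.cc r t v)) (Term.cc w (Term.cc p s t) v) := by
  obtain ⟨q₁, h₁⟩ := rel_comm q s (Term.cc r t v)
  obtain ⟨r₁, h₂⟩ := rel_comm r t v
  obtain ⟨q₂, r₂, h₃⟩ := rel_assoc r₁ q₁ v t s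
  obtain ⟨q₃, h₄⟩ := rel_comm q₂ v (Term.cc r₂ t s)
  obtain ⟨r₃, h₅⟩ := rel_comm r₂ t s
  exact ⟨r₃, q₃, h₁.trans ((rel_cc q₁ h₂ (.refl _)).trans
    (h₃.trans (h₄.trans (rel_cc q₃ h₅ (.refl _)))))⟩

/-- The term `t` is provably equal to the variable `a`, or to a choice between `a` and a term that
does not have `a` in its support. -/
def Head (a : A) (t : Term binaryChoice.{u}.toSig A) : Prop :=
  convexTheory.Rel t (.var a) ∨
    ∃ p t', Term.dist t' a = 0 ∧ convexTheory.Rel t (.cc p (.var a) t')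

theorem Head.of_rel {a : A} {s t : Term binaryChoice.{u}.toSig A} (h : convexTheory.Rel s t)
    (ht : Head a t) : Head a s := by
  rcases ht with ht | ⟨p, t', h0, ht⟩
  · exact .inl (h.trans ht)
  · exact .inr ⟨p, t', h0, h.trans ht⟩

theorem Head.cc_left {a : A} {s t : Term binaryChoice.{u}.toSig A} (q : Set.Ioo (0 : ℝ) 1)
    (hs : Head a s) (ht : t.dist a = 0) : Head a (.cc q s t) := by
  rcases hs with hs | ⟨p, s', h0, hs⟩
  · exact .inr ⟨q, t, ht, rel_cc q hs (.refl _)⟩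
  · obtain ⟨r, w, h⟩ := rel_assoc p q (.var a) s' t
    exact .inr ⟨r, .cc w s' t, by simp [dist_cc, h0, ht],
      (rel_cc q hs (.refl _)).trans h⟩

theorem Head.cc_var {a : A} {t : Term binaryChoice.{u}.toSig A} (q : Set.Ioo (0 : ℝ) 1)
    (ht : Head a t) : Head a (.cc q (.var a) t) := by
  rcases ht with ht | ⟨p, t', h0, ht⟩
  · exact .inl ((rel_cc q (.refl _) ht).trans (rel_idem q _))
  · obtain ⟨r, w, h⟩ := rel_assoc' q p (.var a) (.var a) t'
    exact .inr ⟨w, t', h0, (rel_cc q (.refl _) ht).trans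
      (h.trans (rel_cc w (rel_idem r _) (.refl _)))⟩

theorem Head.comm {a : A} {s t : Term binaryChoice.{u}.toSig A} {p : Set.Ioo (0 : ℝ) 1}
    (h : ∀ q, Head a (.cc q t s)) : Head a (.cc p s t) := by
  obtain ⟨q, hq⟩ := rel_comm p s t
  exact (h q).of_rel hq

/-- If `s` is `a` mixed with `s'`, then associativity pulls this `a` out in front of a choice
between `s'` and `t`. That choice has a head form because `a` occurs only in `t`, and idempotence
merges the two copies of `a`. -/
theorem Head.cc {a : A} {s t : Term binaryChoice.{u}.toSig A} (q : Set.Ioo (0 : ℝ) 1)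
    (hs : Head a s) (ht : Head a t) : Head a (.cc q s t) := by
  rcases hs with hs | ⟨p, s', h0, hs⟩
  · exact (ht.cc_var q).of_rel (rel_cc q hs (.refl _))
  · refine Head.of_rel (rel_cc q hs (.refl _)) ?_
    obtain ⟨r, w, h⟩ := rel_assoc p q (.var a) s' t
    refine (Head.cc_var r ?_).of_rel h
    exact Head.comm fun q' => ht.cc_left q' h0

theorem head_of_ne_zero {a : A} (t : Term binaryChoice.{u}.toSig A) (h : t.dist a ≠ 0) :
    Head a t := by
  induction t with
  | var b =>
    by_cases hb : a = b
    · exact .inl (hb ▸ .refl _)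
    · exact absurd (PMF.pure_apply_of_ne b a hb) h
  | op c x ih =>
    rw [op_eq_cc] at h ⊢
    by_cases h1 : (x ⟨true⟩).dist a = 0
    · by_cases h2 : (x ⟨false⟩).dist a = 0
      · exact absurd (by rw [dist_cc, h1, h2, mul_zero, mul_zero, add_zero]) h
      · exact Head.comm fun q => (ih ⟨false⟩ h2).cc_left q h1
    · by_cases h2 : (x ⟨false⟩).dist a = 0
      · exact (ih ⟨true⟩ h1).cc_left _ h2
      · exact (ih ⟨true⟩ h1).cc _ (ih ⟨false⟩ h2)

theorem adm (t : Term binaryChoice.{u}.toSig A) : t.dist.support.Finite := by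
  induction t with
  | var a => exact (adm_pure a : Adm True _) trivial
  | op c x ih =>
    exact Adm.bind (fin := True) (d := binaryChoice.weight c)
      (fun _ => Set.toFinite (α := ULift Bool) _) (fun i _ _ => ih i) trivial

theorem ofReal_sub_ne_zero (p : Set.Ioo (0 : ℝ) 1) : ENNReal.ofReal (1 - p) ≠ 0 :=
  (ENNReal.ofReal_pos.2 (sub_pos.2 p.2.2)).ne'

theorem dist_cc_var_ne {a b : A} (p : Set.Ioo (0 : ℝ) 1) (t : Term binaryChoice.{u}.toSig A)
    (hb : b ≠ a) : (Term.cc p (.var a) t).dist b = ENNReal.ofReal (1 - p) * t.dist b := by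
  rw [dist_cc, Term.dist, PMF.pure_apply_of_ne a b hb, mul_zero, zero_add]

theorem dist_cc_var_self {a : A} (p : Set.Ioo (0 : ℝ) 1) {t : Term binaryChoice.{u}.toSig A}
    (h : t.dist a = 0) : (Term.cc p (.var a) t).dist a = ENNReal.ofReal p := by
  rw [dist_cc, Term.dist, PMF.pure_apply_self, mul_one, h, mul_zero, add_zero]

theorem dist_cc_var_ne_pure {a : A} (p : Set.Ioo (0 : ℝ) 1) {t : Term binaryChoice.{u}.toSig A}
    (h : t.dist a = 0) : PMF.pure a ≠ (Term.cc p (.var a) t).dist := by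
  intro he
  have := DFunLike.congr_fun he a
  rw [dist_cc_var_self p h, PMF.pure_apply_self, eq_comm, ENNReal.ofReal_eq_one] at this
  exact p.2.2.ne this

/-- Induction on the size of the support. A variable `a` of the support is isolated in both terms as
a first argument; its weight is the mass at `a`, hence the same on both sides. Cancelling the
complementary weight leaves remainders with equal distributions and without `a`. If only one side is
a bare `a`, the masses at `a` differ. -/
theorem complete (s t : Term binaryChoice.{u}.toSig A) (h : s.dist = t.dist) :
    convexTheory.Rel s t := by
  obtain ⟨n, hn⟩ : ∃ n, s.dist.support.ncard = n := ⟨_, rfl⟩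
  induction n using Nat.strong_induction_on generalizing s t with
  | _ n ih =>
    obtain ⟨a, ha⟩ := s.dist.support_nonempty
    rcases head_of_ne_zero s ha with hs | ⟨p, s', hs0, hs⟩ <;>
      rcases head_of_ne_zero t (h ▸ ha) with ht | ⟨q, t', ht0, ht⟩
    · exact hs.trans ht.symm
    · have e := ((Term.dist_eq_of_rel sound hs).symm.trans h).trans (Term.dist_eq_of_rel sound ht)
      exact absurd e (dist_cc_var_ne_pure q ht0)
    · have e := ((Term.dist_eq_of_rel sound hs).symm.trans h).trans (Term.dist_eq_of_rel sound ht)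
      exact absurd e.symm (dist_cc_var_ne_pure p hs0)
    · have hs1 := Term.dist_eq_of_rel sound hs
      have e := (hs1.symm.trans h).trans (Term.dist_eq_of_rel sound ht)
      have ea := DFunLike.congr_fun e a
      rw [dist_cc_var_self p hs0, dist_cc_var_self q ht0,
        ENNReal.ofReal_eq_ofReal_iff p.2.1.le q.2.1.le] at ea
      obtain rfl : p = q := Subtype.ext ea
      have e' : s'.dist = t'.dist := by
        ext b
        by_cases hb : b = a
        · rw [hb, hs0, ht0]
        · have := DFunLike.congr_fun e b
          rw [dist_cc_var_ne _ _ hb, dist_cc_var_ne _ _ hb] at this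
          exact (ENNReal.mul_right_inj (ofReal_sub_ne_zero p) ENNReal.ofReal_ne_top).1 this
      refine hs.trans ((rel_cc p (.refl _) (ih _ ?_ s' t' e' rfl)).trans ht.symm)
      rw [← hn]
      refine Set.ncard_lt_ncard ⟨fun b hb => ?_, fun hsub => hsub ha hs0⟩ (adm s)
      have hba : b ≠ a := fun h => hb (h ▸ hs0)
      rw [PMF.mem_support_iff, hs1, dist_cc_var_ne _ _ hba]
      exact mul_ne_zero (ofReal_sub_ne_zero p) hb

/-- Induction on the size of the support: unless `d` is a point mass, it is the choice with weight
`d a` between `a` and `d` conditioned on avoiding `a`. -/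
theorem exists_dist_eq (d : PMF A) (hd : d.support.Finite) :
    ∃ t : Term binaryChoice.{u}.toSig A, t.dist = d := by
  obtain ⟨n, hn⟩ : ∃ n, d.support.ncard = n := ⟨_, rfl⟩
  induction n using Nat.strong_induction_on generalizing d with
  | _ n ih =>
    obtain ⟨a, ha⟩ := d.support_nonempty
    by_cases h1 : d a = 1
    · refine ⟨.var a, (pmf_eq_of_le fun b => ?_)⟩
      by_cases hb : b = a
      · rw [hb, h1]
        exact PMF.coe_le_one _ _
      · exact (PMF.pure_apply_of_ne a b hb).le.trans zero_le
    · have hsum := toOuterMeasure_add_compl d {a}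
      rw [PMF.toOuterMeasure_apply_singleton] at hsum
      have hne : d.toOuterMeasure {a}ᶜ ≠ 0 := fun h0 => h1 (by rwa [h0, add_zero] at hsum)
      have hex : ∃ b ∈ ({a}ᶜ : Set A), b ∈ d.support := by
        rw [Ne, PMF.toOuterMeasure_apply_eq_zero_iff, Set.not_disjoint_iff] at hne
        obtain ⟨b, hb, hb'⟩ := hne
        exact ⟨b, hb', hb⟩
      have hsupp : (d.filter {a}ᶜ hex).support = {a}ᶜ ∩ d.support := PMF.support_filter _
      have hlt : (d.filter {a}ᶜ hex).support.ncard < n := by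
        rw [← hn, hsupp]
        exact Set.ncard_lt_ncard ⟨Set.inter_subset_right, fun hsub => (hsub ha).1 rfl⟩ hd
      obtain ⟨t, ht⟩ := ih _ hlt (d.filter {a}ᶜ hex)
        (hsupp ▸ hd.subset Set.inter_subset_right) rfl
      have hpt : d a ≠ ∞ := PMF.apply_ne_top _ _
      have hlt1 : d a < 1 := lt_of_le_of_ne (PMF.coe_le_one _ _) h1
      let p : Set.Ioo (0 : ℝ) 1 := ⟨(d a).toReal, ENNReal.toReal_pos ha hpt, by
        rw [← ENNReal.toReal_one, ENNReal.toReal_lt_toReal hpt ENNReal.one_ne_top]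
        exact hlt1⟩
      have hp : ENNReal.ofReal p = d a := ENNReal.ofReal_toReal hpt
      have hp' : ENNReal.ofReal (1 - p) = d.toOuterMeasure {a}ᶜ := by
        have := ofReal_add_ofReal p
        rw [hp, ← hsum] at this
        exact (ENNReal.add_right_inj hpt).1 this
      refine ⟨.cc p (.var a) t, ?_⟩
      ext b
      by_cases hb : b = a
      · rw [hb, dist_cc_var_self, hp]
        rw [ht]
        exact PMF.filter_apply_eq_zero_of_notMem _ fun h => h rfl
      · rw [dist_cc_var_ne _ _ hb, ht, hp', PMF.filter_apply,
          Set.indicator_of_mem (show b ∈ ({a}ᶜ : Set A) from hb), mul_left_comm,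
          ← PMF.toOuterMeasure_apply, ENNReal.mul_inv_cancel hne, mul_one]
        rw [← hp']
        exact ENNReal.ofReal_ne_top

theorem isDistTheory : IsDistTheory binaryChoice.{u} ConvexEqn.{u} True where
  sound := sound
  complete _ := complete
  adm _ t _ := adm t
  exists_dist_eq _ d hd := exists_dist_eq d (hd trivial)

end ConvexEqn

/-! ### The distribution monads as monads of the two theories -/

theorem presents_finDist : convexTheory.{u}.Presents FinDist.{u} FinDist.gen := by
  have key : ∀ (A : Type u) (t : Term binaryChoice.{u}.toSig A),
      (Theory.eval (θ := convexTheory) FinDist.gen t).1 = t.dist := by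
    intro A t
    induction t with
    | var a => rfl
    | op c x ih => exact congrArg (PMF.bind (binaryChoice.weight c)) (funext ih)
  refine Theory.presents_of (fun B s t h => ?_) (fun A s t h => ?_) fun A d => ?_
  · exact Subtype.ext ((key B s).trans ((ConvexEqn.sound _ _ _ h).trans (key B t).symm))
  · exact ConvexEqn.complete s t ((key A s).symm.trans ((congrArg Subtype.val h).trans (key A t)))
  · obtain ⟨t, ht⟩ := ConvexEqn.exists_dist_eq d.1 d.2
    exact ⟨t, Subtype.ext ((key A t).trans ht)⟩

theorem presents_pmf : omegaConvexTheory.{u}.Presents PMF.{u} distGen := by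
  have key : ∀ (A : Type u) (t : Term countableChoice.{u}.toSig A),
      Theory.eval (θ := omegaConvexTheory) distGen t = t.dist := fun A t => eval_weight t
  refine Theory.presents_of (fun B s t h => ?_) (fun A s t h => ?_) fun A d => ?_
  · exact (key B s).trans ((OmegaConvexEqn.sound _ _ _ h).trans (key B t).symm)
  · exact OmegaConvexEqn.complete s t ((key A s).symm.trans (h.trans (key A t)))
  · obtain ⟨t, ht⟩ := OmegaConvexEqn.isDistTheory.exists_dist_eq A d False.elim
    exact ⟨t, (key A t).trans ht⟩

/-! ### Programs modulo bisimilarity -/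

/-- Points of the support that `f` sends to `z` are related only to points that `g` sends to `z`, so
one image distribution is pointwise below the other. Equal total mass makes them equal. -/
theorem DRel.map_eq {X Y Z : Type u} {R : X → Y → Prop} {d : PMF X} {e : PMF Y} (h : DRel R d e)
    {f : X → Z} {g : Y → Z} (hfg : ∀ x ∈ d.support, ∀ y, R x y → f x = g y) :
    d.map f = e.map g := by
  refine pmf_eq_of_le fun z => ?_
  rw [← PMF.toOuterMeasure_apply_singleton, ← PMF.toOuterMeasure_apply_singleton,
    PMF.toOuterMeasure_map_apply, PMF.toOuterMeasure_map_apply,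
    ← PMF.toOuterMeasure_apply_inter_support]
  refine (h _).trans (e.toOuterMeasure.mono ?_)
  rintro y ⟨x, ⟨hx, hxd⟩, hxy⟩
  exact (hfg x hxd y hxy).symm.trans hx

/-- Bisimilarity with the single pair `(x, y)` adjoined is a bisimulation. -/
theorem bisimilar_of_eq {S : Sig.{u}} {X : Type u} {ζ : X → PMF (S.H X)} {x y : X}
    (h : ζ x = ζ y) : Bisimilar S ζ x y := by
  refine ⟨fun x' y' => (x' = x ∧ y' = y) ∨ Bisimilar S ζ x' y', ?_, .inl ⟨rfl, rfl⟩⟩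
  rintro x' y' (⟨rfl, rfl⟩ | h')
  · rw [h]
    exact DRel.of_refl (fun ⟨k, x⟩ => .mk k x x fun _ => .inr ((Bisimilar.equivalence ζ).refl _)) _
  · exact (Bisimilar.step _ _ h').mono fun _ _ => HRel.mono fun _ _ => .inr

section Programs

variable {C : Choice.{u}} {S : Sig.{u}} {A B : Type u}

/-- Terms as programs. -/
def Term.toProg : Term (C.toSig.sum S) A → Prog C (S.addConst A)
  | .var a => .const a
  | .op (.inl c) x => .choice c fun i => (x i).toProg
  | .op (.inr k) x => .req (.inl k) fun i => (x i).toProg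

/-- Programs as terms. -/
def Prog.toTerm : Prog C (S.addConst A) → Term (C.toSig.sum S) A
  | .req (.inl k) x => .op (.inr k) fun i => (x i).toTerm
  | .req (.inr a) _ => .var a
  | .choice c x => .op (.inl c) fun i => (x i).toTerm

theorem Term.toTerm_toProg (t : Term (C.toSig.sum S) A) : t.toProg.toTerm = t := by
  induction t with
  | var a => rfl
  | op k x ih =>
    rcases k with c | k
    · exact congrArg (Term.op (S := C.toSig.sum S) (.inl c)) (funext ih)
    · exact congrArg (Term.op (S := C.toSig.sum S) (.inr k)) (funext ih)

theorem Prog.toProg_toTerm (M : Prog C (S.addConst A)) : M.toTerm.toProg = M := by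
  induction M with
  | req k x ih =>
    rcases k with k | a
    · exact congrArg (Prog.req (S := S.addConst A) (.inl k)) (funext ih)
    · exact congrArg (Prog.req (S := S.addConst A) (.inr a)) (funext fun i => i.elim)
  | choice c x ih => exact congrArg (Prog.choice c) (funext ih)

theorem step_toProg_inl (t : Term C.toSig A) :
    (t.inl (T := S)).toProg.step = t.dist.bind fun a => (Prog.const a : Prog C _).step := by
  induction t with
  | var a => exact (PMF.pure_bind a fun a => (Prog.const a : Prog C (S.addConst A)).step).symm
  | op c x ih =>
    simp only [Term.inl, Term.toProg, Term.dist, Prog.step, PMF.bind_bind]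
    exact congrArg _ (funext ih)

variable {E : ∀ B : Type u, Term C.toSig B → Term C.toSig B → Prop} {fin : Prop}

theorem eval_progBisim (t : Term (C.toSig.sum S) A) :
    Theory.eval (θ := Theory.freeExt ⟨C.toSig, E⟩ S) (ProgBisim.gen C S) t =
      (progCongr C S).cls t.toProg := by
  induction t with
  | var a => rfl
  | op k x ih =>
    rcases k with c | k
    · refine (congrArg (fun f => ProgBisim.gen C S (.inl c) >>= f) (funext ih)).trans ?_
      exact (progCongr C S).cls_bind _ _
    · refine (congrArg (fun f => ProgBisim.gen C S (.inr k) >>= f) (funext ih)).trans ?_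
      exact (progCongr C S).cls_bind _ _

variable {G : ∀ B : Type u, Term (C.toSig.sum S) B → Term (C.toSig.sum S) B → Prop}

/-- The value of a transition of programs. -/
noncomputable def headVal
    (G : ∀ B : Type u, Term (C.toSig.sum S) B → Term (C.toSig.sum S) B → Prop) :
    (S.addConst A).H (Prog C (S.addConst A)) → ExtCls C S G A
  | ⟨.inl k, x⟩ => ereq k fun i => ecls G (x i).toTerm
  | ⟨.inr a, _⟩ => ecls G (.var a)

theorem IsDistTheory.adm_weight (h : IsDistTheory C E fin) (c : C.K) : Adm fin (C.weight c) := by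
  have := h.adm _ (.op c .var)
  simp only [Term.dist, PMF.bind_pure] at this
  exact this

theorem adm_step (h : IsDistTheory C E fin) (M : Prog C S) : Adm fin M.step := by
  induction M with
  | req k x ih => exact adm_pure _
  | choice c x ih => exact (h.adm_weight c).bind fun i _ => ih i

/-- All choices made before the first request collapse into a single mixture over the transition
distribution. In this form provable equality can be compared with bisimilarity one step at a time.
-/
theorem ecls_toTerm (h : IsDistTheory C E fin)
    (hG : ∀ (B : Type u) (s t : Term C.toSig B), E B s t → G B s.inl t.inl)
    (M : Prog C (S.addConst A)) : ecls G M.toTerm = emean (M.step.map (headVal G)) := by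
  induction M with
  | req k x ih =>
    rw [Prog.step, PMF.pure_map, emean_pure h hG]
    rcases k with k | a
    · exact ecls_op_inr k _
    · rfl
  | choice c x ih =>
    refine (emean_op h hG c _).trans ?_
    simp only [ih]
    exact ((extAlg h hG A).mean_map_bind (headVal G) (h.adm_weight c)
      fun i _ => adm_step h (x i)).symm

/-- Both classes are mixtures over transition distributions. These have equal images among the
classes as soon as related continuations have equal classes, which is the inductive hypothesis. -/
theorem ecls_eq_of_bisimilar (h : IsDistTheory C E fin)
    (hG : ∀ (B : Type u) (s t : Term C.toSig B), E B s t → G B s.inl t.inl)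
    (M N : Prog C (S.addConst A)) (hMN : Bisimilar _ Prog.step M N) :
    ecls G M.toTerm = ecls G N.toTerm := by
  -- The hypothesis concerns the continuations reachable by a transition of `M`, not its immediate
  -- subprograms: bisimilarity of `M` and `N` says nothing about the branches of a choice.
  have main : ∀ M : Prog C (S.addConst A),
      (∀ a ∈ M.step.support, ∀ i N, Bisimilar _ Prog.step (a.2 i) N →
        ecls G (a.2 i).toTerm = ecls G N.toTerm) →
      ∀ N, Bisimilar _ Prog.step M N → ecls G M.toTerm = ecls G N.toTerm := by
    intro M hM N hMN
    rw [ecls_toTerm h hG, ecls_toTerm h hG]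
    refine congrArg _ ((Bisimilar.step M N hMN).map_eq fun a ha b hab => ?_)
    obtain ⟨k | a, x, y, hxy⟩ := hab
    · exact congrArg (ereq k) (funext fun i => hM _ ha i _ (hxy i))
    · rfl
  refine main M ?_ N hMN
  clear hMN N
  induction M with
  | req k x ih =>
    intro a ha i N hN
    obtain rfl := (PMF.mem_support_pure_iff _ _).1 ha
    exact main _ (ih i) N hN
  | choice c x ih =>
    -- A transition of a choice is a transition of one of its branches, so the hypothesis on
    -- continuations passes up unchanged.
    intro a ha
    obtain ⟨i, -, hi⟩ := (PMF.mem_support_bind_iff _ _ _).1 ha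
    exact ih i a hi

theorem presents_progBisim (h : IsDistTheory C E fin) :
    (Theory.freeExt ⟨C.toSig, E⟩ S).Presents (ProgBisim C S) (ProgBisim.gen C S) := by
  have hG : ∀ (B : Type u) (s t : Term C.toSig B), E B s t →
      Theory.FreeExtEqn ⟨C.toSig, E⟩ S B s.inl t.inl := fun B s t h => .base h
  refine Theory.presents_of (fun B s t hst => ?_) (fun A s t hst => ?_) fun A d => ?_
  · obtain ⟨hst⟩ := hst
    refine (eval_progBisim _).trans (.trans ?_ (eval_progBisim _).symm)
    refine Quotient.sound (s := (progCongr C S).r B) (bisimilar_of_eq ?_)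
    exact (step_toProg_inl _).trans ((h.sound _ _ _ hst) ▸ (step_toProg_inl _).symm)
  · have hb := (eval_progBisim s).symm.trans (hst.trans (eval_progBisim t))
    have := ecls_eq_of_bisimilar h hG _ _ (Quotient.exact (s := (progCongr C S).r A) hb)
    exact ecls_eq_iff.1 ((congrArg _ (Term.toTerm_toProg (C := C) s)).symm.trans
      (this.trans (congrArg _ (Term.toTerm_toProg (C := C) t))))
  · obtain ⟨M, rfl⟩ := (progCongr C S).exists_rep d
    refine ⟨M.toTerm, (eval_progBisim _).trans ?_⟩
    rw [Prog.toProg_toTerm]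

end Programs

/-! ### Values of strategies -/

section Cores

variable {S : Sig.{u}} {A B : Type u}

/-- The values of a play-measure over `S + A`. -/
abbrev Core (S : Sig.{u}) (A : Type u) : Type u := Play S → S.K ⊕ A → ℝ≥0∞

open Classical in
/-- Output `k` and, after the input `i`, follow `f i`. -/
noncomputable def outPass (k : S.K) (f : S.ar k → Core S A) : Core S A
  | [], .inl l => if l = k then 1 else 0
  | [], .inr _ => 0
  | ⟨k', i⟩ :: s, l => if h : k' = k then f (h ▸ i) s l else 0

theorem outPass_cons_self (k : S.K) (f : S.ar k → Core S A) (i : S.ar k) (s : Play S)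
    (l : S.K ⊕ A) : outPass k f (⟨k, i⟩ :: s) l = f i s l := by
  simp [outPass]

theorem outPass_cons_ne {k k' : S.K} (h : k' ≠ k) (f : S.ar k → Core S A) (i : S.ar k')
    (s : Play S) (l : S.K ⊕ A) : outPass k f (⟨k', i⟩ :: s) l = 0 := by
  simp [outPass, h]

theorem outPass_inl_self (k : S.K) (f : S.ar k → Core S A) : outPass k f [] (.inl k) = 1 := by
  simp [outPass]

theorem outPass_nil_ne {k : S.K} {l : S.K ⊕ A} (h : l ≠ .inl k)
    (f : S.ar k → Core S A) : outPass k f [] l = 0 := by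
  rcases l with l | a
  · exact if_neg fun h' => h (congrArg _ h')
  · rfl

theorem tsum_outPass (k : S.K) (f : S.ar k → Core S A) : ∑' l, outPass k f [] l = 1 := by
  rw [tsum_eq_single (.inl k) fun l hl => outPass_nil_ne hl f, outPass_inl_self]

theorem outPass_consistent (k : S.K) {f : S.ar k → Core S A}
    (hf : ∀ i, Consistent (X := Σ k : S.K, S.ar k) Sigma.fst (f i))
    (hw : ∀ i, ∑' l, f i [] l = 1) :
    Consistent (X := Σ k : S.K, S.ar k) Sigma.fst (outPass k f) := by
  rintro (_ | ⟨⟨k', i⟩, s⟩) ⟨l, j⟩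
  · by_cases h : l = k
    · subst h
      simp only [List.nil_append, outPass_cons_self, hw, outPass_inl_self]
    · simp only [List.nil_append, outPass_cons_ne h, tsum_zero]
      exact (outPass_nil_ne (fun h' => h (Sum.inl_injective h')) f).symm
  · by_cases h : k' = k
    · subst h
      simp only [List.cons_append, outPass_cons_self]
      exact hf i s ⟨l, j⟩
    · simp only [List.cons_append, outPass_cons_ne h, tsum_zero]

theorem bindPass_distPass (f : A → Core S B) (d : PMF A) (t : Play S) (l : S.K ⊕ B) :
    bindPass f (distPass d) t l = ∑' a, d a * f a t l := by
  cases t with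
  | nil =>
    rw [bindPass_nil]
    rcases l with l | l <;> simp [distPass]
  | cons x s =>
    have h0 : (fun t => distPass (K := S.K) d (x :: t)) = fun _ _ => 0 := by
      funext t l
      exact distPass_cons _ _ _ _
    rw [bindPass_cons, h0, bindPass_zero, zero_add]
    rfl

/-- After `k` and the input `i`, what remains of `reqPass k` is the strategy that outputs the
constant `i`, for which substitution is the left unit law. After any other output nothing remains.
-/
theorem bindPass_reqPass (k : S.K) (f : S.ar k → Core S B) (t : Play S) (l : S.K ⊕ B) :
    bindPass f (reqPass k) t l = outPass k f t l := by
  classical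
  have h0 : ∀ i, reqPass (S := S) k [] (.inr i) = 0 := fun i => rfl
  cases t with
  | nil =>
    rw [bindPass_nil]
    simp only [h0, zero_mul, tsum_zero, add_zero]
    rcases l with l | l <;> rfl
  | cons x s =>
    rw [bindPass_cons]
    simp only [h0, zero_mul, tsum_zero, add_zero]
    obtain ⟨k', i⟩ := x
    by_cases h : k' = k
    · subst h
      rw [outPass_cons_self, ← bindPass_pure_left i f s l]
      congr 1
      funext t l
      rcases t with _ | ⟨x, t⟩
      · rcases l with l | j
        · rfl
        · simp [reqPass, distPass, PMF.pure_apply, eq_comm]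
      · rw [reqPass_cons_cons, distPass_cons]
    · rw [outPass_cons_ne h]
      have : (fun t => reqPass k (⟨k', i⟩ :: t)) = fun _ _ => 0 := by
        funext t l
        rcases t with _ | ⟨x, t⟩
        · rcases l with l | j
          · rfl
          · exact if_neg fun h' => h (Sigma.mk.inj h').1
        · exact reqPass_cons_cons _ _ _ _ _
      rw [this, bindPass_zero]

theorem Consistent.le_total {X K : Type u} {out : X → K} {σ : List X → K ⊕ A → ℝ≥0∞}
    (h : Consistent out σ) (t : List X) (l : K ⊕ A) : σ t l ≤ ∑' l, σ [] l := by
  induction t using List.reverseRecOn generalizing l with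
  | nil => exact ENNReal.le_tsum l
  | append_singleton t x ih =>
    exact ((ENNReal.le_tsum l).trans (h t x).le).trans (ih _)

/-- There is no infinite play in the support. -/
inductive WFCore : Core S A → Prop
  | intro (σ : Core S A)
      (h : ∀ k i, σ [] (.inl k) ≠ 0 → WFCore fun t => σ (⟨k, i⟩ :: t)) : WFCore σ

theorem WFCore.mono {σ : Core S A} (h : WFCore σ) {τ : Core S A}
    (hτ : ∀ t l, τ t l ≠ 0 → σ t l ≠ 0) : WFCore τ := by
  induction h generalizing τ with
  | intro σ _ ih => exact .intro τ fun k i hk => ih k i (hτ _ _ hk) fun t l => hτ _ l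

theorem WFCore.of_bounded {m : ℕ} {σ : Core S A} (h : ∀ t l, m ≤ t.length → σ t l = 0) :
    WFCore σ := by
  induction m generalizing σ with
  | zero => exact .intro σ fun k i hk => absurd (h [] _ le_rfl) hk
  | succ m ih => exact .intro σ fun k i _ => ih fun t l ht => h _ l (Nat.succ_le_succ ht)

/-- Dependent choice: a residual that is not inductively well-founded has an output in the support
and an input after which the residual is again not well-founded. The successive moves form an
infinite play in the support. -/
theorem WFCore.of_passWF {σ : Core S A} (h : PassWF Sigma.fst σ) : WFCore σ := by
  by_contra hσ
  have step : ∀ τ : {τ : Core S A // ¬ WFCore τ}, ∃ x : Σ k : S.K, S.ar k,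
      τ.1 [] (.inl x.1) ≠ 0 ∧ ¬ WFCore fun t => τ.1 (x :: t) := by
    intro τ
    by_contra hc
    push Not at hc
    exact τ.2 (.intro _ fun k i hk => hc ⟨k, i⟩ hk)
  choose x hx hx' using step
  let s : ℕ → {τ : Core S A // ¬ WFCore τ} := fun n =>
    Nat.rec ⟨σ, hσ⟩ (fun _ τ => ⟨fun t => τ.1 (x τ :: t), hx' τ⟩) n
  have hs : ∀ n t, (s n).1 t = σ ((List.ofFn fun r : Fin n => x (s r)) ++ t) := by
    intro n
    induction n with
    | zero => exact fun t => rfl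
    | succ n ih =>
      intro t
      rw [ofFn_succ_concat fun r => x (s r), List.append_assoc]
      exact ih _
  refine h ⟨fun n => x (s n), fun n => ?_⟩
  have := hx (s n)
  rw [hs, List.append_nil] at this
  exact this

end Cores

theorem tsum_map_mul {A : Type*} {B : Type*} (d : PMF A) (f : A → B) (g : B → ℝ≥0∞) :
    ∑' b, d.map f b * g b = ∑' a, d a * g (f a) := by
  classical
  simp_rw [PMF.map_apply, ← ENNReal.tsum_mul_right]
  rw [ENNReal.tsum_comm]
  refine tsum_congr fun a => ?_
  rw [tsum_eq_single (f a) fun b hb => by rw [if_neg hb, zero_mul], if_pos rfl]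

/-! ### Algebras for the tensorial extension -/

/-- An algebra in which the operations of `S` commute with mixtures, with a compatible
interpretation by values of strategies. -/
structure TensorAlg (fin : Prop) (S : Sig.{u}) (A : Type u) extends MixAlg fin S A where
  mean_req : ∀ k (D : PMF (S.ar k → X)), Adm fin D →
    mean (D.map (req k)) = req k fun j => mean (D.map fun y => y j)
  core : X → Core S A
  core_pt : ∀ a, core (pt a) = distPass (PMF.pure a)
  core_req : ∀ k x, core (req k x) = outPass k fun i => core (x i)
  core_mean : ∀ d t l, Adm fin d → core (mean d) t l = ∑' x, d x * core x t l

namespace TensorAlg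

variable {fin : Prop} {S : Sig.{u}} {A : Type u} (M : TensorAlg fin S A)

theorem core_mean_map {B : Type*} {d : PMF B} (hd : Adm fin d) (f : B → M.X) (t : Play S)
    (l : S.K ⊕ A) : M.core (M.mean (d.map f)) t l = ∑' b, d b * M.core (f b) t l :=
  (M.core_mean _ t l (hd.map f)).trans (tsum_map_mul d f fun x => M.core x t l)

/-- An output followed by an element of a given family, or a constant. -/
def head (y : ∀ k, S.ar k → M.X) : S.K ⊕ A → M.X := Sum.elim (fun k => M.req k (y k)) M.pt

/-- Commutation merges branches that begin with the same output: a mixture of terms `req k (y ·)` is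
`req k` of the mixtures of the continuations. One continuation per output and input therefore
suffices, and this property survives mixing. -/
theorem exists_nf (x : M.X) : ∃ (d : PMF (S.K ⊕ A)) (y : ∀ k, S.ar k → M.X),
    Adm fin d ∧ x = M.mean (d.map (M.head y)) := by
  refine M.ind (fun x => ∃ (d : PMF (S.K ⊕ A)) (y : ∀ k, S.ar k → M.X),
    Adm fin d ∧ x = M.mean (d.map (M.head y))) (fun a => ?_) (fun k x _ => ?_)
    (fun d₀ hd₀ ih => ?_) x
  · refine ⟨PMF.pure (.inr a), fun _ _ => M.pt a, adm_pure _, ?_⟩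
    rw [PMF.pure_map, M.mean_pure]
    rfl
  · classical
    -- Only the continuations of `k` matter, since all weight is on `k`; for other outputs any
    -- element will do.
    refine ⟨PMF.pure (.inl k), fun k' i => if h : k' = k then x (h ▸ i) else M.req k x,
      adm_pure _, ?_⟩
    rw [PMF.pure_map, M.mean_pure]
    simp [head]
  · have : ∀ x, ∃ (d : PMF (S.K ⊕ A)) (y : ∀ k, S.ar k → M.X), x ∈ d₀.support →
        Adm fin d ∧ x = M.mean (d.map (M.head y)) := by
      intro x
      by_cases hx : x ∈ d₀.support
      · obtain ⟨d, y, h⟩ := ih x hx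
        exact ⟨d, y, fun _ => h⟩
      · obtain ⟨x', hx'⟩ := d₀.support_nonempty
        obtain ⟨d, y, h⟩ := ih x' hx'
        exact ⟨d, y, fun h => absurd h hx⟩
    choose d y h using this
    -- The joint law of a component of the mixture and its first move. Conditioning on the second
    -- coordinate groups the components by first move.
    let D : PMF (M.X × (S.K ⊕ A)) := d₀.bind fun x => (d x).map (Prod.mk x)
    let H : M.X × (S.K ⊕ A) → M.X := fun p => M.head (y p.1) p.2
    have hD : Adm fin D := hd₀.bind fun x hx => (h x hx).1.map _
    have h1 : M.mean d₀ = M.mean (D.map H) := by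
      rw [M.mean_map_bind H hd₀ fun x hx => (h x hx).1.map _]
      refine congrArg _ ((PMF.map_id d₀).symm.trans (pmf_map_congr fun x hx => ?_))
      rw [PMF.map_comp]
      exact (h x hx).2
    refine ⟨D.map Prod.snd, fun k j =>
      M.mean ((fibre D Prod.snd (.inl k)).map fun p => y p.1 k j), hD.map _, ?_⟩
    rw [h1]
    conv_lhs => rw [← map_bind_fibre D Prod.snd]
    rw [M.mean_map_bind H (hD.map _) fun l _ => hD.fibre Prod.snd l]
    refine congrArg _ (pmf_map_congr fun l hl => ?_)
    rcases l with k | a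
    · have e : (fibre D Prod.snd (.inl k)).map H =
          ((fibre D Prod.snd (.inl k)).map fun p => y p.1 k).map (M.req k) := by
        rw [PMF.map_comp]
        refine pmf_map_congr fun p hp => ?_
        have hp2 : p.2 = .inl k := eq_of_mem_fibre hl hp
        simp only [H, hp2]
        rfl
      rw [e, M.mean_req k _ ((hD.fibre _ _).map _)]
      simp only [PMF.map_comp]
      rfl
    · have e : (fibre D Prod.snd (.inr a)).map H =
          (fibre D Prod.snd (.inr a)).map (Function.const _ (M.pt a)) := by
        refine pmf_map_congr fun p hp => ?_
        have hp2 : p.2 = .inr a := eq_of_mem_fibre hl hp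
        simp only [H, hp2]
        rfl
      rw [e, PMF.map_const, M.mean_pure]
      rfl

theorem core_head_nil (y : ∀ k, S.ar k → M.X) (l l' : S.K ⊕ A) :
    M.core (M.head y l) [] l' = PMF.pure l l' := by
  classical
  rcases l with k | a
  · refine (congrFun (congrFun (M.core_req k _) _) _).trans ?_
    by_cases h : l' = .inl k
    · rw [h, outPass_inl_self, PMF.pure_apply_self]
    · rw [outPass_nil_ne h, PMF.pure_apply_of_ne _ _ h]
  · refine (congrFun (congrFun (M.core_pt a) _) _).trans ?_
    rcases l' with k | b
    · exact (PMF.pure_apply_of_ne _ _ (by simp)).symm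
    · simp [distPass, PMF.pure_apply]

theorem core_head_inl (y : ∀ k, S.ar k → M.X) (k : S.K) (i : S.ar k) (s : Play S)
    (l : S.K ⊕ A) : M.core (M.head y (.inl k)) (⟨k, i⟩ :: s) l = M.core (y k i) s l :=
  (congrFun (congrFun (M.core_req k _) _) _).trans (outPass_cons_self _ _ _ _ _)

theorem core_head_ne (y : ∀ k, S.ar k → M.X) {k : S.K} (i : S.ar k) (s : Play S)
    (l l' : S.K ⊕ A) (h : l' ≠ .inl k) : M.core (M.head y l') (⟨k, i⟩ :: s) l = 0 := by
  rcases l' with k' | a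
  · exact (congrFun (congrFun (M.core_req k' _) _) _).trans
      (outPass_cons_ne (fun h' => h (congrArg _ h'.symm)) _ _ _ _)
  · exact (congrFun (congrFun (M.core_pt a) _) _).trans (distPass_cons _ _ _ _)

theorem core_nf_nil {d : PMF (S.K ⊕ A)} (hd : Adm fin d) (y : ∀ k, S.ar k → M.X) (l : S.K ⊕ A) :
    M.core (M.mean (d.map (M.head y))) [] l = d l := by
  rw [M.core_mean_map hd]
  simp only [core_head_nil]
  exact DFunLike.congr_fun (PMF.bind_pure d) l

/-- Only the head `k` contributes to plays that start with `k`, and it has a single continuation at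
`i`, so the value factors. Dividing by the weight recovers the values of the continuation. -/
theorem core_nf_cons {d : PMF (S.K ⊕ A)} (hd : Adm fin d) (y : ∀ k, S.ar k → M.X) (k : S.K)
    (i : S.ar k) (s : Play S) (l : S.K ⊕ A) :
    M.core (M.mean (d.map (M.head y))) (⟨k, i⟩ :: s) l = d (.inl k) * M.core (y k i) s l := by
  rw [M.core_mean_map hd, tsum_eq_single (.inl k), core_head_inl]
  intro l' hl'
  rw [core_head_ne M y i s l l' hl', mul_zero]

/-- Induction on `σ`, which serves only as a bound on the support: a residual of `M.core x` is the
values of a continuation times a weight, and a support bound ignores that factor. Equal values give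
equal weights on first moves. For moves of positive weight, cancelling it gives equal values of the
continuations; the other moves do not affect the mixture. -/
theorem eq_of_core_eq_of_le {σ : Core S A} (hσ : WFCore σ) {x y : M.X}
    (hx : ∀ t l, M.core x t l ≠ 0 → σ t l ≠ 0) (h : M.core x = M.core y) : x = y := by
  induction hσ generalizing x y with
  | intro σ _ ih =>
    obtain ⟨d, u, hd, rfl⟩ := M.exists_nf x
    obtain ⟨d', v, hd', rfl⟩ := M.exists_nf y
    have e : d = d' := by
      ext l
      rw [← M.core_nf_nil hd u l, ← M.core_nf_nil hd' v l, h]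
    subst e
    refine congrArg _ (pmf_map_congr fun l hl => ?_)
    rcases l with k | a
    · refine congrArg (M.req k) (funext fun i => ?_)
      have hk : d (.inl k) ≠ 0 := hl
      have hk' : σ [] (.inl k) ≠ 0 := hx _ _ (by rwa [core_nf_nil M hd])
      refine ih k i hk' (fun t l ht => hx _ _ ?_) ?_
      · rw [core_nf_cons M hd]
        exact mul_ne_zero hk ht
      · funext s l
        have := congrFun (congrFun h (⟨k, i⟩ :: s)) l
        rw [core_nf_cons M hd, core_nf_cons M hd] at this
        exact (ENNReal.mul_right_inj hk (PMF.apply_ne_top _ _)).1 this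
    · rfl

/-- Elements are determined by their values, if these are well-founded. -/
theorem eq_of_core_eq {x y : M.X} (hx : WFCore (M.core x)) (h : M.core x = M.core y) : x = y :=
  M.eq_of_core_eq_of_le hx (fun _ _ => id) h

theorem core_consistent (x : M.X) :
    Consistent Sigma.fst (M.core x) ∧ ∑' l, M.core x [] l = 1 := by
  refine M.ind (fun x => Consistent Sigma.fst (M.core x) ∧ ∑' l, M.core x [] l = 1)
    (fun a => ?_) (fun k x ih => ?_) (fun d hd ih => ?_) x
  · rw [core_pt]
    exact ⟨distPass_consistent _ _, distPass_weight _⟩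
  · rw [core_req]
    exact ⟨outPass_consistent k (fun i => (ih i).1) fun i => (ih i).2, tsum_outPass _ _⟩
  · refine ⟨fun t x => ?_, ?_⟩
    · simp only [M.core_mean _ _ _ hd]
      rw [ENNReal.tsum_comm]
      refine tsum_congr fun y => ?_
      rw [ENNReal.tsum_mul_left]
      by_cases hy : d y = 0
      · rw [hy, zero_mul, zero_mul]
      · rw [(ih y hy).1 t x]
    · simp only [M.core_mean _ _ _ hd]
      rw [ENNReal.tsum_comm, ← d.tsum_coe]
      refine tsum_congr fun y => ?_
      rw [ENNReal.tsum_mul_left]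
      by_cases hy : d y = 0
      · rw [hy, zero_mul]
      · rw [(ih y hy).2, mul_one]

/-- Well-founded values (finitely branching, if `fin` holds) are the values of an element, up to
the total weight. -/
theorem exists_core_eq {σ : Core S A} (hwf : WFCore σ) (hσ : Consistent Sigma.fst σ)
    (hfb : fin → PassFB σ) (h0 : ∑' l, σ [] l ≠ 0) (htop : ∑' l, σ [] l ≠ ∞) :
    ∃ x, ∀ t l, σ t l = (∑' l, σ [] l) * M.core x t l := by
  induction hwf with
  | intro σ _ ih =>
    have hlt : ∀ l, σ [] l ≠ ∞ := fun l => ne_top_of_le_ne_top htop (ENNReal.le_tsum l)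
    have htot : ∀ k i, ∑' l, σ [⟨k, i⟩] l = σ [] (.inl k) := fun k i => hσ [] ⟨k, i⟩
    -- By consistency the residual after `k` and `i` has total weight `σ [] (.inl k)` for every `i`,
    -- so the factor split off by the inductive hypothesis does not depend on the input.
    have ih' : ∀ k i, σ [] (.inl k) ≠ 0 → ∃ x, ∀ t l,
        σ (⟨k, i⟩ :: t) l = σ [] (.inl k) * M.core x t l := by
      intro k i hk
      obtain ⟨x, hx⟩ := ih k i hk (hσ.after _) (fun h t => hfb h _) (by rwa [htot])
        (by rw [htot]; exact hlt _)
      exact ⟨x, fun t l => (hx t l).trans (congrArg (· * M.core x t l) (htot k i))⟩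
    choose y hy using ih'
    obtain ⟨x₀⟩ : Nonempty M.X := by
      obtain ⟨l, hl⟩ : ∃ l, σ [] l ≠ 0 := by
        by_contra hc
        push Not at hc
        exact h0 (ENNReal.tsum_eq_zero.2 hc)
      rcases l with k | a
      · exact ⟨M.req k fun i => y k i hl⟩
      · exact ⟨M.pt a⟩
    classical
    -- Outputs of weight zero receive the default continuation `x₀`.
    let z : ∀ k, S.ar k → M.X := fun k i => if hk : σ [] (.inl k) ≠ 0 then y k i hk else x₀
    let d : PMF (S.K ⊕ A) := PMF.normalize (σ []) h0 htop
    have hd : Adm fin d := fun h => by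
      rw [PMF.support_normalize]
      exact hfb h []
    have hmul : ∀ l, (∑' l, σ [] l) * d l = σ [] l := fun l => by
      rw [PMF.normalize_apply, mul_left_comm, ENNReal.mul_inv_cancel h0 htop, mul_one]
    refine ⟨M.mean (d.map (M.head z)), fun t l => ?_⟩
    rcases t with _ | ⟨⟨k, i⟩, t⟩
    · rw [core_nf_nil M hd, hmul]
    · rw [core_nf_cons M hd, ← mul_assoc, hmul]
      by_cases hk : σ [] (.inl k) = 0
      · rw [hk, zero_mul]
        have := (hσ.after ⟨k, i⟩).le_total t l
        rwa [htot, hk, nonpos_iff_eq_zero] at this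
      · rw [hy k i hk]
        simp only [z, dif_pos hk]

end TensorAlg

/-! ### The tensorial extension -/

section Tensor

variable {C : Choice.{u}} {E : ∀ B : Type u, Term C.toSig B → Term C.toSig B → Prop} {fin : Prop}
  {S : Sig.{u}} {A B : Type u}

/-- The values of the strategy denoted by a term. -/
noncomputable def Term.core : Term (C.toSig.sum S) A → Core S A
  | .var a => distPass (PMF.pure a)
  | .op (.inl c) x => fun t l => ∑' i, C.weight c i * (x i).core t l
  | .op (.inr k) x => outPass k fun i => (x i).core

theorem Term.core_inl_subst (t : Term C.toSig B) (f : B → Term (C.toSig.sum S) A) (s : Play S)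
    (l : S.K ⊕ A) : (t.inl.subst f).core s l = ∑' b, t.dist b * (f b).core s l := by
  induction t with
  | var b =>
    simp only [inl, subst, dist]
    rw [tsum_eq_single b fun b' hb => by rw [PMF.pure_apply_of_ne _ _ hb, zero_mul],
      PMF.pure_apply_self, one_mul]
  | op c x ih =>
    simp only [inl, subst, dist, core, PMF.bind_apply, ih, ← ENNReal.tsum_mul_right,
      ← ENNReal.tsum_mul_left, mul_assoc]
    exact ENNReal.tsum_comm

theorem Term.core_comm (c : C.K) (k : S.K)
    (x : C.ar c → S.ar k → Term (C.toSig.sum S) A) :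
    (Term.op (S := C.toSig.sum S) (.inl c) fun i => .op (.inr k) (x i)).core =
      (Term.op (S := C.toSig.sum S) (.inr k) fun j => .op (.inl c) fun i => x i j).core := by
  funext t l
  simp only [core]
  rcases t with _ | ⟨⟨k', j⟩, t⟩
  · by_cases h : l = .inl k
    · subst h
      simp only [outPass_inl_self, mul_one, PMF.tsum_coe]
    · simp only [outPass_nil_ne h, mul_zero, tsum_zero]
  · by_cases h : k' = k
    · subst h
      simp only [outPass_cons_self]
    · simp only [outPass_cons_ne h, mul_zero, tsum_zero]

theorem Term.core_eq_of_rel (h : IsDistTheory C E fin)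
    {s t : Term (Theory.tensorExt ⟨C.toSig, E⟩ S).sig A}
    (hst : Theory.Rel (Theory.tensorExt ⟨C.toSig, E⟩ S) s t) :
    Term.core (C := C) s = Term.core (C := C) t := by
  induction hst with
  | refl t => rfl
  | symm _ ih => exact ih.symm
  | trans _ _ ih₁ ih₂ => exact ih₁.trans ih₂
  | congr k _ ih =>
    rcases k with c | k
    · exact congrArg (fun (f : C.ar c → Core S A) t l => ∑' i, C.weight c i * f i t l) (funext ih)
    · exact congrArg (outPass k) (funext ih)
  | inst h' f =>
    cases h' with
    | base h' =>
      funext a l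
      refine (Term.core_inl_subst (C := C) _ f a l).trans (.trans ?_
        (Term.core_inl_subst (C := C) _ f a l).symm)
      rw [h.sound _ _ _ h']
    | comm c k => exact Term.core_comm c k fun i j => f (i, j)

/-- The equation `comm` treats a single choice operation. Mixtures are represented by composite
choice terms, to which it extends by induction. -/
theorem ecls_comm (t : Term C.toSig B) (k : S.K) (y : B → S.ar k → Term (C.toSig.sum S) A) :
    ecls (Theory.TensorExtEqn ⟨C.toSig, E⟩ S) (t.inl.subst fun b => .op (.inr k) (y b)) =
      ecls (Theory.TensorExtEqn ⟨C.toSig, E⟩ S)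
        (.op (.inr k) fun j => t.inl.subst fun b => y b j) := by
  induction t with
  | var b => rfl
  | op c x ih =>
    refine (ecls_op_congr (Sum.inl c) ih).trans (ecls_eq_iff.2 ?_)
    exact Theory.Rel.inst (θ := Theory.tensorExt ⟨C.toSig, E⟩ S) (.comm c k)
      fun p => (x p.1).inl.subst fun b => y b p.2

/-- One choice term representing the joint distribution `D` serves all inputs `j` at once;
`ecls_comm` moves it past `k`, and at each `j` it represents the corresponding marginal. -/
theorem emean_ereq (h : IsDistTheory C E fin) (k : S.K)
    (D : PMF (S.ar k → ExtCls C S (Theory.TensorExtEqn ⟨C.toSig, E⟩ S) A)) (hD : Adm fin D) :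
    emean (D.map (ereq k)) = ereq k fun j => emean (D.map fun y => y j) := by
  have hG : ∀ (B : Type u) (s t : Term C.toSig B), E B s t →
    Theory.TensorExtEqn ⟨C.toSig, E⟩ S B s.inl t.inl := fun _ _ _ h => .base h
  have h1 := ecls_comm (E := E) (distTerm C D) k fun y j => erep (y j)
  rw [ecls_inl_subst h hG, h.dist_distTerm hD] at h1
  refine h1.trans ((ecls_op_inr k _).trans (congrArg (ereq k) (funext fun j => ?_)))
  rw [ecls_inl_subst h hG, h.dist_distTerm hD]
  simp only [ecls_erep]

/-- The values of the strategy denoted by a class of terms. -/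
noncomputable def ecore (h : IsDistTheory C E fin) :
    ExtCls C S (Theory.TensorExtEqn ⟨C.toSig, E⟩ S) A → Core S A :=
  Quotient.lift (s := (Theory.termCongr (Theory.tensorExt ⟨C.toSig, E⟩ S)).r A)
    (Term.core (C := C)) fun _ _ hst => Term.core_eq_of_rel h hst

theorem core_erep (h : IsDistTheory C E fin)
    (x : ExtCls C S (Theory.TensorExtEqn ⟨C.toSig, E⟩ S) A) : Term.core (erep x) = ecore h x :=
  congrArg (ecore h) (ecls_erep x)

/-- The algebra of classes of terms of the tensorial extension. -/
noncomputable def tensorAlg (h : IsDistTheory C E fin) (S : Sig.{u}) (A : Type u) :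
    TensorAlg fin S A where
  toMixAlg := extAlg (G := Theory.TensorExtEqn ⟨C.toSig, E⟩ S) h (fun _ _ _ h => .base h) A
  mean_req := emean_ereq h
  core := ecore h
  core_pt a := rfl
  core_req k x := congrArg (outPass k) (funext fun i => core_erep h (x i))
  core_mean d t l hd := by
    refine (Term.core_inl_subst (C := C) (distTerm C d) erep t l).trans ?_
    rw [h.dist_distTerm hd]
    exact tsum_congr fun x => congrArg (d x * ·) (congrFun (congrFun (core_erep h x) t) l)

/-- A criterion for the tensorial extension to present a monad of strategies. -/
theorem presents_strategies (h : IsDistTheory C E fin) {N : Type u → Type u} [Monad N]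
    [LawfulMonad N] {g : ∀ k : (C.toSig.sum S).K, N ((C.toSig.sum S).ar k)}
    (core : ∀ A, N A → Core S A)
    (core_injective : ∀ A, Function.Injective (core A))
    (core_pure : ∀ {A : Type u} (a : A), core A (pure a) = distPass (PMF.pure a))
    (core_choice : ∀ {A : Type u} (c : C.K) (f : C.ar c → N A),
      core A (g (.inl c) >>= f) = fun t l => ∑' i, C.weight c i * core A (f i) t l)
    (core_req : ∀ {A : Type u} (k : S.K) (f : S.ar k → N A),
      core A (g (.inr k) >>= f) = outPass k fun i => core A (f i))
    (inj : ∀ {A : Type u} (x y : (tensorAlg h S A).X),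
      (tensorAlg h S A).core x = (tensorAlg h S A).core y →
      (∃ m, core A m = (tensorAlg h S A).core x) → x = y)
    (surj : ∀ {A : Type u} (m : N A), ∃ x, (tensorAlg h S A).core x = core A m) :
    (Theory.tensorExt ⟨C.toSig, E⟩ S).Presents N g := by
  have key : ∀ (A : Type u) (t : Term (C.toSig.sum S) A),
      core A (Theory.eval (θ := Theory.tensorExt ⟨C.toSig, E⟩ S) g t) = t.core := by
    intro A t
    induction t with
    | var a => exact core_pure a
    | op k x ih =>
      rcases k with c | k
      · refine (core_choice c _).trans ?_
        exact congrArg (fun (f : C.ar c → Core S A) t l => ∑' i, C.weight c i * f i t l)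
          (funext ih)
      · exact (core_req k _).trans (congrArg (outPass k) (funext ih))
  refine Theory.presents_of (fun B s t hst => ?_) (fun A s t hst => ?_) fun A m => ?_
  · refine core_injective _ ((key B s).trans (.trans ?_ (key B t).symm))
    exact Term.core_eq_of_rel h (.of_eqn hst)
  · refine ecls_eq_iff.1 (inj (ecls _ s) (ecls _ t) ?_ ⟨_, key A s⟩)
    exact (key A s).symm.trans ((congrArg (core A) hst).trans (key A t))
  · obtain ⟨x, hx⟩ := surj m
    refine ⟨erep x, core_injective _ ((key A _).trans (.trans ?_ hx))⟩
    exact core_erep h x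

end Tensor

/-! ### Finitely founded strategies -/

section FinFound

variable {S : Sig.{u}} {A B : Type u}

theorem Strategy.core_dist_subst (d : PMF A) (f : A → Strategy (S.addConst B)) :
    ((dist d).subst f).core = fun t l => ∑' a, d a * (f a).core t l := by
  funext t l
  rw [core_subst, core_dist, bindPass_distPass]

theorem Strategy.core_req_subst (k : S.K) (f : S.ar k → Strategy (S.addConst B)) :
    ((req k).subst f).core = outPass k fun i => (f i).core := by
  funext t l
  rw [core_subst, core_req, bindPass_reqPass]

theorem presents_finFound (S : Sig.{u}) :
    (Theory.tensorExt convexTheory S).Presents (FinFound S) (FinFound.gen S) := by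
  refine presents_strategies ConvexEqn.isDistTheory (fun A σ => σ.1.core)
    (fun A σ τ h => ?_)
    (fun a => ?_) (fun c f => ?_) (fun k f => ?_) (fun x y h ⟨m, hm⟩ => ?_) fun m => ?_
  · exact Subtype.ext (Strategy.ext_core fun t l => congrFun (congrFun h t) l)
  · exact Strategy.core_dist _
  · exact Strategy.core_dist_subst _ _
  · exact Strategy.core_req_subst _ _
  · refine TensorAlg.eq_of_core_eq _ ?_ h
    rw [← hm]
    exact .of_passWF ((wf_iff_core _).1 m.2.1)
  · obtain ⟨x, hx⟩ := TensorAlg.exists_core_eq (tensorAlg ConvexEqn.isDistTheory S _)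
      (.of_passWF ((wf_iff_core _).1 m.2.1)) m.1.core_consistent
      (fun _ => (fb_iff_core _).1 m.2.2) (by rw [m.1.core_weight]; exact one_ne_zero)
      (by rw [m.1.core_weight]; exact ENNReal.one_ne_top)
    refine ⟨x, funext fun t => funext fun l => ?_⟩
    rw [hx, m.1.core_weight, one_mul]

end FinFound

/-! ### Victorious strategies -/

section Vict

variable {S : Sig.{u}} {A : Type u}

theorem tsum_tsub {ι : Type*} {f g : ι → ℝ≥0∞} (hg : ∑' i, g i ≠ ∞) (hle : ∀ i, g i ≤ f i) :
    ∑' i, (f i - g i) = ∑' i, f i - ∑' i, g i := by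
  refine ENNReal.eq_sub_of_add_eq hg ?_
  rw [← ENNReal.tsum_add]
  exact tsum_congr fun i => tsub_add_cancel_of_le (hle i)

theorem adm_false {B : Type*} (d : PMF B) : Adm False d := False.elim

/-- The supremum over counterstrategies of the probability that play lasts for at least `m`
cycles. -/
noncomputable def contSup : ℕ → Core S A → ℝ≥0∞
  | 0, σ => ∑' l, σ [] l
  | m + 1, σ => ∑' k, ⨆ i, contSup m fun t => σ (⟨k, i⟩ :: t)

theorem contSup_antitone {σ : Core S A} (hσ : Consistent Sigma.fst σ) :
    Antitone fun m => contSup m σ := by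
  refine antitone_nat_of_succ_le fun m => ?_
  induction m generalizing σ with
  | zero =>
    simp only [contSup]
    rw [tsum_sum_type]
    refine (ENNReal.tsum_le_tsum fun k => iSup_le fun i => ?_).trans le_self_add
    exact (hσ [] ⟨k, i⟩).le
  | succ m ih =>
    exact ENNReal.tsum_le_tsum fun k => iSup_mono fun i => ih (hσ.after ⟨k, i⟩)

/-- The values on nonempty plays are given by a family. -/
noncomputable def consCore (v : S.K ⊕ A → ℝ≥0∞) (f : ∀ k, S.ar k → Core S A) : Core S A
  | [], l => v l
  | ⟨k, i⟩ :: s, l => f k i s l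

/-- Discarding the mass that some opponent can keep alive for `m` cycles leaves a play-measure of
bounded length, at a cost of at most `contSup m σ`. -/
theorem exists_bounded_le (m : ℕ) {σ : Core S A} (hσ : Consistent Sigma.fst σ)
    (htop : ∑' l, σ [] l ≠ ∞) : ∃ α : Core S A, Consistent Sigma.fst α ∧
      (∀ t l, α t l ≤ σ t l) ∧ (∀ t l, m ≤ t.length → α t l = 0) ∧
      ∑' l, σ [] l ≤ ∑' l, α [] l + contSup m σ := by
  induction m generalizing σ with
  | zero =>
    exact ⟨fun _ _ => 0, fun _ _ => tsum_zero, fun _ _ => zero_le, fun _ _ _ => rfl,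
      le_add_self⟩
  | succ m ih =>
    have htot : ∀ k i, ∑' l, σ [⟨k, i⟩] l = σ [] (.inl k) := fun k i => hσ [] ⟨k, i⟩
    have hlt : ∀ l, σ [] l ≠ ∞ := fun l => ne_top_of_le_ne_top htop (ENNReal.le_tsum l)
    have ih' : ∀ k i, ∃ α : Core S A, Consistent Sigma.fst α ∧
        (∀ t l, α t l ≤ σ (⟨k, i⟩ :: t) l) ∧ (∀ t l, m ≤ t.length → α t l = 0) ∧
        ∑' l, σ [⟨k, i⟩] l ≤ ∑' l, α [] l + contSup m fun t => σ (⟨k, i⟩ :: t) := by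
      intro k i
      exact ih (hσ.after ⟨k, i⟩) (by rw [htot]; exact hlt _)
    choose α hα hle hbd htα using ih'
    -- Consistency requires the same mass after `k` for every input, whereas the trimmed residuals
    -- `α k i` may have different masses. Each has at least the mass `e k` guaranteed against the
    -- worst input, and the factor `c k i ≤ 1` scales it down to exactly `e k`.
    let e : S.K → ℝ≥0∞ := fun k =>
      σ [] (.inl k) - ⨆ i, contSup m fun t => σ (⟨k, i⟩ :: t)
    let c : ∀ k, S.ar k → ℝ≥0∞ := fun k i => e k / ∑' l, α k i [] l
    have he : ∀ k i, e k ≤ ∑' l, α k i [] l := by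
      intro k i
      refine tsub_le_iff_right.2 ?_
      rw [← htot k i]
      refine (htα k i).trans ?_
      gcongr
      exact le_iSup (fun i => contSup m fun t => σ (⟨k, i⟩ :: t)) i
    have hαtop : ∀ k i, ∑' l, α k i [] l ≠ ∞ := fun k i =>
      ne_top_of_le_ne_top (hlt (.inl k)) ((ENNReal.tsum_le_tsum (hle k i [])).trans (htot k i).le)
    have hc1 : ∀ k i, c k i ≤ 1 := fun k i => ENNReal.div_le_of_le_mul (by
      rw [one_mul]
      exact he k i)
    have hce : ∀ k i, c k i * ∑' l, α k i [] l = e k := by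
      intro k i
      by_cases h0 : ∑' l, α k i [] l = 0
      · rw [h0, mul_zero]
        exact (nonpos_iff_eq_zero.1 (h0 ▸ he k i)).symm
      · exact ENNReal.div_mul_cancel h0 (hαtop k i)
    refine ⟨consCore (Sum.elim e fun a => σ [] (.inr a)) fun k i t l => c k i * α k i t l,
      ?_, ?_, ?_, ?_⟩
    · rintro (_ | ⟨⟨k, i⟩, t⟩) ⟨k', i'⟩
      · simp only [List.nil_append, consCore]
        rw [ENNReal.tsum_mul_left, hce]
        rfl
      · simp only [List.cons_append, consCore]
        rw [ENNReal.tsum_mul_left, hα k i]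
    · rintro (_ | ⟨⟨k, i⟩, t⟩) l
      · rcases l with k | a
        · exact tsub_le_self
        · exact le_rfl
      · exact (mul_le_of_le_one_left' (hc1 k i)).trans (hle k i t l)
    · rintro (_ | ⟨⟨k, i⟩, t⟩) l ht
      · simp at ht
      · simp only [consCore]
        rw [hbd k i t l (Nat.le_of_succ_le_succ ht), mul_zero]
    · simp only [consCore, contSup]
      rw [tsum_sum_type, tsum_sum_type]
      simp only [Sum.elim_inl, Sum.elim_inr]
      rw [add_right_comm, ← ENNReal.tsum_add]
      gcongr
      exact le_tsub_add

/-- Finite arity enters here: an infimum along `m` passes through a supremum over finitely many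
inputs of antitone sequences. It passes through the sum over outputs because the total mass is
finite. -/
theorem iInf_contSup_le (hS : S.Finitary) {σ : Core S A} (hσ : Consistent Sigma.fst σ)
    (htop : ∑' l, σ [] l ≠ ∞) : ⨅ m, contSup m σ ≤
      ∑' k, ⨆ i, ⨅ m, contSup m fun t => σ (⟨k, i⟩ :: t) := by
  have hanti : ∀ k i, Antitone fun m => contSup m fun t => σ (⟨k, i⟩ :: t) :=
    fun k i => contSup_antitone (hσ.after ⟨k, i⟩)
  calc ⨅ m, contSup m σ ≤ ⨅ m, contSup (m + 1) σ := le_iInf fun m => iInf_le _ (m + 1)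
    _ = ∑' k, ⨅ m, ⨆ i, contSup m fun t => σ (⟨k, i⟩ :: t) := by
      refine tsum_iInf (g := fun m k => ⨆ i, contSup m fun t => σ (⟨k, i⟩ :: t))
        (fun m n h k => iSup_mono fun i => hanti k i h) ?_
      exact ne_top_of_le_ne_top htop (contSup_antitone hσ (Nat.zero_le 1))
    _ ≤ _ := by
      refine ENNReal.tsum_le_tsum fun k => ?_
      have := hS k
      exact (iInf_iSup_of_antitone (hanti k)).le

/-- The plays in which all inputs are chosen according to `b`. -/
def Follows (b : Core S A → ∀ k, Set (S.ar k)) : Core S A → Play S → Prop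
  | _, [] => True
  | σ, x :: s => x.2 ∈ b σ x.1 ∧ Follows b (fun t => σ (x :: t)) s

theorem follows_isCounter {b : Core S A → ∀ k, Set (S.ar k)}
    (hb : ∀ σ k, (b σ k).Subsingleton) (σ : Core S A) :
    IsCounter Sigma.fst {t | Follows b σ t} := by
  constructor
  · intro t x
    induction t generalizing σ with
    | nil => exact fun _ => trivial
    | cons y t ih => exact fun h => ⟨h.1, ih _ h.2⟩
  · rintro t ⟨k, i⟩ ⟨k', j⟩ hx hy rfl
    induction t generalizing σ with
    | nil =>
      have : i = j := hb σ k hx.1 hy.1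
      rw [this]
    | cons y t ih => exact ih _ hx.2 hy.2

/-- The opponent always answers with an input that maximizes the limiting survival value of the
residual, attained since arities are finite. The limit of `contSup` is then at most the survival
probability against this one counterstrategy at every stage, and victory makes the infimum of the
latter `0`. -/
theorem iInf_contSup_eq_zero (hS : S.Finitary) {σ : Core S A} (hσ : Consistent Sigma.fst σ)
    (htop : ∑' l, σ [] l ≠ ∞) (hv : PassVict Sigma.fst σ) : ⨅ m, contSup m σ = 0 := by
  classical
  -- The prescribed answer, as a set with at most one input; it is empty when `k` admits no input.
  have hb : ∀ (σ : Core S A) k, ∃ s : Set (S.ar k), s.Subsingleton ∧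
      ⨆ i, ⨅ m, contSup m (fun t => σ (⟨k, i⟩ :: t)) ≤
        ∑' i, if i ∈ s then ⨅ m, contSup m fun t => σ (⟨k, i⟩ :: t) else 0 := by
    intro σ k
    have := hS k
    rcases isEmpty_or_nonempty (S.ar k) with h | h
    · exact ⟨∅, Set.subsingleton_empty, iSup_le fun i => h.elim i⟩
    · obtain ⟨i, hi⟩ := exists_eq_ciSup_of_finite
        (f := fun i => ⨅ m, contSup m fun t => σ (⟨k, i⟩ :: t))
      refine ⟨{i}, Set.subsingleton_singleton, ?_⟩
      rw [← hi]
      refine le_trans ?_ (ENNReal.le_tsum i)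
      rw [if_pos (Set.mem_singleton i)]
  choose b hbs hb using hb
  have key : ∀ m (σ : Core S A), Consistent Sigma.fst σ → ∑' l, σ [] l ≠ ∞ →
      ⨅ m, contSup m σ ≤ passCont {t | Follows b σ t} σ m := by
    intro m
    induction m with
    | zero =>
      intro σ _ _
      rw [passCont_zero, if_pos (show [] ∈ {t | Follows b σ t} from trivial)]
      exact iInf_le _ 0
    | succ m ih =>
      intro σ hσ htop
      refine (iInf_contSup_le hS hσ htop).trans ((ENNReal.tsum_le_tsum fun k => hb σ k).trans ?_)
      rw [passCont_succ, ENNReal.tsum_sigma']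
      refine ENNReal.tsum_le_tsum fun k => ENNReal.tsum_le_tsum fun i => ?_
      split_ifs with h
      · refine (ih _ (hσ.after ⟨k, i⟩) ?_).trans (le_of_eq ?_)
        · have := hσ.total_after ⟨k, i⟩
          rw [this]
          exact ne_top_of_le_ne_top htop (ENNReal.le_tsum _)
        · congr 1
          ext t
          exact ⟨fun ht => ⟨h, ht⟩, fun ht => ht.2⟩
      · exact zero_le
  exact le_antisymm ((le_iInf fun m => key m σ hσ htop).trans
    (hv _ (follows_isCounter hbs σ)).le) zero_le

/-- As `contSup m σ` becomes arbitrarily small, some `m` makes the loss less than half of the total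
mass. A measure of total mass zero has no room for strict inequality and is treated apart. -/
theorem exists_half (hS : S.Finitary) {σ : Core S A} (hσ : Consistent Sigma.fst σ)
    (htop : ∑' l, σ [] l ≠ ∞) (hv : PassVict Sigma.fst σ) :
    ∃ α : Core S A, Consistent Sigma.fst α ∧ (∀ t l, α t l ≤ σ t l) ∧ WFCore α ∧
      ∑' l, σ [] l ≤ ∑' l, α [] l + 2⁻¹ * ∑' l, σ [] l := by
  by_cases h0 : ∑' l, σ [] l = 0
  · exact ⟨fun _ _ => 0, fun _ _ => tsum_zero, fun _ _ => zero_le,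
      .intro _ fun k i h => absurd rfl h, by rw [h0]; exact zero_le⟩
  · have hlt : ⨅ m, contSup m σ < 2⁻¹ * ∑' l, σ [] l := by
      rw [iInf_contSup_eq_zero hS hσ htop hv]
      exact ENNReal.mul_pos (by simp) h0
    obtain ⟨m, hm⟩ := iInf_lt_iff.1 hlt
    obtain ⟨α, hα, hle, hbd, htot⟩ := exists_bounded_le m hσ htop
    exact ⟨α, hα, hle, .of_bounded hbd, htot.trans (by gcongr)⟩

theorem Consistent.sub {σ α : Core S A} (hσ : Consistent Sigma.fst σ)
    (hα : Consistent Sigma.fst α) (hle : ∀ t l, α t l ≤ σ t l) (htop : ∑' l, α [] l ≠ ∞) :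
    Consistent (X := Σ k : S.K, S.ar k) Sigma.fst fun t l => σ t l - α t l := by
  intro t x
  have hα' : ∑' l, α (t ++ [x]) l ≠ ∞ := by
    rw [hα]
    exact ne_top_of_le_ne_top htop (hα.le_total _ _)
  exact (tsum_tsub hα' (hle _)).trans (by rw [hσ, hα])

theorem PassVict.mono {σ τ : Core S A} (hσ : PassVict Sigma.fst σ) (h : ∀ t l, τ t l ≤ σ t l) :
    PassVict (X := Σ k : S.K, S.ar k) Sigma.fst τ := by
  intro R hR
  refine le_antisymm ((iInf_mono fun m => ?_).trans (hσ R hR).le) zero_le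
  refine ENNReal.tsum_le_tsum fun s => ?_
  split_ifs
  · exact ENNReal.tsum_le_tsum (h s)
  · exact le_rfl

/-- A victorious strategy is a countable sum of well-founded play-measures. -/
theorem exists_tsum_eq (hS : S.Finitary) {σ : Core S A} (hσ : Consistent Sigma.fst σ)
    (htop : ∑' l, σ [] l ≠ ∞) (hv : PassVict Sigma.fst σ) :
    ∃ α : ℕ → Core S A, (∀ n, Consistent Sigma.fst (α n)) ∧ (∀ n, WFCore (α n)) ∧
      ∀ t l, σ t l = ∑' n, α n t l := by
  let T := {σ : Core S A // Consistent Sigma.fst σ ∧ ∑' l, σ [] l ≠ ∞ ∧ PassVict Sigma.fst σ}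
  have half : ∀ τ : T, ∃ α : Core S A, Consistent Sigma.fst α ∧ (∀ t l, α t l ≤ τ.1 t l) ∧
      WFCore α ∧ ∑' l, τ.1 [] l ≤ ∑' l, α [] l + 2⁻¹ * ∑' l, τ.1 [] l :=
    fun τ => exists_half hS τ.2.1 τ.2.2.1 τ.2.2.2
  choose α hα hle hwf htot using half
  have hαtop : ∀ τ : T, ∑' l, α τ [] l ≠ ∞ := fun τ =>
    ne_top_of_le_ne_top τ.2.2.1 (ENNReal.tsum_le_tsum (hle τ []))
  -- The remainder after removing a well-founded piece with at least half of the mass. It is again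
  -- consistent, finite and victorious, so the removal can be repeated, and the remaining mass
  -- decays geometrically.
  let next : T → T := fun τ => ⟨fun t l => τ.1 t l - α τ t l,
    τ.2.1.sub (hα τ) (hle τ) (hαtop τ),
    ne_top_of_le_ne_top τ.2.2.1 (ENNReal.tsum_le_tsum fun l => tsub_le_self),
    τ.2.2.2.mono fun t l => tsub_le_self⟩
  let r : ℕ → T := fun n => next^[n] ⟨σ, hσ, htop, hv⟩
  have hr : ∀ n, r (n + 1) = next (r n) := fun n => Function.iterate_succ_apply' _ _ _
  have hw : ∀ n, ∑' l, (r n).1 [] l ≤ 2⁻¹ ^ n * ∑' l, σ [] l := by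
    intro n
    induction n with
    | zero => rw [pow_zero, one_mul]; exact le_rfl
    | succ n ih =>
      rw [hr]
      simp only [next]
      rw [tsum_tsub (hαtop _) (hle _ []), pow_succ', mul_assoc]
      refine (tsub_le_iff_left.2 (htot (r n))).trans ?_
      gcongr
  have hsum : ∀ n t l, σ t l = ∑ i ∈ Finset.range n, α (r i) t l + (r n).1 t l := by
    intro n t l
    induction n with
    | zero => rw [Finset.sum_range_zero, zero_add]; rfl
    | succ n ih =>
      rw [ih, Finset.sum_range_succ, hr, add_assoc]
      simp only [next]
      rw [add_tsub_cancel_of_le (hle _ t l)]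
  refine ⟨fun n => α (r n), fun n => hα _, fun n => hwf _, fun t l => ?_⟩
  refine le_antisymm ?_ ?_
  · have hlim : Filter.Tendsto (fun n => ∑' i, α (r i) t l + 2⁻¹ ^ n * ∑' l, σ [] l)
        Filter.atTop (nhds (∑' i, α (r i) t l + 0 * ∑' l, σ [] l)) :=
      tendsto_const_nhds.add (ENNReal.Tendsto.mul_const
        (ENNReal.tendsto_pow_atTop_nhds_zero_of_lt_one (by simp)) (.inr htop))
    rw [zero_mul, add_zero] at hlim
    refine ge_of_tendsto' hlim fun n => ?_
    rw [hsum n t l]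
    gcongr
    · exact ENNReal.sum_le_tsum _
    · exact ((r n).2.1.le_total t l).trans (hw n)
  · rw [ENNReal.tsum_eq_iSup_nat]
    refine iSup_le fun n => ?_
    rw [hsum n t l]
    exact le_self_add

/-! ### Assembling elements from well-founded pieces -/

namespace TensorAlg

variable (M : TensorAlg False S A)

/-- Well-founded play-measures with total weight `1` are multiples of values of elements. -/
theorem exists_pieces {D : ℕ → Core S A} (hD : ∀ n, Consistent Sigma.fst (D n))
    (hwf : ∀ n, WFCore (D n)) (hsum : ∑' n, ∑' l, D n [] l = 1) :
    ∃ (w : PMF ℕ) (d : ℕ → M.X), ∀ n t l, D n t l = w n * M.core (d n) t l := by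
  let w : PMF ℕ := ⟨fun n => ∑' l, D n [] l, hsum ▸ ENNReal.summable.hasSum⟩
  have h : ∀ n, w n ≠ 0 → ∃ x, ∀ t l, D n t l = w n * M.core x t l := fun n hn =>
    M.exists_core_eq (hwf n) (hD n) False.elim hn (w.apply_ne_top n)
  -- A piece of positive mass supplies the element assigned to pieces of mass zero.
  obtain ⟨n₀, hn₀⟩ := w.support_nonempty
  obtain ⟨x₀, -⟩ := h n₀ hn₀
  have h' : ∀ n, ∃ x, ∀ t l, D n t l = w n * M.core x t l := by
    intro n
    by_cases hn : w n = 0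
    · refine ⟨x₀, fun t l => ?_⟩
      rw [hn, zero_mul]
      exact nonpos_iff_eq_zero.1 (((hD n).le_total t l).trans hn.le)
    · exact h n hn
  choose d hd using h'
  exact ⟨w, d, hd⟩

theorem exists_core_eq_of_vict (hS : S.Finitary) {σ : Core S A} (hσ : Consistent Sigma.fst σ)
    (hw : ∑' l, σ [] l = 1) (hv : PassVict Sigma.fst σ) : ∃ x, M.core x = σ := by
  obtain ⟨α, hα, hwf, hsum⟩ := exists_tsum_eq hS hσ (hw ▸ ENNReal.one_ne_top) hv
  obtain ⟨w, d, h⟩ := M.exists_pieces hα hwf (by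
    rw [ENNReal.tsum_comm, ← hw]
    exact tsum_congr fun l => (hsum [] l).symm)
  refine ⟨M.mean (w.map d), funext fun t => funext fun l => ?_⟩
  rw [M.core_mean_map (adm_false _), hsum]
  exact tsum_congr fun n => (h n t l).symm

end TensorAlg

end Vict

/-! ### Couplings and decompositions of distributions -/

section Coupling

/-- A finite family of distributions has a joint distribution. -/
theorem exists_coupling {ι : Type*} [Finite ι] {Y : Type*} (p : ι → PMF Y) :
    ∃ P : PMF (ι → Y), ∀ j, P.map (fun y => y j) = p j := by
  classical
  have := Fintype.ofFinite ι
  suffices h : ∀ s : Finset ι, ∃ P : PMF (ι → Y), ∀ j ∈ s, P.map (fun y => y j) = p j by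
    obtain ⟨P, hP⟩ := h Finset.univ
    exact ⟨P, fun j => hP j (Finset.mem_univ j)⟩
  intro s
  induction s using Finset.induction_on with
  | empty => exact ⟨PMF.pure fun j => (p j).support_nonempty.some, by simp⟩
  | insert j s hj ih =>
    obtain ⟨P, hP⟩ := ih
    -- The coordinate `j` is redrawn from `p j` independently of the others, which leaves the other
    -- marginals unchanged.
    refine ⟨P.bind fun y => (p j).map (Function.update y j), fun i hi => ?_⟩
    rw [PMF.map_bind]
    by_cases h : i = j
    · subst h
      have : ∀ y : ι → Y, ((p i).map (Function.update y i)).map (fun y => y i) = p i := by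
        intro y
        rw [PMF.map_comp]
        refine (pmf_map_congr fun a _ => ?_).trans (PMF.map_id (p i))
        simp
      simp only [this, PMF.bind_const]
    · have : ∀ y : ι → Y, ((p j).map (Function.update y j)).map (fun y => y i) =
          PMF.pure (y i) := by
        intro y
        rw [PMF.map_comp]
        refine (pmf_map_congr (f' := Function.const _ (y i)) fun a _ => ?_).trans
          (PMF.map_const _ _)
        simp [h]
      simp only [this]
      exact hP i (Finset.mem_of_mem_insert_of_ne hi h)

theorem tsum_increments {f : ℕ → ℝ≥0∞} (hf : Monotone f) (h0 : f 0 = 0) {a : ℝ≥0∞}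
    (ha : Filter.Tendsto f Filter.atTop (nhds a)) : ∑' i, (f (i + 1) - f i) = a := by
  refine tendsto_nhds_unique (ENNReal.tendsto_nat_tsum _) (ha.congr fun n => ?_)
  induction n with
  | zero => rw [h0, Finset.sum_range_zero]
  | succ n ih => rw [Finset.sum_range_succ, ← ih, add_tsub_cancel_of_le (hf (Nat.le_succ n))]

/-- A distribution that is a sum of rows is a mixture of the normalized rows. -/
theorem exists_rows {a : ℕ → ℕ → ℝ≥0∞} {P : PMF ℕ} (h : ∀ n, P n = ∑' i, a i n) :
    ∃ (W : PMF ℕ) (R : ℕ → PMF ℕ), (∀ i, W i = ∑' n, a i n) ∧ (∀ i n, W i * R i n = a i n) ∧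
      W.bind R = P := by
  classical
  have hsum : ∑' i, ∑' n, a i n = 1 := by
    rw [ENNReal.tsum_comm, ← P.tsum_coe]
    exact tsum_congr fun n => (h n).symm
  let W : PMF ℕ := ⟨fun i => ∑' n, a i n, hsum ▸ ENNReal.summable.hasSum⟩
  -- A row of weight zero cannot be normalized and receives an arbitrary distribution.
  let R : ℕ → PMF ℕ := fun i =>
    if hi : W i ≠ 0 then PMF.normalize (a i) hi (W.apply_ne_top i) else PMF.pure 0
  have hR : ∀ i n, W i * R i n = a i n := by
    intro i n
    by_cases hi : W i = 0
    · rw [hi, zero_mul]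
      exact (ENNReal.tsum_eq_zero.1 hi n).symm
    · simp only [R]
      rw [dif_pos hi, PMF.normalize_apply, mul_left_comm]
      exact (congrArg (a i n * ·) (ENNReal.mul_inv_cancel hi (W.apply_ne_top i))).trans (mul_one _)
  refine ⟨W, R, fun i => rfl, hR, ?_⟩
  ext n
  rw [PMF.bind_apply, h]
  exact tsum_congr fun i => hR i n

end Coupling

/-! ### Elements with finitely many plays -/

section FinCore

variable {S : Sig.{u}} {A : Type u}

/-- Finitely many plays are in the support. -/
def FinCore (σ : Core S A) : Prop := {q : Play S × (S.K ⊕ A) | σ q.1 q.2 ≠ 0}.Finite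

theorem FinCore.wfCore {σ : Core S A} (h : FinCore σ) : WFCore σ := by
  obtain ⟨m, hm⟩ := (h.image fun q => q.1.length).bddAbove
  refine WFCore.of_bounded (m := m + 1) fun t l ht => ?_
  by_contra h0
  exact absurd (hm ⟨(t, l), h0, rfl⟩) (not_le.2 ht)

theorem finCore_distPass_pure (a : A) :
    FinCore (distPass (X := Σ k : S.K, S.ar k) (K := S.K) (PMF.pure a)) := by
  refine (Set.finite_singleton ([], .inr a)).subset ?_
  rintro ⟨_ | ⟨x, t⟩, k | b⟩ h
  · exact absurd rfl h
  · have : b = a := by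
      by_contra hb
      exact h (PMF.pure_apply_of_ne _ _ hb)
    rw [this]
    rfl
  · exact absurd rfl h
  · exact absurd rfl h

/-- Finite arity is needed: the plays after `k` form a union over its inputs. -/
theorem FinCore.outPass (k : S.K) [Finite (S.ar k)] {f : S.ar k → Core S A}
    (hf : ∀ i, FinCore (f i)) : FinCore (outPass k f) := by
  refine ((Set.finite_singleton ([], .inl k)).union (Set.finite_iUnion fun i =>
    (hf i).image fun q => (⟨k, i⟩ :: q.1, q.2))).subset ?_
  rintro ⟨_ | ⟨⟨k', i⟩, t⟩, l⟩ h
  · refine .inl ?_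
    have : l = .inl k := by
      by_contra hl
      exact h (outPass_nil_ne hl f)
    rw [this]
    rfl
  · refine .inr ?_
    by_cases hk : k' = k
    · subst hk
      refine Set.mem_iUnion.2 ⟨i, (t, l), ?_, rfl⟩
      have h' : ProbIO.outPass k' f (⟨k', i⟩ :: t) l ≠ 0 := h
      rwa [outPass_cons_self] at h'
    · exact absurd (outPass_cons_ne hk f i t l) h

namespace TensorAlg

variable (M : TensorAlg False S A)

/-- For a finitary signature, each element is a mixture of elements with finitely many plays. -/
theorem exists_eq_mean (hS : S.Finitary) (x : M.X) :
    ∃ P : PMF M.X, x = M.mean P ∧ ∀ u ∈ P.support, FinCore (M.core u) := by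
  refine M.ind (fun x => ∃ P : PMF M.X, x = M.mean P ∧ ∀ u ∈ P.support, FinCore (M.core u))
    (fun a => ?_) (fun k x ih => ?_) (fun d _ ih => ?_) x
  · refine ⟨PMF.pure (M.pt a), (M.mean_pure _).symm, fun u hu => ?_⟩
    rw [(PMF.mem_support_pure_iff _ _).1 hu, core_pt]
    exact finCore_distPass_pure a
  · choose p hp hfin using ih
    have := hS k
    -- The continuations are mixtures `p i`, one for each of the finitely many inputs. A joint
    -- distribution of them can be moved in front of `k` by commutation.
    obtain ⟨P, hP⟩ := exists_coupling p
    refine ⟨P.map (M.req k), ?_, fun u hu => ?_⟩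
    · rw [M.mean_req k P (adm_false _)]
      exact congrArg (M.req k) (funext fun i => by rw [hP]; exact hp i)
    · obtain ⟨y, hy, rfl⟩ := (PMF.mem_support_map_iff _ _ _).1 hu
      rw [core_req]
      refine FinCore.outPass k fun i => hfin i _ ?_
      rw [← hP]
      exact (PMF.mem_support_map_iff _ _ _).2 ⟨y, hy, rfl⟩
  · have : ∀ x, ∃ P : PMF M.X, x = M.mean P ∧
        (x ∈ d.support → ∀ u ∈ P.support, FinCore (M.core u)) := by
      intro x
      by_cases hx : x ∈ d.support
      · obtain ⟨P, h, h'⟩ := ih x hx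
        exact ⟨P, h, fun _ => h'⟩
      · exact ⟨PMF.pure x, (M.mean_pure x).symm, fun h => absurd h hx⟩
    choose P hP hfin using this
    refine ⟨d.bind P, ?_, fun u hu => ?_⟩
    · rw [M.mean_bind (adm_false _) fun _ _ => adm_false _]
      simp only [← hP]
      rw [show (fun x : M.X => x) = id from rfl, PMF.map_id]
    · obtain ⟨x, hx, hu⟩ := (PMF.mem_support_bind_iff _ _ _).1 hu
      exact hfin x hx u hu

/-- The values of a weighted sum of elements. -/
noncomputable def coreSum (f : ℕ → ℝ≥0∞) (u : ℕ → M.X) : Core S A :=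
  fun t l => ∑' n, f n * M.core (u n) t l

theorem core_mean_map_nat (P : PMF ℕ) (u : ℕ → M.X) :
    M.core (M.mean (P.map u)) = M.coreSum P u :=
  funext fun t => funext fun l => M.core_mean_map (adm_false _) u t l

theorem coreSum_consistent (f : ℕ → ℝ≥0∞) (u : ℕ → M.X) :
    Consistent Sigma.fst (M.coreSum f u) := by
  intro t x
  simp only [coreSum]
  rw [ENNReal.tsum_comm]
  refine tsum_congr fun n => ?_
  rw [ENNReal.tsum_mul_left, (M.core_consistent (u n)).1 t x]

theorem tsum_coreSum_nil (f : ℕ → ℝ≥0∞) (u : ℕ → M.X) :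
    ∑' l, M.coreSum f u [] l = ∑' n, f n := by
  simp only [coreSum]
  rw [ENNReal.tsum_comm]
  refine tsum_congr fun n => ?_
  rw [ENNReal.tsum_mul_left, (M.core_consistent (u n)).2, mul_one]

theorem coreSum_mono {f g : ℕ → ℝ≥0∞} (h : ∀ n, f n ≤ g n) (u : ℕ → M.X) (t : Play S)
    (l : S.K ⊕ A) : M.coreSum f u t l ≤ M.coreSum g u t l :=
  ENNReal.tsum_le_tsum fun n => by gcongr; exact h n

theorem coreSum_ne_top (P : PMF ℕ) (u : ℕ → M.X) (t : Play S) (l : S.K ⊕ A) :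
    M.coreSum P u t l ≠ ∞ := by
  refine ne_top_of_le_ne_top ENNReal.one_ne_top
    (((M.coreSum_consistent P u).le_total t l).trans ?_)
  rw [tsum_coreSum_nil, P.tsum_coe]

/-- Each mixture is regrouped as a mixture of its normalized rows. Equality of values forces equal
row masses, and normalized rows coincide because their values are well-founded. The values of the
whole mixtures need not be. -/
theorem mean_eq_of_rows {a b : ℕ → ℕ → ℝ≥0∞} {P Q : PMF ℕ} {u v : ℕ → M.X}
    (hP : ∀ n, P n = ∑' i, a i n) (hQ : ∀ n, Q n = ∑' i, b i n)
    (hcore : ∀ i, M.coreSum (a i) u = M.coreSum (b i) v)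
    (hwf : ∀ i, WFCore (M.coreSum (a i) u)) : M.mean (P.map u) = M.mean (Q.map v) := by
  obtain ⟨W, R, hW, hR, rfl⟩ := exists_rows hP
  obtain ⟨W', R', hW', hR', rfl⟩ := exists_rows hQ
  have e : W = W' := by
    ext i
    rw [hW, hW', ← M.tsum_coreSum_nil _ u, hcore, tsum_coreSum_nil]
  subst e
  have hmul : ∀ (c : ℝ≥0∞) (R : PMF ℕ) (u : ℕ → M.X) (a : ℕ → ℝ≥0∞), (∀ n, c * R n = a n) →
      ∀ t l, c * M.core (M.mean (R.map u)) t l = M.coreSum a u t l := by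
    intro c R u a h t l
    rw [core_mean_map_nat, coreSum, ← ENNReal.tsum_mul_left]
    refine tsum_congr fun n => ?_
    rw [← mul_assoc, h]
  rw [M.mean_map_bind u (adm_false _) fun _ _ => adm_false _,
    M.mean_map_bind v (adm_false _) fun _ _ => adm_false _]
  refine congrArg _ (pmf_map_congr fun i hi => ?_)
  refine M.eq_of_core_eq_of_le (hwf i) (fun t l h => ?_) (funext fun t => funext fun l => ?_)
  · rw [← hmul _ _ _ _ (hR i)]
    exact mul_ne_zero hi h
  · refine (ENNReal.mul_right_inj hi (W.apply_ne_top i)).1 ?_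
    rw [hmul _ _ _ _ (hR i), hmul _ _ _ _ (hR' i), hcore]

/-- Two mixtures agree if they are limits of chains of partial mixtures with the same well-founded
values. -/
theorem mean_eq_of_chains {p q : ℕ → ℕ → ℝ≥0∞} {P Q : PMF ℕ} {u v : ℕ → M.X}
    (hp : ∀ n, Monotone fun i => p i n) (hq : ∀ n, Monotone fun i => q i n)
    (hp0 : ∀ n, p 0 n = 0) (hq0 : ∀ n, q 0 n = 0)
    (hP : ∀ n, Filter.Tendsto (fun i => p i n) Filter.atTop (nhds (P n)))
    (hQ : ∀ n, Filter.Tendsto (fun i => q i n) Filter.atTop (nhds (Q n)))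
    (hcore : ∀ i, M.coreSum (p i) u = M.coreSum (q i) v)
    (hwf : ∀ i, WFCore (M.coreSum (p i) u)) : M.mean (P.map u) = M.mean (Q.map v) := by
  have hadd : ∀ (p : ℕ → ℕ → ℝ≥0∞) (u : ℕ → M.X), (∀ n, Monotone fun i => p i n) → ∀ i t l,
      M.coreSum (p i) u t l + M.coreSum (fun n => p (i + 1) n - p i n) u t l =
        M.coreSum (p (i + 1)) u t l := by
    intro p u hp i t l
    simp only [coreSum]
    rw [← ENNReal.tsum_add]
    refine tsum_congr fun n => ?_
    rw [← add_mul, add_tsub_cancel_of_le (hp n (Nat.le_succ i))]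
  -- The rows are the increments of the two chains. Their values agree by cancelling the earlier
  -- terms, which are finite since they are bounded by values of full mixtures.
  refine M.mean_eq_of_rows (a := fun i n => p (i + 1) n - p i n)
    (b := fun i n => q (i + 1) n - q i n) (fun n => (tsum_increments (hp n) (hp0 n) (hP n)).symm)
    (fun n => (tsum_increments (hq n) (hq0 n) (hQ n)).symm) (fun i => ?_) (fun i => ?_)
  · funext t l
    have hne : M.coreSum (p i) u t l ≠ ∞ := ne_top_of_le_ne_top (M.coreSum_ne_top P u t l)
      (M.coreSum_mono (fun n => (hp n).ge_of_tendsto (hP n) i) u t l)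
    refine (ENNReal.add_right_inj hne).1 ?_
    rw [hadd p u hp, hcore i, hadd q v hq, hcore]
  · refine (hwf (i + 1)).mono fun t l h => ?_
    rw [← hadd p u hp]
    exact fun h0 => h (add_eq_zero.1 h0).2

end TensorAlg

end FinCore

/-! ### Interleaving the truncations of two mixtures -/

section Chains

/-- The first `m` weights, scaled by `c`. -/
noncomputable def trunc (c : ℝ≥0∞) (m : ℕ) (P : ℕ → ℝ≥0∞) (n : ℕ) : ℝ≥0∞ :=
  if n < m then c * P n else 0

theorem tsum_trunc_mul (c : ℝ≥0∞) (m : ℕ) (P g : ℕ → ℝ≥0∞) :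
    ∑' n, trunc c m P n * g n = c * ∑ n ∈ Finset.range m, P n * g n := by
  rw [tsum_eq_sum (s := Finset.range m), Finset.mul_sum]
  · refine Finset.sum_congr rfl fun n hn => ?_
    rw [trunc, if_pos (Finset.mem_range.1 hn), mul_assoc]
  · intro n hn
    rw [trunc, if_neg fun h => hn (Finset.mem_range.2 h), zero_mul]

theorem trunc_mono {c c' : ℝ≥0∞} (hc : c ≤ c') {m m' : ℕ} (hm : m ≤ m') (P : ℕ → ℝ≥0∞) (n : ℕ) :
    trunc c m P n ≤ trunc c' m' P n := by
  rw [trunc, trunc]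
  split_ifs with h h'
  · gcongr
  · exact absurd (h.trans_le hm) h'
  · exact zero_le
  · exact le_rfl

theorem tendsto_trunc {c : ℕ → ℝ≥0∞} (hc : Filter.Tendsto c Filter.atTop (nhds 1)) {m : ℕ → ℕ}
    (hm : Filter.Tendsto m Filter.atTop Filter.atTop) (P : ℕ → ℝ≥0∞) (n : ℕ) :
    Filter.Tendsto (fun i => trunc (c i) (m i) P n) Filter.atTop (nhds (P n)) := by
  have h1 : Filter.Tendsto (fun i => c i * P n) Filter.atTop (nhds (1 * P n)) :=
    ENNReal.Tendsto.mul_const hc (.inl one_ne_zero)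
  rw [one_mul] at h1
  refine h1.congr' ?_
  filter_upwards [hm.eventually_gt_atTop n] with i hi
  rw [trunc, if_pos hi]

theorem tendsto_tsum_trunc {c : ℕ → ℝ≥0∞} (hc : Filter.Tendsto c Filter.atTop (nhds 1))
    {m : ℕ → ℕ} (hm : Filter.Tendsto m Filter.atTop Filter.atTop) (P : PMF ℕ) :
    Filter.Tendsto (fun i => ∑' n, trunc (c i) (m i) P n) Filter.atTop (nhds 1) := by
  have h2 := (ENNReal.tendsto_nat_tsum P).comp hm
  rw [P.tsum_coe] at h2
  have h3 := ENNReal.Tendsto.mul hc (.inl one_ne_zero) h2 (.inl one_ne_zero)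
  rw [one_mul] at h3
  refine h3.congr fun i => ?_
  have := tsum_trunc_mul (c i) (m i) P fun _ => 1
  simp only [mul_one] at this
  exact this.symm

variable {S : Sig.{u}} {A : Type u}

namespace TensorAlg

variable (M : TensorAlg False S A)

theorem finCore_coreSum_trunc (c : ℝ≥0∞) (m : ℕ) (P : ℕ → ℝ≥0∞) {x : ℕ → M.X}
    (hx : ∀ n, FinCore (M.core (x n))) : FinCore (M.coreSum (trunc c m P) x) := by
  refine ((Finset.range m).finite_toSet.biUnion fun n _ => hx n).subset ?_
  intro q hq
  by_contra hc
  refine hq ?_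
  rw [coreSum, tsum_trunc_mul]
  refine mul_eq_zero_of_right _ (Finset.sum_eq_zero fun n hn => ?_)
  have : M.core (x n) q.1 q.2 = 0 := by
    by_contra h
    exact hc (Set.mem_biUnion (Finset.mem_coe.2 hn) h)
  rw [this, mul_zero]

/-- A partial mixture of elements with finitely many plays is dominated by a partial mixture of
another family with the same total values. -/
theorem exists_trunc_le {P Q : PMF ℕ} {x y : ℕ → M.X} (hx : ∀ n, FinCore (M.core (x n)))
    (h : M.coreSum P x = M.coreSum Q y) {c c' : ℝ≥0∞} (hc : c < c') (m : ℕ) :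
    ∃ N, ∀ m' ≥ N, ∀ t l,
      M.coreSum (trunc c m P) x t l ≤ M.coreSum (trunc c' m' Q) y t l := by
  have hle : ∀ t l, M.coreSum (trunc c m P) x t l ≤ c * M.coreSum P x t l := by
    intro t l
    rw [coreSum, tsum_trunc_mul]
    gcongr
    exact ENNReal.sum_le_tsum _
  -- Only finitely many plays have nonzero value on the left. At each of them that value is at most
  -- `c` times the common value, hence strictly below `c'` times it, the limit of the right side;
  -- finitely many such conditions hold together eventually.
  have hev : ∀ᶠ m' in Filter.atTop,
      ∀ q ∈ {q : Play S × (S.K ⊕ A) | M.coreSum (trunc c m P) x q.1 q.2 ≠ 0},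
        M.coreSum (trunc c m P) x q.1 q.2 ≤ M.coreSum (trunc c' m' Q) y q.1 q.2 := by
    refine (Filter.eventually_all_finite (M.finCore_coreSum_trunc c m P hx)).2 fun q hq => ?_
    have h0 : M.coreSum P x q.1 q.2 ≠ 0 := fun h0 => hq (by
      have := hle q.1 q.2
      rwa [h0, mul_zero, nonpos_iff_eq_zero] at this)
    have hlt : M.coreSum (trunc c m P) x q.1 q.2 < c' * M.coreSum Q y q.1 q.2 := by
      refine (hle _ _).trans_lt ?_
      rw [← h]
      exact ENNReal.mul_lt_mul_left h0 (M.coreSum_ne_top P x _ _) hc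
    have hlim : Filter.Tendsto (fun m' => M.coreSum (trunc c' m' Q) y q.1 q.2) Filter.atTop
        (nhds (c' * M.coreSum Q y q.1 q.2)) := by
      simp only [coreSum, tsum_trunc_mul]
      refine ENNReal.Tendsto.const_mul (ENNReal.tendsto_nat_tsum _) (.inl ?_)
      rw [show ∑' n, Q n * M.core (y n) q.1 q.2 = M.coreSum Q y q.1 q.2 from rfl, ← h]
      exact h0
    exact (hlim.eventually_const_lt hlt).mono fun _ => le_of_lt
  obtain ⟨N, hN⟩ := Filter.eventually_atTop.1 hev
  refine ⟨N, fun m' hm' t l => ?_⟩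
  by_cases h0 : M.coreSum (trunc c m P) x t l = 0
  · rw [h0]
    exact zero_le
  · exact hN m' hm' (t, l) h0

/-- Mixtures of elements with finitely many plays are determined by their values. -/
theorem mean_eq_of_coreSum_eq {P Q : PMF ℕ} {x y : ℕ → M.X} (hx : ∀ n, FinCore (M.core (x n)))
    (hy : ∀ n, FinCore (M.core (y n))) (h : M.coreSum P x = M.coreSum Q y) :
    M.mean (P.map x) = M.mean (Q.map y) := by
  -- Strictly increasing scale factors give each truncation room to be dominated by a later
  -- truncation of the other mixture.
  obtain ⟨c, hc, -, hclim⟩ := exists_seq_strictMono_tendsto' (zero_lt_one (α := ℝ≥0∞))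
  have hstep : ∀ i m, ∃ N, ∀ m' ≥ N, ∀ t l,
      M.coreSum (trunc (c i) m P) x t l ≤ M.coreSum (trunc (c (i + 1)) m' Q) y t l ∧
      M.coreSum (trunc (c i) m Q) y t l ≤ M.coreSum (trunc (c (i + 1)) m' P) x t l := by
    intro i m
    obtain ⟨N, hN⟩ := M.exists_trunc_le hx h (hc (Nat.lt_succ_self i)) m
    obtain ⟨N', hN'⟩ := M.exists_trunc_le hy h.symm (hc (Nat.lt_succ_self i)) m
    exact ⟨max N N', fun m' hm' t l => ⟨hN m' ((le_max_left _ _).trans hm') t l,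
      hN' m' ((le_max_right _ _).trans hm') t l⟩⟩
  choose N hN using hstep
  -- The cut-off `0` makes both chains start at zero, and the term `r + 1` drives the cut-offs to
  -- infinity.
  let m : ℕ → ℕ := fun i => Nat.rec 0 (fun i r => max (N i r) (r + 1)) i
  have hmsucc : ∀ i, m (i + 1) = max (N i (m i)) (m i + 1) := fun i => rfl
  have hmmono : StrictMono m := strictMono_nat_of_lt_succ fun i => by
    rw [hmsucc]
    exact lt_of_lt_of_le (Nat.lt_succ_self _) (le_max_right _ _)
  have hmlim := hmmono.tendsto_atTop
  let p : ℕ → ℕ → ℝ≥0∞ := fun i => trunc (c i) (m i) P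
  let q : ℕ → ℕ → ℝ≥0∞ := fun i => trunc (c i) (m i) Q
  have hp : ∀ n, Monotone fun i => p i n := fun n i j hij =>
    trunc_mono (hc.monotone hij) (hmmono.monotone hij) P n
  have hq : ∀ n, Monotone fun i => q i n := fun n i j hij =>
    trunc_mono (hc.monotone hij) (hmmono.monotone hij) Q n
  have hp0 : ∀ n, p 0 n = 0 := fun n => if_neg (Nat.not_lt_zero n)
  have hq0 : ∀ n, q 0 n = 0 := fun n => if_neg (Nat.not_lt_zero n)
  have hpq : ∀ i t l, M.coreSum (p i) x t l ≤ M.coreSum (q (i + 1)) y t l := fun i t l =>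
    (hN i (m i) (m (i + 1)) (le_max_left _ _) t l).1
  have hqp : ∀ i t l, M.coreSum (q i) y t l ≤ M.coreSum (p (i + 1)) x t l := fun i t l =>
    (hN i (m i) (m (i + 1)) (le_max_left _ _) t l).2
  have hzero : ∀ (f : ℕ → ℝ≥0∞) (u : ℕ → M.X), (∀ n, f n = 0) → ∀ t l, M.coreSum f u t l = 0 :=
    fun f u hf t l => ENNReal.tsum_eq_zero.2 fun n => by rw [hf, zero_mul]
  -- The interleaved chain `p 0 ≤ q 1 ≤ p 2 ≤ q 3 ≤ …` of values, with total mass tending to `1`.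
  let B : ℕ → Core S A := fun j =>
    if Even j then M.coreSum (p j) x else M.coreSum (q j) y
  have hBe : ∀ j, Even j → B j = M.coreSum (p j) x := fun j hj => if_pos hj
  have hBo : ∀ j, ¬ Even j → B j = M.coreSum (q j) y := fun j hj => if_neg hj
  have hBfin : ∀ j, FinCore (B j) := by
    intro j
    by_cases hj : Even j
    · rw [hBe j hj]
      exact M.finCore_coreSum_trunc _ _ _ hx
    · rw [hBo j hj]
      exact M.finCore_coreSum_trunc _ _ _ hy
  have hBcons : ∀ j, Consistent Sigma.fst (B j) := by
    intro j
    by_cases hj : Even j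
    · rw [hBe j hj]
      exact M.coreSum_consistent _ _
    · rw [hBo j hj]
      exact M.coreSum_consistent _ _
  have hBmono : ∀ t l, Monotone fun j => B j t l := by
    intro t l
    refine monotone_nat_of_le_succ fun j => ?_
    by_cases hj : Even j
    · rw [hBe j hj, hBo (j + 1) (by rwa [Nat.even_add_one, not_not])]
      exact hpq j t l
    · rw [hBo j hj, hBe (j + 1) (by rwa [Nat.even_add_one])]
      exact hqp j t l
  have hB0 : ∀ t l, B 0 t l = 0 := fun t l => by
    rw [hBe 0 (by simp)]
    exact hzero _ _ hp0 t l
  have hBtot : Filter.Tendsto (fun j => ∑' l, B j [] l) Filter.atTop (nhds 1) := by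
    have h1 := tendsto_tsum_trunc hclim hmlim P
    have h2 := tendsto_tsum_trunc hclim hmlim Q
    refine (Filter.Tendsto.if' (p := Even) h1 h2).congr fun j => ?_
    by_cases hj : Even j
    · rw [if_pos hj, hBe j hj, tsum_coreSum_nil]
    · rw [if_neg hj, hBo j hj, tsum_coreSum_nil]
  have hBtmono : Monotone fun j => ∑' l, B j [] l := fun i j hij =>
    ENNReal.tsum_le_tsum fun l => hBmono [] l hij
  have hBtop : ∀ j, ∑' l, B j [] l ≠ ∞ := fun j =>
    ne_top_of_le_ne_top ENNReal.one_ne_top (hBtmono.ge_of_tendsto hBtot j)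
  -- The increments of `B` are consistent, well-founded and of total mass `1` together, so they are
  -- the weighted values of elements `d`. This is the third mixture, whose first `k` components have
  -- values `B k`.
  obtain ⟨w, d, hwd⟩ := M.exists_pieces (D := fun j t l => B (j + 1) t l - B j t l)
    (fun j => (hBcons (j + 1)).sub (hBcons j) (fun t l => hBmono t l (Nat.le_succ j)) (hBtop j))
    (fun j => (hBfin (j + 1)).wfCore.mono fun t l h0 h1 => h0 (by
      simp only [h1, zero_tsub]))
    (by
      have : ∀ j, ∑' l, (B (j + 1) [] l - B j [] l) = ∑' l, B (j + 1) [] l - ∑' l, B j [] l :=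
        fun j => tsum_tsub (hBtop j) fun l => hBmono [] l (Nat.le_succ j)
      simp only [this]
      exact tsum_increments hBtmono (by simp only [hB0, tsum_zero]) hBtot)
  have hsum : ∀ k, M.coreSum (trunc 1 k w) d = B k := by
    intro k
    funext t l
    rw [coreSum, tsum_trunc_mul, one_mul]
    induction k with
    | zero => rw [Finset.sum_range_zero, hB0]
    | succ k ih =>
      rw [Finset.sum_range_succ, ih, ← hwd, add_tsub_cancel_of_le (hBmono t l (Nat.le_succ k))]
  have hone : Filter.Tendsto (fun _ : ℕ => (1 : ℝ≥0∞)) Filter.atTop (nhds 1) :=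
    tendsto_const_nhds
  -- Along indices `φ i` where `B` consists of partial mixtures of `R`, the chains for `R` and for
  -- `w` have the same well-founded values, so `mean_eq_of_chains` identifies the two mixtures.
  have main : ∀ (φ : ℕ → ℕ) (r : ℕ → ℕ → ℝ≥0∞) (R : PMF ℕ) (u : ℕ → M.X), Monotone φ → φ 0 = 0 →
      Filter.Tendsto φ Filter.atTop Filter.atTop → (∀ n, Monotone fun i => r i n) →
      (∀ n, r 0 n = 0) → (∀ n, Filter.Tendsto (fun i => r i n) Filter.atTop (nhds (R n))) →
      (∀ i, M.coreSum (r (φ i)) u = B (φ i)) → M.mean (R.map u) = M.mean (w.map d) := by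
    intro φ r R u hφ hφ0 hφlim hr hr0 hrlim hrB
    refine M.mean_eq_of_chains (p := fun i => r (φ i)) (q := fun i => trunc 1 (φ i) w)
      (fun n i j hij => hr n (hφ hij)) (fun n i j hij => trunc_mono le_rfl (hφ hij) w n)
      (fun n => ?_) (fun n => ?_) (fun n => (hrlim n).comp hφlim)
      (fun n => tendsto_trunc hone hφlim w n) (fun i => ?_) fun i => ?_
    · simp only [hφ0, hr0]
    · simp only [hφ0]
      exact if_neg (Nat.not_lt_zero n)
    · rw [hsum, hrB]
    · rw [hrB]
      exact (hBfin _).wfCore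
  -- Even indices serve `P` and odd ones `Q`. In `2 * i - 1` the subtraction is truncated, so the
  -- second sequence also starts at `0`, where both chains vanish.
  refine (main (fun i => 2 * i) p P x (fun i j h => ?_) rfl ?_ hp hp0
    (tendsto_trunc hclim hmlim P) fun i => ?_).trans
    (main (fun i => 2 * i - 1) q Q y (fun i j h => ?_) rfl ?_ hq hq0
      (tendsto_trunc hclim hmlim Q) fun i => ?_).symm
  · exact Nat.mul_le_mul_left 2 h
  · exact Filter.tendsto_atTop_mono (fun i => by simp only [id]; omega) Filter.tendsto_id
  · rw [hBe _ (even_two_mul i)]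
  · exact Nat.sub_le_sub_right (Nat.mul_le_mul_left 2 h) 1
  · exact Filter.tendsto_atTop_mono (fun i => by simp only [id]; omega) Filter.tendsto_id
  · rcases i with _ | i
    · funext t l
      rw [hB0]
      exact hzero _ _ hq0 t l
    · rw [hBo _ (by
        rw [Nat.even_iff]
        omega)]

/-- The values of a general element are not well-founded, so induction is unavailable. Both elements
are rewritten as countable mixtures of elements with finitely many plays, and these mixtures are
compared by `mean_eq_of_coreSum_eq`. -/
theorem core_injective (hS : S.Finitary) : Function.Injective M.core := by
  intro x y h
  obtain ⟨P, rfl, hP⟩ := M.exists_eq_mean hS x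
  obtain ⟨Q, rfl, hQ⟩ := M.exists_eq_mean hS y
  obtain ⟨P, x, rfl, hx⟩ := exists_nat_map P
  obtain ⟨Q, y, rfl, hy⟩ := exists_nat_map Q
  refine M.mean_eq_of_coreSum_eq (fun n => hP _ (hx n)) (fun n => hQ _ (hy n)) ?_
  rwa [core_mean_map_nat, core_mean_map_nat] at h

end TensorAlg

theorem presents_vict {S : Sig.{u}} (hS : S.Finitary) :
    (Theory.tensorExt omegaConvexTheory S).Presents (Vict S) (Vict.gen S) := by
  refine presents_strategies OmegaConvexEqn.isDistTheory (fun A σ => σ.1.core)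
    (fun A σ τ h => ?_) (fun a => ?_) (fun c f => ?_) (fun k f => ?_) (fun x y h _ => ?_)
    fun m => ?_
  · exact Subtype.ext (Strategy.ext_core fun t l => congrFun (congrFun h t) l)
  · exact Strategy.core_dist _
  · exact Strategy.core_dist_subst _ _
  · exact Strategy.core_req_subst _ _
  · exact TensorAlg.core_injective _ hS h
  · exact TensorAlg.exists_core_eq_of_vict _ hS m.1.core_consistent m.1.core_weight
      ((vict_iff_core _).1 m.2)

end Chains

end ProbIO

theorem mainTheorem7 (S : ProbIO.Sig.{u}) :
    ProbIO.IsFreeExtension ProbIO.convexTheory.{u} S ProbIO.FinDist.{u} ProbIO.FinDist.gen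
      (ProbIO.ProgBisim ProbIO.binaryChoice.{u} S) (ProbIO.ProgBisim.gen ProbIO.binaryChoice.{u} S) ∧
    ProbIO.IsFreeExtension ProbIO.omegaConvexTheory.{u} S PMF.{u} ProbIO.distGen
      (ProbIO.ProgBisim ProbIO.countableChoice.{u} S)
      (ProbIO.ProgBisim.gen ProbIO.countableChoice.{u} S) ∧
    ProbIO.IsFreeTensorialExtension ProbIO.convexTheory.{u} S ProbIO.FinDist.{u} ProbIO.FinDist.gen
      (ProbIO.FinFound S) (ProbIO.FinFound.gen S) ∧
    (S.Finitary →
      ProbIO.IsFreeTensorialExtension ProbIO.omegaConvexTheory.{u} S PMF.{u} ProbIO.distGen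
        (ProbIO.Vict S) (ProbIO.Vict.gen S)) :=
  ⟨⟨ProbIO.presents_finDist, ProbIO.presents_progBisim ProbIO.ConvexEqn.isDistTheory⟩,
    ⟨ProbIO.presents_pmf, ProbIO.presents_progBisim ProbIO.OmegaConvexEqn.isDistTheory⟩,
    ⟨ProbIO.presents_finDist, ProbIO.presents_finFound S⟩,
    fun hS => ⟨ProbIO.presents_pmf, ProbIO.presents_vict hS⟩⟩
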